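/- **Notation.** Let $1\le n<N$ be integers, $|\cdot|$ the Euclidean norm, $d(x,y)=|x-y|$, $d(x,E)=\inf_{y\in E}d(x,y)$, $d(E,E')=\inf_{x\in E}d(x,E')$; $B(x,r)$ is the closed ball, and balls are written as pairs $(x,r)$. $\mathcal P(N,n)$ is the set of $n$-dimensional affine planes of $\mathbb R^N$; the angle $\varangle(P,P')$ of two planes is the operator norm of the difference of the orthogonal projections onto the linear subspaces parallel to $P$ and $P'$. $\mathcal H^n$ is $n$-dimensional Hausdorff measure (equal to Lebesgue measure on $n$-dimensional planes). An $n$-simplex $\Delta(x_0,\dots,x_n)$ is an $(n,\sigma)$-simplex if $d(x_i,\operatorname{aff}\{x_j:j\ne i\})\ge\sigma$ for all $i$. For a Borel measure $\mu$, $k>1$, $t>0$ put $\delta_\mu(x,t)=\mu(B(x,t))/t^n$, $\beta^P_{1;k}(x,t)=t^{-n}\int_{B(x,kt)}\frac{d(y,P)}t\,d\mu(y)$ and $\beta_{1;k}(x,t)=\inf_{P\in\mathcal P(N,n)}\beta^P_{1;k}(x,t)$. For $\mathcal K:(\mathbb R^N)^{n+2}\to[0,\infty)$ and $p>1$ put $\mathcal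 M_{\mathcal K^p}(\mu)=\int\!\cdots\!\int\mathcal K^p(x_0,\dots,x_{n+1})\,d\mu(x_0)\cdots d\mu(x_{n+1})$. $\mathcal K^p$ is a *symmetric $\mu$-proper integrand* if $\mathcal K$ is invariant under permutations of its arguments and $\mu^{n+2}$-measurable; there are $c,l\ge1$ such that $\big(d(w,\operatorname{aff}(x_0,\dots,x_n))/t\big)^p\le c\,C^l\,t^{n(n+1)}\mathcal K^p(x_0,\dots,x_n,w)$ for all $t>0$, $C\ge1$, $x\in\mathbb R^N$, all $(n,t/C)$-simplices $\Delta(x_0,\dots,x_n)\subset B(x,Ct)$ and all $w\in B(x,Ct)$; $t^{n(n+1)}\mathcal K^p(tx_0,\dots,tx_{n+1})=\mathcal K^p(x_0,\dots,x_{n+1})$ for $t>0$; and $\mathcal K$ is invariant under simultaneous translation of its arguments. **Setting.** Let $C_0\ge10$, $p\in(1,\infty)$, $k>2$, $\eta>0$, $P_0$ an $n$-dimensional linear subspace of $\mathbb R^N$, and $\mu$ a Borel measure on $\mathbb R^N$ with compact support $F$ such that $\mathcal K^p$ is a symmetric $\mu$-proper integrand and (A) $\mu(B(0,5))\ge1$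 and $\mu(\mathbb R^N\setminus B(0,5))=0$; (B) $\mu(B)\le C_0(\operatorname{diam}B)^n$ for every ball $B$; (C) $\mathcal M_{\mathcal K^p}(\mu)\le\eta$; (D) $\beta^{P_0}_{1;k}(0,5)\le\eta$. **Construction of $A$.** Let $\alpha,\varepsilon>0$ and $\delta=\min\{10^{-10}/(600^nN_0),\,2/50^n\}$, where $N_0=N_0(N)$ is the (least) constant of Besicovitch's covering theorem in $\mathbb R^N$. Let $S_{total}$ be the set of all $(x,t)\in F\times(0,50)$ with $\delta_\mu(x,t)\ge\delta/2$ and $\beta_{1;k}(x,t)<2\varepsilon$ for which there is a plane $P_{(x,t)}\in\mathcal P(N,n)$ with $\beta_{1;k}^{P_{(x,t)}}(x,t)\le2\varepsilon$ and $\varangle(P_{(x,t)},P_0)\le\alpha$; fix such planes. For $x\in F$ let $h(x)=\sup(H(x)\cup\{0\})$, where $H(x)$ is the set of $t\in(0,50)$ such that $(y,\tau)\notin S_{total}$ for some $y\in F$ and some $\tau\in[\frac t4,\frac t3]$ with $d(x,y)<\tau/3$. Let $S=\{(x,t)\in S_{total}: t\ge h(x)\}$, $\mathcal Z=\{x\in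 F: h(x)=0\}$, let $\pi,\pi^\perp$ be the orthogonal projections onto $P_0,P_0^\perp$, and $d(x)=\inf_{(X,t)\in S}(d(X,x)+t)$ for $x\in\mathbb R^N$, $D(y)=\inf_{\pi(x)=y}d(x)$ for $y\in P_0$. Let $R_i$, $i\in I$, be the maximal ones among the dyadic cells $Q$ of $P_0$ (with respect to a fixed orthonormal basis of $P_0$) that satisfy $\operatorname{diam}Q\le\frac1{20}\inf_{u\in Q}D(u)$. For $l>0$ put $U_l=B(0,l)\cap P_0$, and let $I_{12}=\{i\in I: R_i\cap U_{12}\ne\emptyset\}$. For $i\in I_{12}$ choose $(X_i,t_i)\in S$ such that $B_i=B(X_i,t_i)$ satisfies $\operatorname{diam}R_i\le\operatorname{diam}B_i\le200\operatorname{diam}R_i$ and $d(\pi(B_i),R_i)\le100\operatorname{diam}R_i$; let $A_i:P_0\to P_0^\perp$ be the affine map with graph $P_{(X_i,t_i)}$; and choose $\tilde\phi_i\in C^\infty(P_0)$ with $0\le\tilde\phi_i\le1$, $\tilde\phi_i=1$ on $2R_i$, $\tilde\phi_i=0$ outside $3R_i$ and $\|D^m\tilde\phi_i\|\le b/(\operatorname{diam}R_i)^m$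 for $m=1,2$, where $b\ge b_1(n)$ is a constant fixed beforehand, depending only on $n$ ($rR_i$ is the cube with the centre and orientation of $R_i$ and $r$ times its diameter). Put $\phi_i=\tilde\phi_i/\sum_{j\in I_{12}}\tilde\phi_j$ and define $A:U_{12}\to P_0^\perp$ by $$A(a)=\pi^\perp\big((\pi|_{\mathcal Z})^{-1}(a)\big)\ \text{ for } a\in\pi(\mathcal Z),\qquad A(a)=\sum_{i\in I_{12}}\phi_i(a)A_i(a)\ \text{ for } a\in U_{12}\setminus\pi(\mathcal Z).$$ For $q\in U_{10}$ and $0<t<2$ let $$\gamma_A(q,t)=\inf_a\frac1{t^n}\int_{B(q,t)\cap P_0}\frac{d(A(u),a(u))}t\,d\mathcal H^n(u),$$ the infimum being taken over all affine maps $a:P_0\to P_0^\perp$. **Theorem.** There exist $\tilde k\ge4$ and, for every $n$, some $\tilde\alpha=\tilde\alpha(n)>0$ (and $b_1(n)>0$) such that for all $0<\alpha\le\tilde\alpha$ there is $\tilde\varepsilon=\tilde\varepsilon(N,n,C_0,\alpha)>0$ such that, in the above setting, if $k\ge\tilde k$ and $\eta\le\tilde\varepsilon^p$, then for every $\varepsilon\in[\eta^{1/p},\tilde\varepsilon]$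 the choices in the construction are possible, and for every function $A$ constructed in this way $$\int_{U_{10}}\int_0^2\gamma_A(q,t)^p\,\frac{dt}t\,d\mathcal H^n(q)\ \le\ C\varepsilon^p+C\,\mathcal M_{\mathcal K^p}(\mu)\ \le\ C'\varepsilon^p$$ with constants $C,C'$ that depend only on $N,n,\mathcal K,p,C_0,k$ (the constants $\tilde\varepsilon,C,C'$ may also depend on the fixed constant $b$). -/

import Mathlib

open MeasureTheory Metric Set Module
open scoped ENNReal NNReal

namespace MengerGraph

noncomputable section

/-- The Euclidean space `ℝ^N`. -/
abbrev Euc (N : ℕ) : Type := EuclideanSpace ℝ (Fin N)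

/-! ### Planes, angles, simplices -/

/-- `P` is an `n`-dimensional affine plane of `ℝ^N`. -/
def IsPlane {N : ℕ} (n : ℕ) (P : AffineSubspace ℝ (Euc N)) : Prop :=
  (P : Set (Euc N)).Nonempty ∧ finrank ℝ P.direction = n

/-- The angle between two linear subspaces: the operator norm of the difference of the orthogonal
projections. The angle of two affine planes is the angle of their directions. -/
def angle {N : ℕ} (G₁ G₂ : Submodule ℝ (Euc N)) : ℝ :=
  ‖G₁.starProjection - G₂.starProjection‖

/-- The points `x 0, …, x n` are the vertices of an `(n, σ)`-simplex: an `n`-simplex all of whose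
heights are at least `σ`. -/
def IsFatSimplex {N : ℕ} (n : ℕ) (σ : ℝ) (x : Fin (n + 1) → Euc N) : Prop :=
  AffineIndependent ℝ x ∧
    ∀ i, σ ≤ infDist (x i) (affineSpan ℝ (x '' {j | j ≠ i}) : Set (Euc N))

/-! ### Integrands and integral Menger curvature -/

/-- `K ^ p` is a `μ`-proper integrand on `(ℝ^N)^(n+2)`. -/
structure IsProperIntegrand {N : ℕ} (n : ℕ) (p : ℝ) (K : (Fin (n + 2) → Euc N) → ℝ≥0)
    (μ : Measure (Euc N)) : Prop where
  aemeasurable : AEMeasurable K (Measure.pi fun _ : Fin (n + 2) => μ)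
  lower_bound : ∃ c l : ℝ, 1 ≤ c ∧ 1 ≤ l ∧ ∀ t C : ℝ, 0 < t → 1 ≤ C →
    ∀ (z : Euc N) (x : Fin (n + 1) → Euc N), IsFatSimplex n (t / C) x →
      convexHull ℝ (range x) ⊆ closedBall z (C * t) →
      ∀ w ∈ closedBall z (C * t),
        (infDist w (affineSpan ℝ (range x) : Set (Euc N)) / t) ^ p ≤
          c * C ^ l * t ^ (n * (n + 1)) * (K (Fin.snoc (α := fun _ => Euc N) x w) : ℝ) ^ p
  scaling : ∀ t : ℝ, 0 < t → ∀ x : Fin (n + 2) → Euc N,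
    t ^ (n * (n + 1)) * (K fun i => t • x i : ℝ) ^ p = (K x : ℝ) ^ p
  translation : ∀ (b : Euc N) (x : Fin (n + 2) → Euc N), (K fun i => x i + b) = K x

/-- The integral Menger curvature of `μ` with integrand `K ^ p`. -/
def mengerCurvature {N : ℕ} (n : ℕ) (p : ℝ) (K : (Fin (n + 2) → Euc N) → ℝ≥0)
    (μ : Measure (Euc N)) : ℝ≥0∞ :=
  ∫⁻ x, (K x : ℝ≥0∞) ^ p ∂(Measure.pi fun _ : Fin (n + 2) => μ)

/-! ### Measure quotient and `β`-numbers -/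

/-- The measure quotient `δ(B(x,t)) = μ(B(x,t)) / t^n`. -/
def quotient {N : ℕ} (n : ℕ) (μ : Measure (Euc N)) (x : Euc N) (t : ℝ) : ℝ≥0∞ :=
  μ (closedBall x t) / ENNReal.ofReal (t ^ n)

/-- The number `β_{1;k}^P(x,t) = t^(-n) ∫_{B(x,kt)} d(y,P)/t dμ(y)`. -/
def betaPlane {N : ℕ} (n : ℕ) (k : ℝ) (μ : Measure (Euc N)) (P : AffineSubspace ℝ (Euc N))
    (x : Euc N) (t : ℝ) : ℝ≥0∞ :=
  (∫⁻ y in closedBall x (k * t), ENNReal.ofReal (infDist y (P : Set (Euc N)) / t) ∂μ) /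
    ENNReal.ofReal (t ^ n)

/-- The number `β_{1;k}(x,t)`: the infimum of `β_{1;k}^P(x,t)` over all `n`-dimensional planes. -/
def beta {N : ℕ} (n : ℕ) (k : ℝ) (μ : Measure (Euc N)) (x : Euc N) (t : ℝ) : ℝ≥0∞ :=
  ⨅ (P : AffineSubspace ℝ (Euc N)) (_ : IsPlane n P), betaPlane n k μ P x t

/-! ### The standing assumptions -/

/-- The standing assumptions on the measure `μ` and the plane `P₀`. -/
structure IsSetting {N : ℕ} (n : ℕ) (p : ℝ) (K : (Fin (n + 2) → Euc N) → ℝ≥0) (C₀ k η : ℝ)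
    (P₀ : Submodule ℝ (Euc N)) (μ : Measure (Euc N)) : Prop where
  finrank_eq : finrank ℝ P₀ = n
  isCompact_support : IsCompact μ.support
  proper : IsProperIntegrand n p K μ
  symmetric : ∀ (σ : Equiv.Perm (Fin (n + 2))) (x : Fin (n + 2) → Euc N), K (x ∘ σ) = K x
  one_le_measure : 1 ≤ μ (closedBall 0 5)
  measure_compl : μ (closedBall 0 5)ᶜ = 0
  upper_regular : ∀ (x : Euc N) (r : ℝ), 0 < r →
    μ (closedBall x r) ≤ ENNReal.ofReal (C₀ * diam (closedBall x r) ^ n)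
  curvature_le : mengerCurvature n p K μ ≤ ENNReal.ofReal η
  beta_le : betaPlane n k μ P₀.toAffineSubspace 0 5 ≤ ENNReal.ofReal η

/-! ### The constant of Besicovitch's covering theorem -/

/-- `m` families suffice in Besicovitch's covering theorem in `ℝ^N`: every collection `F` of
nondegenerate closed balls (given as pairs of centre and radius) of bounded radii has countable
disjoint subfamilies `G 0, …, G (m-1)` which together cover all the centres. -/
def IsBesicovitchNumber (N m : ℕ) : Prop :=
  ∀ F : Set (Euc N × ℝ), (∀ B ∈ F, 0 < B.2) → (∃ R : ℝ, ∀ B ∈ F, B.2 ≤ R) →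
    ∃ G : Fin m → Set (Euc N × ℝ),
      (∀ i, G i ⊆ F ∧ (G i).Countable ∧
        (G i).PairwiseDisjoint fun B => closedBall B.1 B.2) ∧
      Prod.fst '' F ⊆ ⋃ i, ⋃ B ∈ G i, closedBall B.1 B.2

theorem exists_isBesicovitchNumber (N : ℕ) : ∃ m, IsBesicovitchNumber N m := by
  obtain ⟨m, τ, hτ, hm⟩ := HasBesicovitchCovering.no_satelliteConfig (α := Euc N)
  refine ⟨m, fun F hpos hR => ?_⟩
  obtain ⟨R, hR⟩ := hR
  let q : Besicovitch.BallPackage F (Euc N) :=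
    { c := fun B => B.1.1
      r := fun B => B.1.2
      rpos := fun B => hpos B.1 B.2
      r_bound := R
      r_le := fun B => hR B.1 B.2 }
  obtain ⟨s, hs, hcov⟩ := Besicovitch.exist_disjoint_covering_families hτ hm q
  have hdisj : ∀ i, (Subtype.val '' s i).PairwiseDisjoint
      fun B : Euc N × ℝ => closedBall B.1 B.2 := by
    rintro i _ ⟨a, ha, rfl⟩ _ ⟨b, hb, rfl⟩ hab
    exact hs i ha hb fun h => hab (congrArg _ h)
  refine ⟨fun i => Subtype.val '' s i, fun i => ⟨?_, ?_, hdisj i⟩, ?_⟩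
  · rintro _ ⟨a, -, rfl⟩
    exact a.2
  · refine (hdisj i).countable_of_nonempty_interior ?_
    rintro _ ⟨a, -, rfl⟩
    exact ⟨a.1.1, ball_subset_interior_closedBall (mem_ball_self (hpos a.1 a.2))⟩
  · rintro _ ⟨B, hB, rfl⟩
    have h := hcov ⟨⟨B, hB⟩, rfl⟩
    simp only [mem_iUnion] at h ⊢
    obtain ⟨i, j, hj, hx⟩ := h
    exact ⟨i, j.1, ⟨j, hj, rfl⟩, ball_subset_closedBall hx⟩

/-- The Besicovitch constant `N₀ = N₀(N)`. -/
def besicovitchNumber (N : ℕ) : ℕ := sInf {m | IsBesicovitchNumber N m}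

/-- The constant `δ = min {10^(-10) / (600^n N₀), 2 / 50^n}`. -/
def deltaConst (N n : ℕ) : ℝ :=
  min (1 / 10 ^ 10 / (600 ^ n * besicovitchNumber N)) (2 / 50 ^ n)

/-! ### Good balls and the set `Z` -/

/-- `P` is an admissible plane `P_{(x,t)}` for the ball `B(x,t)`. -/
def IsGoodPlane {N : ℕ} (n : ℕ) (k α ε : ℝ) (P₀ : Submodule ℝ (Euc N)) (μ : Measure (Euc N))
    (B : Euc N × ℝ) (P : AffineSubspace ℝ (Euc N)) : Prop :=
  IsPlane n P ∧ betaPlane n k μ P B.1 B.2 ≤ ENNReal.ofReal (2 * ε) ∧ angle P.direction P₀ ≤ α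

/-- The set `S_total`. A ball `B(x,t)` is identified with the pair `(x,t)`. -/
def STotal {N : ℕ} (n : ℕ) (k α ε : ℝ) (P₀ : Submodule ℝ (Euc N)) (μ : Measure (Euc N)) :
    Set (Euc N × ℝ) :=
  {B | B.1 ∈ μ.support ∧ B.2 ∈ Ioo (0 : ℝ) 50 ∧
    ENNReal.ofReal (deltaConst N n / 2) ≤ quotient n μ B.1 B.2 ∧
    beta n k μ B.1 B.2 < ENNReal.ofReal (2 * ε) ∧
    ∃ P, IsGoodPlane n k α ε P₀ μ B P}

/-- The set `H(x)`. -/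
def badScales {N : ℕ} (n : ℕ) (k α ε : ℝ) (P₀ : Submodule ℝ (Euc N)) (μ : Measure (Euc N))
    (x : Euc N) : Set ℝ :=
  {t | t ∈ Ioo (0 : ℝ) 50 ∧ ∃ y ∈ μ.support, ∃ τ : ℝ, t / 4 ≤ τ ∧ τ ≤ t / 3 ∧
    dist x y < τ / 3 ∧ (y, τ) ∉ STotal n k α ε P₀ μ}

/-- The function `h`. -/
def hFun {N : ℕ} (n : ℕ) (k α ε : ℝ) (P₀ : Submodule ℝ (Euc N)) (μ : Measure (Euc N))
    (x : Euc N) : ℝ :=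
  sSup (badScales n k α ε P₀ μ x ∪ {0})

/-- The set `S` of good balls. -/
def goodBalls {N : ℕ} (n : ℕ) (k α ε : ℝ) (P₀ : Submodule ℝ (Euc N)) (μ : Measure (Euc N)) :
    Set (Euc N × ℝ) :=
  {B | B ∈ STotal n k α ε P₀ μ ∧ hFun n k α ε P₀ μ B.1 ≤ B.2}

/-- The set `Z`. -/
def zSet {N : ℕ} (n : ℕ) (k α ε : ℝ) (P₀ : Submodule ℝ (Euc N)) (μ : Measure (Euc N)) :
    Set (Euc N) :=
  {x | x ∈ μ.support ∧ hFun n k α ε P₀ μ x = 0}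

/-- The function `d` on `ℝ^N`. -/
def dFun {N : ℕ} (n : ℕ) (k α ε : ℝ) (P₀ : Submodule ℝ (Euc N)) (μ : Measure (Euc N))
    (x : Euc N) : ℝ :=
  sInf ((fun B : Euc N × ℝ => dist B.1 x + B.2) '' goodBalls n k α ε P₀ μ)

/-- The function `D` on `P₀`. -/
def DFun {N : ℕ} (n : ℕ) (k α ε : ℝ) (P₀ : Submodule ℝ (Euc N)) (μ : Measure (Euc N))
    (y : P₀) : ℝ :=
  sInf (dFun n k α ε P₀ μ '' {x | P₀.orthogonalProjectionOnto x = y})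

/-! ### Dyadic cells of `P₀` and the Whitney decomposition

Dyadic cells are taken in the coordinates of an orthonormal basis `e` of `P₀`; the index `(j, m)`
stands for the closed cell `∏ [m_l 2^j, (m_l + 1) 2^j]`. -/

/-- The cube `r Q` for the dyadic cell `Q` of index `i`: same centre and orientation as `Q`, but
`r` times its diameter. The cell itself is `cube e i 1`. -/
def cube {N n : ℕ} {P₀ : Submodule ℝ (Euc N)} (e : OrthonormalBasis (Fin n) ℝ P₀)
    (i : ℤ × (Fin n → ℤ)) (r : ℝ) : Set P₀ :=
  {x | ∀ l, |e.repr x l - ((i.2 l : ℝ) + 1 / 2) * (2 : ℝ) ^ i.1| ≤ r * (2 : ℝ) ^ i.1 / 2}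

/-- The dyadic cell `Q` of index `i` satisfies `diam Q ≤ (1/20) inf_{u ∈ Q} D(u)`. -/
def IsSmallCell {N n : ℕ} (k α ε : ℝ) {P₀ : Submodule ℝ (Euc N)} (μ : Measure (Euc N))
    (e : OrthonormalBasis (Fin n) ℝ P₀) (i : ℤ × (Fin n → ℤ)) : Prop :=
  ∀ u ∈ cube e i 1, diam (cube e i 1) ≤ 1 / 20 * DFun n k α ε P₀ μ u

/-- The index set `I`: the cells `R_i`, `i ∈ I`, are the maximal ones among the dyadic cells `Q`
with `diam Q ≤ (1/20) inf_{u ∈ Q} D(u)`. -/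
def whitneyIndex {N n : ℕ} (k α ε : ℝ) {P₀ : Submodule ℝ (Euc N)} (μ : Measure (Euc N))
    (e : OrthonormalBasis (Fin n) ℝ P₀) : Set (ℤ × (Fin n → ℤ)) :=
  {i | IsSmallCell k α ε μ e i ∧
    ∀ i', IsSmallCell k α ε μ e i' → cube e i 1 ⊆ cube e i' 1 → i' = i}

/-- The index set `I₁₂` of the cells `R_i` that meet `U₁₂ = B(0,12) ∩ P₀`. -/
def index12 {N n : ℕ} (k α ε : ℝ) {P₀ : Submodule ℝ (Euc N)} (μ : Measure (Euc N))
    (e : OrthonormalBasis (Fin n) ℝ P₀) : Set (ℤ × (Fin n → ℤ)) :=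
  {i | i ∈ whitneyIndex k α ε μ e ∧ (cube e i 1 ∩ closedBall 0 12).Nonempty}

/-- The distance of two sets: the infimum of the distances of their points. -/
def setDist {X : Type*} [PseudoMetricSpace X] (A B : Set X) : ℝ :=
  sInf (image2 dist A B)

/-! ### The choices made in the construction, and the function `A` -/

/-- The choices made in the construction of `A`: for every `i ∈ I₁₂` a good ball
`B_i = B(X_i, t_i)` comparable and close to `R_i`, for every ball in `S_total` an admissible plane,
and for every `i ∈ I₁₂` a smooth function equal to `1` on `2 R_i`, vanishing outside `3 R_i`, with
values in `[0,1]` and first and second derivatives bounded by `b / diam R_i` and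
`b / (diam R_i)^2`. -/
structure Choices {N n : ℕ} (k α ε b : ℝ) {P₀ : Submodule ℝ (Euc N)} (μ : Measure (Euc N))
    (e : OrthonormalBasis (Fin n) ℝ P₀) where
  /-- The centre `X_i`. -/
  center : ℤ × (Fin n → ℤ) → Euc N
  /-- The radius `t_i`. -/
  radius : ℤ × (Fin n → ℤ) → ℝ
  /-- The plane `P_{(x,t)}`. -/
  plane : Euc N × ℝ → AffineSubspace ℝ (Euc N)
  /-- The function from which the partition of unity is made. -/
  bump : ℤ × (Fin n → ℤ) → P₀ → ℝ
  ball_mem : ∀ i ∈ index12 k α ε μ e, (center i, radius i) ∈ goodBalls n k α ε P₀ μ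
  diam_le : ∀ i ∈ index12 k α ε μ e,
    diam (cube e i 1) ≤ diam (closedBall (center i) (radius i))
  le_diam : ∀ i ∈ index12 k α ε μ e,
    diam (closedBall (center i) (radius i)) ≤ 200 * diam (cube e i 1)
  setDist_le : ∀ i ∈ index12 k α ε μ e,
    setDist (P₀.orthogonalProjectionOnto '' closedBall (center i) (radius i)) (cube e i 1) ≤
      100 * diam (cube e i 1)
  plane_good : ∀ B ∈ STotal n k α ε P₀ μ, IsGoodPlane n k α ε P₀ μ B (plane B)
  bump_contDiff : ∀ i ∈ index12 k α ε μ e, ContDiff ℝ (⊤ : ℕ∞) (bump i)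
  bump_mem : ∀ i ∈ index12 k α ε μ e, ∀ a, bump i a ∈ Icc (0 : ℝ) 1
  bump_one : ∀ i ∈ index12 k α ε μ e, ∀ a ∈ cube e i 2, bump i a = 1
  bump_zero : ∀ i ∈ index12 k α ε μ e, ∀ a ∉ cube e i 3, bump i a = 0
  bump_deriv : ∀ i ∈ index12 k α ε μ e, ∀ m : ℕ, 1 ≤ m → m ≤ 2 → ∀ a,
    ‖iteratedFDeriv ℝ m (bump i) a‖ ≤ b / diam (cube e i 1) ^ m

/-- The map `P₀ → P₀ᗮ` whose graph is the plane `P` (for a plane at an angle less than `1` to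
`P₀`, there is exactly one such `v` for every `u`). -/
def graphMap {N : ℕ} (P₀ : Submodule ℝ (Euc N)) (P : AffineSubspace ℝ (Euc N)) (u : P₀) : P₀ᗮ :=
  Classical.epsilon fun v : P₀ᗮ => (u : Euc N) + (v : Euc N) ∈ P

/-- The inverse of the orthogonal projection `π` restricted to `Z` (which is injective for the
parameters of the construction). -/
def zInv {N : ℕ} (n : ℕ) (k α ε : ℝ) (P₀ : Submodule ℝ (Euc N)) (μ : Measure (Euc N))
    (a : P₀) : Euc N :=
  Classical.epsilon fun x => x ∈ zSet n k α ε P₀ μ ∧ P₀.orthogonalProjectionOnto x = a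

section Construction

variable {N n : ℕ} {k α ε b : ℝ} {P₀ : Submodule ℝ (Euc N)} {μ : Measure (Euc N)}
  {e : OrthonormalBasis (Fin n) ℝ P₀}

/-- The partition of unity `φ_i`, `i ∈ I₁₂`. -/
def Choices.phi (c : Choices k α ε b μ e) (i : ℤ × (Fin n → ℤ)) (a : P₀) : ℝ :=
  c.bump i a / ∑ᶠ j ∈ index12 k α ε μ e, c.bump j a

open Classical in
/-- The function `A`. Only its values on `U₁₂ = B(0,12) ∩ P₀` are meaningful. -/
def Choices.A (c : Choices k α ε b μ e) (a : P₀) : P₀ᗮ :=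
  if a ∈ P₀.orthogonalProjectionOnto '' zSet n k α ε P₀ μ then
    P₀ᗮ.orthogonalProjectionOnto (zInv n k α ε P₀ μ a)
  else
    ∑ᶠ i ∈ index12 k α ε μ e, c.phi i a • graphMap P₀ (c.plane (c.center i, c.radius i)) a

end Construction

/-! ### The `γ`-function -/

/-- The number `γ_g(q,t)`: the infimum of `t^(-n) ∫_{B(q,t) ∩ P₀} d(g(u),a(u))/t dH^n(u)` over all
affine `a : P₀ → P₀ᗮ`. Here `μHE[n]` is the `n`-dimensional Hausdorff measure, normalized so as to
agree with Lebesgue measure. -/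
def gammaFun {N : ℕ} (n : ℕ) {P₀ : Submodule ℝ (Euc N)} (g : P₀ → P₀ᗮ) (q : P₀) (t : ℝ) : ℝ≥0∞ :=
  ⨅ a : P₀ →ᵃ[ℝ] P₀ᗮ,
    (∫⁻ u in closedBall q t, ENNReal.ofReal (dist (g u) (a u) / t) ∂μHE[n]) /
      ENNReal.ofReal (t ^ n)

end

end MengerGraph

open MengerGraph

/-!
The balls of `S` are good in three ways: they carry much mass of `μ`, they can be enlarged within
`S`, and near them `μ` is, in the mean and up to a factor `ε`, concentrated on a plane at a small
angle to `P₀`, that is, on the graph of an affine map of slope at most `1`. A family of balls with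
graphs of this kind is called a flat system here. Everything known about it comes from one fact: a
ball of large mass contains many tuples of `n + 1` points that span a simplex which is not thin,
and they may be chosen off any given set of small measure (`exists_fat_tuples`). Two graphs that
are close to `μ` in the same ball are therefore close to a common fat tuple, hence close to each
other (`exists_compare`). Passing from scale to scale, this shows that the graphs of any two
comparable balls of the system agree up to `ε` times the radius, and that the centres of the balls
lie almost on a Lipschitz graph (`exists_flatSystem_const`). It follows that `A`, which is put
together from such graphs, is `ε`-close at every scale to the graphs of the system
(`Choices.norm_A_sub_le`).

The estimate of `γ = γ_A(q, t)` depends on the size of `t` in comparison with `D q`. If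
`t ≤ D q / 100`, then `A` is near `q` a combination of boundedly many affine maps that differ by `O(ε D q)`,
with coefficients that are smooth at the scale `D q`; so `A` differs on `B(q, t)` from an affine
map by `O(ε t ^ 2 / D q)` (`Choices.exists_affine_near`), and `γ ≤ C ε t / D q`.

If `t > D q / 100`, let `f` be any affine map. The ball `B(q, t)` is covered by balls around
points `b` of radius comparable to `D b + ρ`, with `ρ > 0` a small parameter. Over each of them
`A` is close to a graph of the system, whose distance from `f` is controlled by the mean distance
of `μ` from the graph of `f`. A Vitali covering keeps the corresponding balls of `ℝ ^ N` disjoint,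
and the sum is `∫ |A - f| ≤ C ε ∫ (D + ρ) + C ∫ d(w, graph f) dμ(w)` (`exists_covering_const`).
For `f` one can take the map whose graph contains a given fat tuple `x` close to the graph of the
ball. Averaging over all these tuples, the inequality of Hölder and the lower bound for the
integrand lead to `γ ^ p ≤ C ε ^ p t ^ (-n - 1) ∫_{B(q, 27 t)} (D + ρ) + C t ^ (-n) ∫ K ^ p`,
where the last integral is over tuples of `n + 2` points whose size is comparable to `t` and whose
first point lies over `B(q, 200 t)` (`exists_gamma_const`).

It remains to integrate with respect to `dt / t` and `q` (`exists_integral_const`). The bound at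
small scales gives `C ε ^ p`. In the two other integrals Tonelli's theorem is applied: a point `u`
enters only for `t ≥ D u / 127`, and `∫ D u / t ^ 2 dt` over this range is bounded
(`lintegral_dist_le`); a tuple enters only for `t` comparable to the distance of its first two
points, which contributes a bounded factor, so that the sum over all scales is at most a multiple
of the total curvature (`lintegral_scaleSet_le`). The choice `ρ = t ^ 2 / 4` makes the remaining
term `O(ε ^ p)`.
-/

namespace MengerGraph

/-! ### Fat tuples -/

/-- The tuple `x` is `h`-fat: the coefficients of an affine relation are controlled by the norm of
the corresponding combination. For affinely independent tuples this says that every vertex has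
distance at least `h` from the span of the others. -/
def FatTuple {V : Type*} [NormedAddCommGroup V] [NormedSpace ℝ V] {m : ℕ} (h : ℝ)
    (x : Fin m → V) : Prop :=
  ∀ c : Fin m → ℝ, ∑ i, c i = 0 → ∀ i, h * |c i| ≤ ‖∑ i, c i • x i‖

theorem isClosed_fatTuple {V : Type*} [NormedAddCommGroup V] [NormedSpace ℝ V] (m : ℕ) (h : ℝ) :
    IsClosed {x : Fin m → V | FatTuple h x} := by
  simp only [FatTuple, ofPred_forall]
  refine isClosed_iInter fun c => isClosed_iInter fun _ => isClosed_iInter fun i => ?_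
  exact isClosed_le continuous_const (by fun_prop)

theorem measurableSet_fatTuple {N m : ℕ} (X : Euc N) (T h : ℝ) {E : Set (Euc N)}
    (hE : MeasurableSet E) :
    MeasurableSet {x : Fin m → Euc N | (∀ i, x i ∈ closedBall X T \ E) ∧ FatTuple h x} := by
  have h1 : {x : Fin m → Euc N | (∀ i, x i ∈ closedBall X T \ E) ∧ FatTuple h x} =
      (univ.pi fun _ => closedBall X T \ E) ∩ {x | FatTuple h x} := by
    ext x
    simp
  rw [h1]
  exact (MeasurableSet.univ_pi fun _ => isClosed_closedBall.measurableSet.diff hE).inter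
    (isClosed_fatTuple m h).measurableSet

/-- Adding a vertex at distance at least `d` from the plane through the old ones keeps a tuple
fat. -/
theorem FatTuple.snoc {V : Type*} [NormedAddCommGroup V] [NormedSpace ℝ V] {m : ℕ} {h d R : ℝ}
    (hh : 0 < h) (hd : 0 < d) {x : Fin (m + 1) → V} (hx : FatTuple h x)
    {w : V} (hR : ‖w - x 0‖ ≤ R)
    (hw : ∀ v ∈ Submodule.span ℝ (range fun i => x i - x 0), d ≤ ‖w - x 0 + v‖) :
    FatTuple (h * d / (d + R + h)) (Fin.snoc (α := fun _ => V) x w : Fin (m + 2) → V) := by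
  intro c hc i
  have hR0 : 0 ≤ R := (norm_nonneg _).trans hR
  set s := c (Fin.last _) with hs
  rw [Fin.sum_univ_castSucc] at hc ⊢
  simp only [Fin.snoc_castSucc, Fin.snoc_last]
  rw [← hs] at hc ⊢
  set v := ∑ i : Fin (m + 1), c i.castSucc • x i + s • w with hv
  have hv' : v = s • (w - x 0) + ∑ i : Fin (m + 1), c i.castSucc • (x i - x 0) := by
    simp only [smul_sub, Finset.sum_sub_distrib, ← Finset.sum_smul]
    rw [show ∑ i : Fin (m + 1), c i.castSucc = -s by linarith, neg_smul, hv]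
    abel
  have hsd : d * |s| ≤ ‖v‖ := by
    rcases eq_or_ne s 0 with h0 | h0
    · simp [h0]
    have hmem : s⁻¹ • ∑ i : Fin (m + 1), c i.castSucc • (x i - x 0) ∈
        Submodule.span ℝ (range fun i => x i - x 0) :=
      Submodule.smul_mem _ _ (Submodule.sum_mem _ fun i _ =>
        Submodule.smul_mem _ _ (Submodule.subset_span ⟨i, rfl⟩))
    have h1 := hw _ hmem
    have h2 : v = s • (w - x 0 + s⁻¹ • ∑ i : Fin (m + 1), c i.castSucc • (x i - x 0)) := by
      rw [smul_add, smul_smul, mul_inv_cancel₀ h0, one_smul, hv']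
    rw [h2, norm_smul, Real.norm_eq_abs, mul_comm]
    gcongr
  have hden : 0 < d + R + h := by positivity
  rw [div_mul_eq_mul_div, div_le_iff₀ hden]
  induction i using Fin.lastCases with
  | last =>
    rw [← hs]
    calc h * d * |s| = h * (d * |s|) := by ring
      _ ≤ h * ‖v‖ := by gcongr
      _ ≤ ‖v‖ * (d + R + h) := by nlinarith [norm_nonneg v]
  | cast i =>
    have h1 := hx (fun j => c j.castSucc + if j = 0 then s else 0)
      (by rw [Finset.sum_add_distrib]; simpa using hc) i
    have h2 : ∑ j : Fin (m + 1), (c j.castSucc + if j = 0 then s else 0) • x j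
        = v - s • (w - x 0) := by
      simp only [add_smul, Finset.sum_add_distrib, ite_smul, zero_smul]
      simp only [Finset.sum_ite_eq', Finset.mem_univ, if_true, smul_sub, hv]
      abel
    rw [h2] at h1
    have h3 : ‖v - s • (w - x 0)‖ ≤ ‖v‖ + |s| * R := by
      refine (norm_sub_le _ _).trans ?_
      rw [norm_smul, Real.norm_eq_abs]
      gcongr
    have h4 : |c i.castSucc| ≤ |c i.castSucc + if i = 0 then s else 0| + |s| := by
      split_ifs
      · have := abs_add_le (c i.castSucc + s) (-s)
        rw [abs_neg] at this
        simpa using this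
      · simp
    have h5 : h * |c i.castSucc| ≤ ‖v‖ + |s| * R + h * |s| := by nlinarith
    calc h * d * |c i.castSucc| = d * (h * |c i.castSucc|) := by ring
      _ ≤ d * (‖v‖ + |s| * R + h * |s|) := by gcongr
      _ = d * ‖v‖ + (R + h) * (d * |s|) := by ring
      _ ≤ d * ‖v‖ + (R + h) * ‖v‖ := by gcongr
      _ = ‖v‖ * (d + R + h) := by ring

theorem FatTuple.le_dist {V : Type*} [NormedAddCommGroup V] [NormedSpace ℝ V] {m : ℕ} {h : ℝ}
    {x : Fin m → V} (hx : FatTuple h x) {i j : Fin m} (hij : i ≠ j) : h ≤ dist (x i) (x j) := by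
  have := hx (fun l => (if l = i then 1 else 0) - if l = j then 1 else 0) (by simp) i
  simpa [sub_smul, dist_eq_norm, hij] using this

/-- A fat `(n+1)`-tuple is the vertex set of a fat simplex. -/
theorem FatTuple.isFatSimplex {N n : ℕ} {h : ℝ} (hn : 1 ≤ n) (hh : 0 < h)
    {x : Fin (n + 1) → Euc N} (hx : FatTuple h x) : IsFatSimplex n h x := by
  refine ⟨?_, fun i => ?_⟩
  · rw [affineIndependent_iff_of_fintype]
    intro w hw hw0 i
    rw [Finset.weightedVSub_eq_linear_combination _ hw] at hw0
    have := hx w hw i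
    rw [hw0, norm_zero] at this
    exact abs_eq_zero.1 (le_antisymm (by nlinarith [abs_nonneg (w i)]) (abs_nonneg _))
  · have hne : (x '' {j | j ≠ i}).Nonempty := by
      have : Nontrivial (Fin (n + 1)) := Fin.nontrivial_iff_two_le.2 (by omega)
      obtain ⟨j, hj⟩ := exists_ne i
      exact ⟨x j, j, hj, rfl⟩
    refine (le_infDist ((affineSpan_nonempty _).2 hne)).2 fun y hy => ?_
    obtain ⟨s, hs0, hs1, rfl⟩ : ∃ s : Fin (n + 1) → ℝ, s i = 0 ∧ ∑ j, s j = 1 ∧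
        ∑ j, s j • x j = y := by
      refine affineSpan_induction hy ?_ ?_
      · rintro _ ⟨j, hj, rfl⟩
        exact ⟨Pi.single j 1, by simp [Ne.symm hj], by simp,
          by simp [Pi.single_apply]⟩
      · rintro c _ _ _ ⟨s, h1, h2, rfl⟩ ⟨t, h3, h4, rfl⟩ ⟨u, h5, h6, rfl⟩
        refine ⟨fun j => c * (s j - t j) + u j, by simp [*], ?_, ?_⟩
        · rw [Finset.sum_add_distrib, ← Finset.mul_sum, Finset.sum_sub_distrib, h2, h4, h6]
          ring
        · simp only [add_smul, mul_smul, sub_smul, Finset.sum_add_distrib, ← Finset.smul_sum,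
            Finset.sum_sub_distrib, vsub_eq_sub, vadd_eq_add]
    have := hx (fun j => (if j = i then 1 else 0) - s j) (by simp [hs1]) i
    simpa [sub_smul, dist_eq_norm, hs0] using this

/-- A neighbourhood of relative width `δ` of a plane of dimension less than `n` carries little
mass: it is covered by `O(δ ^ (1 - n))` balls of relative radius `δ`. -/
theorem exists_measure_near_plane_le (n : ℕ) {C₁ : ℝ} (hC₁ : 0 ≤ C₁) :
    ∃ C : ℝ, 0 < C ∧ ∀ (N : ℕ) (μ : Measure (Euc N)),
      (∀ x r, 0 < r → μ (closedBall x r) ≤ ENNReal.ofReal (C₁ * r ^ n)) →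
      ∀ W : Submodule ℝ (Euc N), finrank ℝ W < n → ∀ (X o : Euc N) (t δ : ℝ), 0 < t → 0 < δ →
        δ ≤ 1 →
        μ {w | w ∈ closedBall X t ∧ ‖Wᗮ.orthogonalProjectionOnto (w - o)‖ ≤ δ * t} ≤
          ENNReal.ofReal (C * δ * t ^ n) := by
  refine ⟨C₁ * (n + 2) ^ n * 5 ^ n + 1, by positivity, ?_⟩
  intro N μ hμ W hW X o t δ ht hδ hδ1
  set A := {w | w ∈ closedBall X t ∧ ‖Wᗮ.orthogonalProjectionOnto (w - o)‖ ≤ δ * t} with hA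
  set m := finrank ℝ W with hm
  let e := stdOrthonormalBasis ℝ W
  let co : Euc N → Fin m → ℝ := fun w l => e.repr (W.orthogonalProjectionOnto (w - X)) l
  let M : ℤ := ⌈1 / δ⌉
  have hM1 : 1 / δ ≤ M := Int.le_ceil _
  have hM2 : (M : ℝ) < 1 / δ + 1 := Int.ceil_lt_add_one _
  have hM0 : 0 ≤ M := Int.ceil_nonneg (by positivity)
  have hδt : 0 < δ * t := by positivity
  -- a grid of side `δ * t` in the coordinates of `W` cuts `A` into pieces, each of which lies in a
  -- ball of radius `(n + 2) * δ * t`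
  let I : Finset (Fin m → ℤ) := Fintype.piFinset fun _ => Finset.Icc (-M) M
  have hcov : A ⊆ ⋃ z ∈ I, {w ∈ A | ∀ l, ⌊co w l / (δ * t)⌋ = z l} := by
    intro w hw
    simp only [mem_iUnion]
    refine ⟨fun l => ⌊co w l / (δ * t)⌋, ?_, hw, fun l => rfl⟩
    rw [Fintype.mem_piFinset]
    intro l
    have h1 : |co w l| ≤ t := by
      refine (PiLp.norm_apply_le (e.repr (W.orthogonalProjectionOnto (w - X))) l).trans ?_
      rw [e.repr.norm_map]
      exact (W.norm_orthogonalProjectionOnto_apply_le _).trans (by simpa [dist_eq_norm] using hw.1)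
    have h2 : |co w l / (δ * t)| ≤ 1 / δ := by
      rw [abs_div, abs_of_pos hδt, div_le_div_iff₀ hδt hδ]
      nlinarith
    rw [Finset.mem_Icc]
    constructor
    · rw [Int.le_floor]
      push_cast
      linarith [(abs_le.1 h2).1]
    · exact_mod_cast (Int.floor_le _).trans ((le_of_abs_le h2).trans hM1)
  have hpiece : ∀ z : Fin m → ℤ, μ {w ∈ A | ∀ l, ⌊co w l / (δ * t)⌋ = z l} ≤
      ENNReal.ofReal (C₁ * ((n + 2) * (δ * t)) ^ n) := by
    intro z
    rcases {w ∈ A | ∀ l, ⌊co w l / (δ * t)⌋ = z l}.eq_empty_or_nonempty with h0 | ⟨w₀, hw₀, hz₀⟩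
    · rw [h0]; simp
    refine (measure_mono ?_).trans (hμ w₀ ((n + 2) * (δ * t)) (by positivity))
    rintro w ⟨hw, hz⟩
    rw [mem_closedBall, dist_eq_norm]
    have h1 : ‖W.orthogonalProjectionOnto (w - w₀)‖ ≤ n * (δ * t) := by
      have h4 : ∀ l, |e.repr (W.orthogonalProjectionOnto (w - w₀)) l| ≤ δ * t := by
        intro l
        have h5 : e.repr (W.orthogonalProjectionOnto (w - w₀)) l = co w l - co w₀ l := by
          simp only [co]
          rw [← PiLp.sub_apply, ← map_sub, ← map_sub, sub_sub_sub_cancel_right]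
        have h6 := Int.abs_sub_lt_one_of_floor_eq_floor ((hz l).trans (hz₀ l).symm)
        rw [← sub_div, abs_div, abs_of_pos hδt, div_lt_one hδt] at h6
        rw [h5]
        exact h6.le
      rw [← e.sum_repr (W.orthogonalProjectionOnto (w - w₀))]
      refine (norm_sum_le _ _).trans ?_
      calc ∑ l, ‖e.repr (W.orthogonalProjectionOnto (w - w₀)) l • e l‖
          ≤ ∑ l : Fin m, δ * t := Finset.sum_le_sum fun l _ => by
            rw [norm_smul, e.norm_eq_one, mul_one]; exact h4 l
        _ = m * (δ * t) := by simp
        _ ≤ n * (δ * t) := by gcongr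
    have h2 : ‖Wᗮ.orthogonalProjectionOnto (w - w₀)‖ ≤ 2 * (δ * t) := by
      rw [show w - w₀ = (w - o) - (w₀ - o) by abel, map_sub]
      exact (norm_sub_le _ _).trans (by linarith [hw.2, hw₀.2])
    have h3 : w - w₀ = (W.orthogonalProjectionOnto (w - w₀) : Euc N) +
        Wᗮ.orthogonalProjectionOnto (w - w₀) :=
      (W.starProjection_add_starProjection_orthogonal _).symm
    rw [h3]
    refine (norm_add_le _ _).trans ?_
    rw [← Submodule.coe_norm, ← Submodule.coe_norm]
    linarith
  calc μ A ≤ μ (⋃ z ∈ I, {w ∈ A | ∀ l, ⌊co w l / (δ * t)⌋ = z l}) := measure_mono hcov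
    _ ≤ ∑ z ∈ I, μ {w ∈ A | ∀ l, ⌊co w l / (δ * t)⌋ = z l} := measure_biUnion_finset_le _ _
    _ ≤ ∑ z ∈ I, ENNReal.ofReal (C₁ * ((n + 2) * (δ * t)) ^ n) :=
        Finset.sum_le_sum fun z _ => hpiece z
    _ = ENNReal.ofReal ((2 * M + 1) ^ m * (C₁ * ((n + 2) * (δ * t)) ^ n)) := by
        have h1 : (((M + 1 - -M).toNat : ℕ) : ℝ) = 2 * M + 1 := by
          have : ((M + 1 - -M).toNat : ℤ) = 2 * M + 1 := by omega
          exact_mod_cast this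
        rw [Finset.sum_const, nsmul_eq_mul, Fintype.card_piFinset_const, Int.card_Icc, ← h1,
          ← Nat.cast_pow, ENNReal.ofReal_mul (Nat.cast_nonneg _), ENNReal.ofReal_natCast]
    _ ≤ _ := by
        apply ENNReal.ofReal_le_ofReal
        have h1 : (2 * (M : ℝ) + 1) ≤ 5 / δ := by
          have : 1 ≤ 1 / δ := by rw [le_div_iff₀ hδ]; linarith
          have : 5 / δ = 5 * (1 / δ) := by ring
          linarith
        have h2 : (2 * (M : ℝ) + 1) ^ m * δ ^ n ≤ 5 ^ n * δ := by
          calc (2 * (M : ℝ) + 1) ^ m * δ ^ n ≤ (5 / δ) ^ m * δ ^ n := by gcongr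
            _ = 5 ^ m * δ ^ (n - m) := by
                rw [div_pow, div_mul_eq_mul_div, div_eq_iff (by positivity), mul_assoc, ← pow_add]
                congr 2; omega
            _ ≤ 5 ^ n * δ ^ 1 := mul_le_mul (pow_le_pow_right₀ (by norm_num) hW.le)
                (pow_le_pow_of_le_one hδ.le hδ1 (by omega)) (by positivity) (by positivity)
            _ = _ := by rw [pow_one]
        calc (2 * (M : ℝ) + 1) ^ m * (C₁ * ((n + 2) * (δ * t)) ^ n)
            = C₁ * (n + 2) ^ n * t ^ n * ((2 * (M : ℝ) + 1) ^ m * δ ^ n) := by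
              rw [mul_pow, mul_pow]; ring
          _ ≤ C₁ * (n + 2) ^ n * t ^ n * (5 ^ n * δ) := by gcongr
          _ ≤ _ := by
              have : 0 < δ * t ^ n := by positivity
              nlinarith

/-- Appending the last coordinate is measure preserving. -/
theorem measurePreserving_snoc {X : Type*} [MeasurableSpace X] (μ : Measure X) [SigmaFinite μ]
    (m : ℕ) :
    MeasurePreserving
      (fun p : (Fin m → X) × X => (Fin.snoc (α := fun _ => X) p.1 p.2 : Fin (m + 1) → X))
      ((Measure.pi fun _ : Fin m => μ).prod μ) (Measure.pi fun _ : Fin (m + 1) => μ) := by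
  have h1 := (measurePreserving_piFinSuccAbove (fun _ : Fin (m + 1) => μ) (Fin.last m)).symm
  have h2 := h1.comp (Measure.measurePreserving_swap (μ := Measure.pi fun _ : Fin m => μ) (ν := μ))
  convert h2 using 1
  ext p i
  simp [MeasurableEquiv.piFinSuccAbove_symm_apply, Fin.insertNthEquiv, Fin.insertNth_last']

/-- A ball of large mass contains many fat tuples of points outside a given small set `E`: each new
vertex may be chosen anywhere off `E` and off a thin neighbourhood of the plane through the
previous ones. -/
theorem exists_fat_tuples (n : ℕ) {C₁ lam : ℝ} (hC₁ : 0 ≤ C₁) (hlam : 0 < lam) :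
    ∃ θ : ℝ, 0 < θ ∧ ∀ m ≤ n, ∃ h : ℝ, 0 < h ∧ ∀ (N : ℕ) (μ : Measure (Euc N)) [IsFiniteMeasure μ],
      (∀ x r, 0 < r → μ (closedBall x r) ≤ ENNReal.ofReal (C₁ * r ^ n)) →
      ∀ (X : Euc N) (T : ℝ), 0 < T → ENNReal.ofReal (lam * T ^ n) ≤ μ (closedBall X T) →
      ∀ E : Set (Euc N), MeasurableSet E → μ (closedBall X T ∩ E) ≤ ENNReal.ofReal (θ * T ^ n) →
        ENNReal.ofReal ((θ * T ^ n) ^ (m + 1)) ≤ (Measure.pi fun _ : Fin (m + 1) => μ)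
          {x | (∀ i, x i ∈ closedBall X T \ E) ∧ FatTuple (h * T) x} := by
  obtain ⟨C, hC, hnear⟩ := exists_measure_near_plane_le n hC₁
  obtain ⟨δ, hδ, hδ1, hδC⟩ : ∃ δ : ℝ, 0 < δ ∧ δ ≤ 1 ∧ C * δ ≤ lam / 4 := by
    refine ⟨min 1 (lam / 4 / C), by positivity, min_le_left _ _, ?_⟩
    rw [mul_comm, ← le_div_iff₀ hC]
    exact min_le_right _ _
  -- the exceptional set and the neighbourhood of the plane each take at most a quarter of `lam`, so
  -- at least half is left for every new vertex; `θ = lam / 4` is enough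
  refine ⟨lam / 4, by positivity, fun m => ?_⟩
  induction m with
  | zero =>
    refine fun _ => ⟨1, one_pos, fun N μ _ hμ X T hT hX E hE hEs => ?_⟩
    have h1 : {x : Fin 1 → Euc N | (∀ i, x i ∈ closedBall X T \ E) ∧ FatTuple (1 * T) x} =
        univ.pi fun _ => closedBall X T \ E := by
      ext x
      simp only [mem_ofPred_eq, mem_univ_pi, and_iff_left_iff_imp]
      intro _ c hc i
      rw [Fin.sum_univ_one] at hc
      simp [Subsingleton.elim i 0, hc]
    rw [h1, Measure.pi_pi]
    rw [Fin.prod_const, zero_add, pow_one, pow_one]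
    rw [← sdiff_inter_self_eq_sdiff, inter_comm]
    refine le_trans ?_ le_measure_sdiff
    refine le_trans ?_ (tsub_le_tsub hX hEs)
    rw [← ENNReal.ofReal_sub _ (by positivity)]
    apply ENNReal.ofReal_le_ofReal
    nlinarith [pow_pos hT n]
  | succ m ih =>
    intro hm
    obtain ⟨h, hh, ih⟩ := ih (by omega)
    refine ⟨h * δ / (δ + 2 + h), by positivity, fun N μ _ hμ X T hT hX E hE hEs => ?_⟩
    have ih := ih N μ hμ X T hT hX E hE hEs
    set G := {x : Fin (m + 1) → Euc N | (∀ i, x i ∈ closedBall X T \ E) ∧ FatTuple (h * T) x}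
    have hG : MeasurableSet G := measurableSet_fatTuple X T _ hE
    set G' := {x : Fin (m + 1 + 1) → Euc N | (∀ i, x i ∈ closedBall X T \ E) ∧
      FatTuple (h * δ / (δ + 2 + h) * T) x}
    have hG' : MeasurableSet G' := measurableSet_fatTuple X T _ hE
    have hTn := pow_pos hT n
    have key : ∀ x ∈ G, ENNReal.ofReal (lam / 4 * T ^ n) ≤
        μ (Prod.mk x ⁻¹' ((fun p : (Fin (m + 1) → Euc N) × Euc N =>
          (Fin.snoc (α := fun _ => Euc N) p.1 p.2 : Fin (m + 1 + 1) → Euc N)) ⁻¹' G')) := by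
      rintro x ⟨hx, hfat⟩
      set W := Submodule.span ℝ (range fun i => x i - x 0) with hW
      have hWn : finrank ℝ W < n := by
        have h1 : W = Submodule.span ℝ (range fun i : Fin m => x i.succ - x 0) := by
          apply le_antisymm
          · rw [hW, Submodule.span_le]
            rintro _ ⟨i, rfl⟩
            induction i using Fin.cases with
            | zero => simp
            | succ i => exact Submodule.subset_span ⟨i, rfl⟩
          · apply Submodule.span_mono
            rintro _ ⟨i, rfl⟩
            exact ⟨i.succ, rfl⟩
        rw [h1]
        refine lt_of_le_of_lt (finrank_range_le_card (R := ℝ) fun i : Fin m => x i.succ - x 0) ?_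
        simpa using hm
      have h2 := hnear N μ hμ W hWn X (x 0) T δ hT hδ hδ1
      refine le_trans ?_ (measure_mono (s := closedBall X T \ ((closedBall X T ∩ E) ∪
        {w | w ∈ closedBall X T ∧ ‖Wᗮ.orthogonalProjectionOnto (w - x 0)‖ ≤ δ * T})) ?_)
      · refine le_trans ?_ le_measure_sdiff
        refine le_trans ?_ (tsub_le_tsub hX ((measure_union_le _ _).trans (add_le_add hEs h2)))
        rw [← ENNReal.ofReal_add (by positivity) (by positivity),
          ← ENNReal.ofReal_sub _ (by positivity)]
        apply ENNReal.ofReal_le_ofReal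
        nlinarith
      · rintro w ⟨hw, hw'⟩
        simp only [mem_union, mem_inter_iff, mem_ofPred_eq, not_or, not_and, not_le] at hw'
        simp only [mem_preimage]
        refine ⟨fun i => ?_, ?_⟩
        · induction i using Fin.lastCases with
          | last => rw [Fin.snoc_last]; exact ⟨hw, hw'.1 hw⟩
          | cast i => rw [Fin.snoc_castSucc]; exact hx i
        · have hR : ‖w - x 0‖ ≤ 2 * T := by
            rw [← dist_eq_norm]
            have h3 := (hx 0).1
            rw [mem_closedBall] at h3 hw
            linarith [dist_triangle_right w (x 0) X]
          have := hfat.snoc (d := δ * T) (R := 2 * T) (w := w) (by positivity) (by positivity) hR ?_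
          · convert this using 1
            field_simp
          · intro v hv
            refine (hw'.2 hw).le.trans ?_
            have h4 : Wᗮ.orthogonalProjectionOnto (w - x 0) =
                Wᗮ.orthogonalProjectionOnto (w - x 0 + v) := by
              rw [map_add, Submodule.orthogonalProjectionOnto_orthogonal_apply_eq_zero hv, add_zero]
            rw [h4]
            exact Wᗮ.norm_orthogonalProjectionOnto_apply_le _
    have hsn := measurePreserving_snoc μ (m + 1)
    rw [← hsn.measure_preimage hG'.nullMeasurableSet,
      Measure.prod_apply (hsn.measurable hG')]
    calc ENNReal.ofReal ((lam / 4 * T ^ n) ^ (m + 1 + 1))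
        = ENNReal.ofReal (lam / 4 * T ^ n) * ENNReal.ofReal ((lam / 4 * T ^ n) ^ (m + 1)) := by
          rw [← ENNReal.ofReal_mul (by positivity), pow_succ']
      _ ≤ ENNReal.ofReal (lam / 4 * T ^ n) * (Measure.pi fun _ : Fin (m + 1) => μ) G := by gcongr
      _ = ∫⁻ x in G, ENNReal.ofReal (lam / 4 * T ^ n) ∂(Measure.pi fun _ : Fin (m + 1) => μ) := by
          rw [setLIntegral_const]
      _ ≤ ∫⁻ x in G, _ ∂(Measure.pi fun _ : Fin (m + 1) => μ) := setLIntegral_mono' hG key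
      _ ≤ _ := setLIntegral_le_lintegral _ _

/-! ### Graphs over a plane -/

/-- The coefficients, with respect to a fat tuple of maximal length, of a vector as a linear
combination with coefficient sum zero. -/
theorem FatTuple.exists_coeff {V : Type*} [NormedAddCommGroup V] [NormedSpace ℝ V]
    [FiniteDimensional ℝ V] {n : ℕ} (hV : finrank ℝ V = n) {h : ℝ} (hh : 0 < h)
    {x : Fin (n + 1) → V} (hx : FatTuple h x) :
    ∃ Λ : V →ₗ[ℝ] (Fin (n + 1) → ℝ), (∀ u, ∑ i, Λ u i = 0) ∧ (∀ u, ∑ i, Λ u i • x i = u) ∧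
      (∀ c : Fin (n + 1) → ℝ, ∑ i, c i = 0 → Λ (∑ i, c i • x i) = c) ∧
      ∀ u i, |Λ u i| ≤ ‖u‖ / h := by
  let M : (Fin (n + 1) → ℝ) →ₗ[ℝ] V × ℝ :=
    (Fintype.linearCombination ℝ x).prod (∑ i, LinearMap.proj i)
  have hM1 : ∀ c, (M c).1 = ∑ i, c i • x i := fun c => by
    simp [M, Fintype.linearCombination_apply]
  have hM2 : ∀ c, (M c).2 = ∑ i, c i := fun c => by simp [M]
  have hinj : Function.Injective M := by
    rw [← LinearMap.ker_eq_bot, LinearMap.ker_eq_bot']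
    intro c hc
    ext i
    have h1 := hx c (by rw [← hM2, hc]; rfl) i
    rw [← hM1, hc, Prod.fst_zero, norm_zero] at h1
    exact abs_eq_zero.1 (le_antisymm (by nlinarith [abs_nonneg (c i)]) (abs_nonneg _))
  let e := LinearEquiv.ofInjectiveOfFinrankEq M hinj (by simp [hV])
  have he : ∀ c, e c = M c := fun c => rfl
  have hs : ∀ u : V, M (e.symm (u, 0)) = (u, 0) := fun u => by rw [← he, e.apply_symm_apply]
  have h1 : ∀ u : V, ∑ i, e.symm (u, 0) i = 0 := fun u => by rw [← hM2, hs]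
  have h2 : ∀ u : V, ∑ i, e.symm (u, 0) i • x i = u := fun u => by rw [← hM1, hs]
  refine ⟨e.symm.toLinearMap ∘ₗ LinearMap.inl ℝ V ℝ, h1, h2, fun c hc => ?_, fun u i => ?_⟩
  · have : (∑ i, c i • x i, (0 : ℝ)) = e c := by rw [he, Prod.ext_iff, hM1, hM2, hc]; simp
    change e.symm (∑ i, c i • x i, (0 : ℝ)) = c
    rw [this, e.symm_apply_apply]
  · rw [le_div_iff₀ hh, mul_comm]
    have := hx (e.symm (u, 0)) (h1 u) i
    rwa [h2] at this

theorem affineMap_apply_eq {V W : Type*} [AddCommGroup V] [Module ℝ V] [AddCommGroup W]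
    [Module ℝ W] (a : V →ᵃ[ℝ] W) (u v : V) : a u = a v + a.linear (u - v) := by
  have := a.map_vadd v (u - v)
  simpa [add_comm] using this

/-- For coefficients of sum zero, an affine map acts on the combination through its linear part. -/
theorem sum_smul_affineMap {V W ι : Type*} [AddCommGroup V] [Module ℝ V] [AddCommGroup W]
    [Module ℝ W] [Fintype ι] (a : V →ᵃ[ℝ] W) {c : ι → ℝ} (hc : ∑ i, c i = 0) (y : ι → V) :
    ∑ i, c i • a (y i) = a.linear (∑ i, c i • y i) := by
  have : ∀ i, c i • a (y i) = c i • a 0 + a.linear (c i • y i) := fun i => by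
    rw [affineMap_apply_eq a (y i) 0, sub_zero, smul_add, map_smul]
  simp only [this, Finset.sum_add_distrib, ← Finset.sum_smul, hc, zero_smul, zero_add, map_sum]

section Graphs

variable {N n : ℕ} {P₀ : Submodule ℝ (Euc N)}

/-- The distance of `w` to the graph of `a`, measured in the direction orthogonal to `P₀`. -/
noncomputable def vertDist (a : P₀ →ᵃ[ℝ] P₀ᗮ) (w : Euc N) : ℝ :=
  ‖P₀ᗮ.orthogonalProjectionOnto w - a (P₀.orthogonalProjectionOnto w)‖

theorem vertDist_nonneg (a : P₀ →ᵃ[ℝ] P₀ᗮ) (w : Euc N) : 0 ≤ vertDist a w := norm_nonneg _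

theorem continuous_vertDist (a : P₀ →ᵃ[ℝ] P₀ᗮ) : Continuous (vertDist a) := by
  have : Continuous a := a.continuous_of_finiteDimensional
  unfold vertDist
  fun_prop

theorem norm_proj_sub_le (x y : Euc N) :
    ‖P₀.orthogonalProjectionOnto x - P₀.orthogonalProjectionOnto y‖ ≤ ‖x - y‖ := by
  rw [← map_sub]
  exact P₀.norm_orthogonalProjectionOnto_apply_le _

theorem proj_add_proj (x : Euc N) :
    (P₀.orthogonalProjectionOnto x : Euc N) + P₀ᗮ.orthogonalProjectionOnto x = x :=
  P₀.starProjection_add_starProjection_orthogonal x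

theorem norm_le_proj_add (x : Euc N) :
    ‖x‖ ≤ ‖P₀.orthogonalProjectionOnto x‖ + ‖P₀ᗮ.orthogonalProjectionOnto x‖ := by
  conv_lhs => rw [← proj_add_proj (P₀ := P₀) x]
  exact norm_add_le _ _

theorem vertDist_le_add {a : P₀ →ᵃ[ℝ] P₀ᗮ} {s : ℝ} (hs : 0 ≤ s)
    (ha : ∀ v, ‖a.linear v‖ ≤ s * ‖v‖) (w y : Euc N) :
    vertDist a w ≤ vertDist a y + (1 + s) * ‖w - y‖ := by
  have h1 : P₀ᗮ.orthogonalProjectionOnto w - a (P₀.orthogonalProjectionOnto w) =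
      (P₀ᗮ.orthogonalProjectionOnto y - a (P₀.orthogonalProjectionOnto y)) +
      ((P₀ᗮ.orthogonalProjectionOnto w - P₀ᗮ.orthogonalProjectionOnto y) -
        a.linear (P₀.orthogonalProjectionOnto w - P₀.orthogonalProjectionOnto y)) := by
    rw [affineMap_apply_eq a (P₀.orthogonalProjectionOnto w) (P₀.orthogonalProjectionOnto y)]
    abel
  unfold vertDist
  rw [h1]
  refine (norm_add_le _ _).trans (add_le_add_right ?_ _)
  refine (norm_sub_le _ _).trans ?_
  have h2 := norm_proj_sub_le (P₀ := P₀ᗮ) w y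
  have h3 := norm_proj_sub_le (P₀ := P₀) w y
  have h4 := ha (P₀.orthogonalProjectionOnto w - P₀.orthogonalProjectionOnto y)
  nlinarith

/-- If `P` lies in the graph of `a`, then the vertical distance to the graph is controlled by the
distance to `P`. -/
theorem vertDist_le_infDist {a : P₀ →ᵃ[ℝ] P₀ᗮ} {s : ℝ} (hs : 0 ≤ s)
    (ha : ∀ v, ‖a.linear v‖ ≤ s * ‖v‖) {P : Set (Euc N)} (hP : P.Nonempty)
    (h : ∀ y ∈ P, vertDist a y = 0) (w : Euc N) : vertDist a w ≤ (1 + s) * infDist w P := by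
  rw [mul_comm, ← div_le_iff₀ (by positivity)]
  refine (le_infDist hP).2 fun y hy => ?_
  rw [div_le_iff₀ (by positivity), dist_eq_norm, mul_comm]
  have := vertDist_le_add hs ha w y
  rwa [h y hy, zero_add] at this

/-- A fat tuple close to the graph of a map of slope at most `1` projects to a fat tuple. -/
theorem FatTuple.proj {m : ℕ} {H κ : ℝ} (hH : 0 < H) {x : Fin m → Euc N}
    (hx : FatTuple H x) {a : P₀ →ᵃ[ℝ] P₀ᗮ} (ha : ∀ v, ‖a.linear v‖ ≤ ‖v‖)
    (hκ : ∀ i, vertDist a (x i) ≤ κ) (hκH : 2 * m * κ ≤ H) :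
    FatTuple (H / 4) (fun i => P₀.orthogonalProjectionOnto (x i)) := by
  intro c hc i
  set v := ∑ i, c i • x i with hv
  have hcv : ∀ i, |c i| ≤ ‖v‖ / H := fun i => by
    rw [le_div_iff₀ hH, mul_comm]; exact hx c hc i
  have h1 : P₀.orthogonalProjectionOnto v = ∑ i, c i • P₀.orthogonalProjectionOnto (x i) := by
    simp [hv, map_sum]
  have h2 : P₀ᗮ.orthogonalProjectionOnto v = a.linear (P₀.orthogonalProjectionOnto v) +
      ∑ i, c i • (P₀ᗮ.orthogonalProjectionOnto (x i) - a (P₀.orthogonalProjectionOnto (x i))) := by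
    rw [h1, ← sum_smul_affineMap a hc]
    simp [hv, map_sum, smul_sub]
  -- by fatness the coefficients are at most `‖v‖ / H`, so the vertical errors add up to `‖v‖ / 2`
  have h3 : ‖∑ i, c i • (P₀ᗮ.orthogonalProjectionOnto (x i) -
      a (P₀.orthogonalProjectionOnto (x i)))‖ ≤ ‖v‖ / 2 := by
    refine (norm_sum_le _ _).trans ?_
    calc _ ≤ ∑ _i : Fin m, ‖v‖ / H * κ := Finset.sum_le_sum fun i _ => by
            rw [norm_smul, Real.norm_eq_abs]
            exact mul_le_mul (hcv i) (hκ i) (norm_nonneg _) (by positivity)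
      _ = ‖v‖ / H * (m * κ) := by simp; ring
      _ ≤ ‖v‖ / H * (H / 2) := by gcongr; linarith
      _ = ‖v‖ / 2 := by field_simp
  have h4 := norm_le_proj_add (P₀ := P₀) v
  have h5 : ‖P₀ᗮ.orthogonalProjectionOnto v‖ ≤ ‖P₀.orthogonalProjectionOnto v‖ + ‖v‖ / 2 := by
    rw [h2]
    exact (norm_add_le _ _).trans (add_le_add (ha _) h3)
  rw [← h1]
  have := hx c hc i
  rw [← hv] at this
  linarith

/-- The plane through a fat tuple close to the graph of a map of slope at most `1` is itself a
graph of controlled slope. -/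
theorem FatTuple.exists_interpolation (hP₀ : finrank ℝ P₀ = n) {H κ : ℝ} (hH : 0 < H)
    {x : Fin (n + 1) → Euc N} (hx : FatTuple H x) {a : P₀ →ᵃ[ℝ] P₀ᗮ}
    (ha : ∀ v, ‖a.linear v‖ ≤ ‖v‖) (hκ : ∀ i, vertDist a (x i) ≤ κ)
    (hκH : 4 * (n + 1) * κ ≤ H) :
    ∃ b : P₀ →ᵃ[ℝ] P₀ᗮ,
      ∀ w, vertDist b w ≤ 3 * infDist w (affineSpan ℝ (range x) : Set (Euc N)) := by
  have hκ0 : 0 ≤ κ := (vertDist_nonneg _ _).trans (hκ 0)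
  have hp : FatTuple (H / 4) (fun i => P₀.orthogonalProjectionOnto (x i)) :=
    hx.proj hH ha hκ (by push_cast; nlinarith)
  obtain ⟨Λ, h0, h1, h2, h3⟩ := hp.exists_coeff hP₀ (by positivity)
  -- `b` takes the value `π^⊥ (x i)` at `π (x i)`
  let L : P₀ →ₗ[ℝ] P₀ᗮ :=
    Fintype.linearCombination ℝ (fun i => P₀ᗮ.orthogonalProjectionOnto (x i)) ∘ₗ Λ
  have hL : ∀ v, L v = ∑ i, Λ v i • P₀ᗮ.orthogonalProjectionOnto (x i) := fun v => by
    simp [L, Fintype.linearCombination_apply]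
  let b : P₀ →ᵃ[ℝ] P₀ᗮ := L.toAffineMap + AffineMap.const ℝ P₀
    (P₀ᗮ.orthogonalProjectionOnto (x 0) - L (P₀.orthogonalProjectionOnto (x 0)))
  have hb : ∀ u, b u = P₀ᗮ.orthogonalProjectionOnto (x 0) +
      L (u - P₀.orthogonalProjectionOnto (x 0)) := fun u => by
    simp [b, map_sub]; abel
  have hbl : b.linear = L := by simp [b]
  have hslope : ∀ v, ‖b.linear v‖ ≤ 2 * ‖v‖ := by
    intro v
    have h4 : b.linear v = a.linear v + ∑ i, Λ v i •
        (P₀ᗮ.orthogonalProjectionOnto (x i) - a (P₀.orthogonalProjectionOnto (x i))) := by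
      simp only [smul_sub, Finset.sum_sub_distrib]
      rw [sum_smul_affineMap a (h0 v), h1, hbl, hL]
      abel
    have h5 : ‖∑ i, Λ v i • (P₀ᗮ.orthogonalProjectionOnto (x i) -
        a (P₀.orthogonalProjectionOnto (x i)))‖ ≤ ‖v‖ := by
      refine (norm_sum_le _ _).trans ?_
      calc _ ≤ ∑ _i : Fin (n + 1), ‖v‖ / (H / 4) * κ := Finset.sum_le_sum fun i _ => by
              rw [norm_smul, Real.norm_eq_abs]
              exact mul_le_mul (h3 v i) (hκ i) (norm_nonneg _) (by positivity)
        _ = ‖v‖ / H * (4 * (n + 1) * κ) := by simp; ring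
        _ ≤ ‖v‖ / H * H := by gcongr
        _ = ‖v‖ := by field_simp
    rw [h4]
    exact (norm_add_le _ _).trans (by linarith [ha v])
  refine ⟨b, fun w => ?_⟩
  have hne : (affineSpan ℝ (range x) : Set (Euc N)).Nonempty :=
    (affineSpan_nonempty _).2 (range_nonempty x)
  have hzero : ∀ y ∈ (affineSpan ℝ (range x) : Set (Euc N)), vertDist b y = 0 := by
    intro y hy
    have hy : P₀ᗮ.orthogonalProjectionOnto y = b (P₀.orthogonalProjectionOnto y) := by
      refine affineSpan_induction hy ?_ ?_
      · rintro _ ⟨j, rfl⟩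
        have h6 := h2 (fun i => (if i = j then 1 else 0) - if i = 0 then 1 else 0) (by simp)
        rw [hb, hL]
        simp only [sub_smul, ite_smul, one_smul, zero_smul, Finset.sum_sub_distrib,
          Finset.sum_ite_eq', Finset.mem_univ, if_true] at h6
        rw [h6]
        simp [sub_smul]
      · intro c u v w hu hv hw
        simp only [vsub_eq_sub, vadd_eq_add, map_add, map_smul, map_sub, hu, hv, hw]
        rw [affineMap_apply_eq b (c • _ + _) (P₀.orthogonalProjectionOnto w), add_sub_cancel_right,
          map_smul, affineMap_apply_eq b (P₀.orthogonalProjectionOnto u)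
          (P₀.orthogonalProjectionOnto v), add_sub_cancel_left, add_comm]
    unfold vertDist
    rw [hy, sub_self, norm_zero]
  have := vertDist_le_infDist (by norm_num : (0:ℝ) ≤ 2) hslope hne hzero w
  linarith

/-- A plane at a small angle to `P₀` is the graph of an affine map of slope at most `1`. -/
theorem IsPlane.exists_graph (hP₀ : finrank ℝ P₀ = n) {P : AffineSubspace ℝ (Euc N)}
    (hP : IsPlane n P) (hangle : angle P.direction P₀ ≤ 1 / 4) :
    ∃ a : P₀ →ᵃ[ℝ] P₀ᗮ, (∀ v, ‖a.linear v‖ ≤ ‖v‖) ∧ (∀ u, graphMap P₀ P u = a u) ∧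
      ∀ w, vertDist a w ≤ 2 * infDist w (P : Set (Euc N)) := by
  have hdir : ∀ v ∈ P.direction,
      ‖P₀ᗮ.orthogonalProjectionOnto v‖ ≤ 1 / 3 * ‖P₀.orthogonalProjectionOnto v‖ := by
    intro v hv
    have h1 : P₀ᗮ.starProjection v = (P.direction.starProjection - P₀.starProjection) v := by
      rw [sub_apply, Submodule.starProjection_eq_self_iff.2 hv,
        Submodule.starProjection_orthogonal_val]
    have h2 : ‖P₀ᗮ.orthogonalProjectionOnto v‖ ≤ 1 / 4 * ‖v‖ := by
      rw [Submodule.coe_norm]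
      change ‖P₀ᗮ.starProjection v‖ ≤ _
      rw [h1]
      exact (ContinuousLinearMap.le_opNorm _ _).trans (by gcongr; exact hangle)
    have h3 := norm_le_proj_add (P₀ := P₀) v
    linarith
  obtain ⟨⟨p, hp⟩, hfr⟩ := hP
  let T : P.direction →ₗ[ℝ] P₀ := P₀.orthogonalProjectionOnto.toLinearMap ∘ₗ P.direction.subtype
  have hT : ∀ v, T v = P₀.orthogonalProjectionOnto (v : Euc N) := fun v => rfl
  have hTinj : Function.Injective T := by
    rw [← LinearMap.ker_eq_bot, LinearMap.ker_eq_bot']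
    intro v hv
    have h1 := hdir v v.2
    rw [hT] at hv
    have h2 := norm_le_proj_add (P₀ := P₀) (v : Euc N)
    rw [hv, norm_zero] at h1 h2
    have : ‖(v : Euc N)‖ ≤ 0 := by linarith
    exact Subtype.ext (norm_le_zero_iff.1 this)
  -- the projection to `P₀` is injective on the direction of `P`, hence bijective for dimension
  -- reasons
  let e := LinearEquiv.ofInjectiveOfFinrankEq T hTinj (by rw [hfr, hP₀])
  have he : ∀ c, e c = T c := fun c => rfl
  have hes : ∀ u, P₀.orthogonalProjectionOnto (e.symm u : Euc N) = u := fun u => by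
    rw [← hT, ← he, e.apply_symm_apply]
  let L : P₀ →ₗ[ℝ] P₀ᗮ :=
    P₀ᗮ.orthogonalProjectionOnto.toLinearMap ∘ₗ P.direction.subtype ∘ₗ e.symm.toLinearMap
  have hL : ∀ v, L v = P₀ᗮ.orthogonalProjectionOnto (e.symm v : Euc N) := fun v => rfl
  let a : P₀ →ᵃ[ℝ] P₀ᗮ := L.toAffineMap + AffineMap.const ℝ P₀
    (P₀ᗮ.orthogonalProjectionOnto p - L (P₀.orthogonalProjectionOnto p))
  have ha : ∀ u, a u = P₀ᗮ.orthogonalProjectionOnto p +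
      L (u - P₀.orthogonalProjectionOnto p) := fun u => by
    simp [a, map_sub]; abel
  have hal : a.linear = L := by simp [a]
  have hslope : ∀ v, ‖a.linear v‖ ≤ ‖v‖ := by
    intro v
    rw [hal, hL]
    have := hdir (e.symm v) (e.symm v).2
    rw [hes] at this
    linarith [norm_nonneg v]
  have hmem : ∀ u : P₀, (u : Euc N) + (a u : Euc N) ∈ P := by
    intro u
    have h1 : (u : Euc N) + (a u : Euc N) =
        (e.symm (u - P₀.orthogonalProjectionOnto p) : Euc N) + p := by
      have h2 := proj_add_proj (P₀ := P₀) p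
      have h3 := proj_add_proj (P₀ := P₀) (e.symm (u - P₀.orthogonalProjectionOnto p) : Euc N)
      rw [hes, ← hL, Submodule.coe_sub] at h3
      calc (u : Euc N) + (a u : Euc N)
          = ((u : Euc N) - P₀.orthogonalProjectionOnto p +
            L (u - P₀.orthogonalProjectionOnto p)) + (P₀.orthogonalProjectionOnto p +
            P₀ᗮ.orthogonalProjectionOnto p) := by rw [ha, Submodule.coe_add]; abel
        _ = _ := by rw [h2, h3]
    rw [h1]
    exact AffineSubspace.vadd_mem_of_mem_direction (e.symm _).2 hp
  -- `P` meets the fibre over `u` in one point only, which is therefore the one that `graphMap`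
  -- picks
  have huniq : ∀ (u : P₀) (v : P₀ᗮ), (u : Euc N) + (v : Euc N) ∈ P → v = a u := by
    intro u v hv
    have h1 := AffineSubspace.vsub_mem_direction hv (hmem u)
    rw [vsub_eq_sub, add_sub_add_left_eq_sub, ← Submodule.coe_sub] at h1
    have h2 := hdir _ h1
    rw [Submodule.orthogonalProjectionOnto_mem_subspace_eq_self,
      Submodule.orthogonalProjectionOnto_apply_of_mem_orthogonal (v - a u).2, norm_zero,
      mul_zero] at h2
    exact sub_eq_zero.1 (norm_le_zero_iff.1 h2)
  refine ⟨a, hslope, fun u => ?_, fun w => ?_⟩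
  · exact huniq u _ (Classical.epsilon_spec (p := fun v : P₀ᗮ => (u : Euc N) + (v : Euc N) ∈ P)
      ⟨_, hmem u⟩)
  · have := vertDist_le_infDist zero_le_one (by simpa using hslope) ⟨p, hp⟩ (fun y hy => ?_) w
    · linarith
    · have h1 := huniq (P₀.orthogonalProjectionOnto y) (P₀ᗮ.orthogonalProjectionOnto y)
        (by rw [proj_add_proj]; exact hy)
      unfold vertDist
      rw [h1, sub_self, norm_zero]

/-- Chebyshev's inequality for the vertical distance to a graph. -/
theorem measure_lt_vertDist_le {μ : Measure (Euc N)} (f : P₀ →ᵃ[ℝ] P₀ᗮ) {X : Euc N} {T κ Q : ℝ}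
    (hκ : 0 < κ)
    (hf : ∫⁻ w in closedBall X T, ENNReal.ofReal (vertDist f w) ∂μ ≤ ENNReal.ofReal Q) :
    μ (closedBall X T ∩ {w | κ < vertDist f w}) ≤ ENNReal.ofReal (Q / κ) := by
  have hms : MeasurableSet {w | κ < vertDist f w} :=
    measurableSet_lt measurable_const (continuous_vertDist f).measurable
  have h1 : ENNReal.ofReal κ * μ (closedBall X T ∩ {w | κ < vertDist f w}) ≤
      ENNReal.ofReal Q := by
    rw [inter_comm, ← Measure.restrict_apply hms, ← setLIntegral_const]
    refine le_trans (setLIntegral_mono' hms fun w hw => ENNReal.ofReal_le_ofReal (le_of_lt hw)) ?_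
    exact (setLIntegral_le_lintegral _ _).trans hf
  rwa [mul_comm, ← ENNReal.le_div_iff_mul_le (by simp [hκ]) (by simp),
    ← ENNReal.ofReal_div_of_pos hκ] at h1

end Graphs

/-- Two graphs that are both close, in the mean, to the measure in a ball of large mass are close to
each other: the measure sees a fat tuple near both graphs, and an affine map is controlled by its
values at the projected vertices. Only the first graph is assumed to have slope at most `1` and to
be very close to the measure; this is what makes the projected tuple fat. -/
theorem exists_compare (n : ℕ) {C₁ lam : ℝ} (hC₁ : 0 ≤ C₁) (hlam : 0 < lam) :
    ∃ K ε₀ : ℝ, 0 < K ∧ 0 < ε₀ ∧ ∀ (N : ℕ) (μ : Measure (Euc N)) [IsFiniteMeasure μ],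
      (∀ x r, 0 < r → μ (closedBall x r) ≤ ENNReal.ofReal (C₁ * r ^ n)) →
      ∀ P₀ : Submodule ℝ (Euc N), finrank ℝ P₀ = n → ∀ (X : Euc N) (T : ℝ), 0 < T →
      ENNReal.ofReal (lam * T ^ n) ≤ μ (closedBall X T) →
      ∀ a : P₀ →ᵃ[ℝ] P₀ᗮ, (∀ v, ‖a.linear v‖ ≤ ‖v‖) → ∀ (b : P₀ →ᵃ[ℝ] P₀ᗮ) (I J : ℝ), 0 < I →
      0 < J → I ≤ ε₀ * T ^ (n + 1) →
      ∫⁻ w in closedBall X T, ENNReal.ofReal (vertDist a w) ∂μ ≤ ENNReal.ofReal I →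
      ∫⁻ w in closedBall X T, ENNReal.ofReal (vertDist b w) ∂μ ≤ ENNReal.ofReal J →
      ∀ u, ‖a u - b u‖ ≤ K * (1 + ‖u - P₀.orthogonalProjectionOnto X‖ / T) * ((I + J) / T ^ n) := by
  obtain ⟨θ, hθ, htup⟩ := exists_fat_tuples n hC₁ hlam
  obtain ⟨h, hh, htup⟩ := htup n le_rfl
  refine ⟨2 / θ * (1 + 4 * (n + 1) / h), h * θ / (4 * (n + 1)), by positivity, by positivity, ?_⟩
  intro N μ _ hμ P₀ hP₀ X T hT hX a ha b I J hI hJ hIε haI hbJ u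
  have hTn := pow_pos hT n
  have cheb : ∀ (f : P₀ →ᵃ[ℝ] P₀ᗮ) (Q : ℝ), 0 < Q →
      ∫⁻ w in closedBall X T, ENNReal.ofReal (vertDist f w) ∂μ ≤ ENNReal.ofReal Q →
      μ (closedBall X T ∩ {w | 2 * Q / (θ * T ^ n) < vertDist f w}) ≤
        ENNReal.ofReal (θ / 2 * T ^ n) := by
    intro f Q hQ hf
    refine (measure_lt_vertDist_le f (by positivity) hf).trans
      (ENNReal.ofReal_le_ofReal (le_of_eq ?_))
    field_simp
  set κ := 2 * I / (θ * T ^ n) with hκ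
  set κ' := 2 * J / (θ * T ^ n) with hκ'
  set E := {w | κ < vertDist a w} ∪ {w | κ' < vertDist b w} with hE
  have hEm : MeasurableSet E :=
    (measurableSet_lt measurable_const (continuous_vertDist a).measurable).union
      (measurableSet_lt measurable_const (continuous_vertDist b).measurable)
  have hEs : μ (closedBall X T ∩ E) ≤ ENNReal.ofReal (θ * T ^ n) := by
    rw [hE, inter_union_distrib_left]
    refine (measure_union_le _ _).trans ((add_le_add (cheb a I hI haI) (cheb b J hJ hbJ)).trans ?_)
    rw [← ENNReal.ofReal_add (by positivity) (by positivity)]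
    apply ENNReal.ofReal_le_ofReal
    linarith
  have h1 := htup N μ hμ X T hT hX E hEm hEs
  -- a fat tuple that avoids the points far from one of the graphs
  obtain ⟨x, hx, hfat⟩ : {x : Fin (n + 1) → Euc N | (∀ i, x i ∈ closedBall X T \ E) ∧
      FatTuple (h * T) x}.Nonempty := by
    refine nonempty_of_measure_ne_zero (μ := Measure.pi fun _ : Fin (n + 1) => μ) ?_
    refine (lt_of_lt_of_le ?_ h1).ne'
    rw [ENNReal.ofReal_pos]
    positivity
  have hxa : ∀ i, vertDist a (x i) ≤ κ := fun i => not_lt.1 fun hlt => (hx i).2 (Or.inl hlt)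
  have hxb : ∀ i, vertDist b (x i) ≤ κ' := fun i => not_lt.1 fun hlt => (hx i).2 (Or.inr hlt)
  have hκH : 2 * ((n + 1 : ℕ) : ℝ) * κ ≤ h * T := by
    rw [hκ, ← mul_div_assoc, div_le_iff₀ (by positivity)]
    have : h * θ / (4 * (n + 1)) * T ^ (n + 1) * (4 * (n + 1)) = h * T * (θ * T ^ n) := by
      rw [pow_succ]
      field_simp
    push_cast
    nlinarith
  have hp := hfat.proj (by positivity) ha hxa hκH
  obtain ⟨Λ, h0, h1, -, h3⟩ := hp.exists_coeff hP₀ (by positivity)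
  have hab : ∀ i, ‖a (P₀.orthogonalProjectionOnto (x i)) - b (P₀.orthogonalProjectionOnto (x i))‖ ≤
      κ + κ' := by
    intro i
    have h4 := norm_sub_le_norm_sub_add_norm_sub (a (P₀.orthogonalProjectionOnto (x i)))
      (P₀ᗮ.orthogonalProjectionOnto (x i)) (b (P₀.orthogonalProjectionOnto (x i)))
    have h5 := hxa i
    have h6 := hxb i
    unfold vertDist at h5 h6
    rw [norm_sub_rev] at h5
    exact h4.trans (add_le_add h5 h6)
  set v := u - P₀.orthogonalProjectionOnto (x 0) with hv
  have hvn : ‖v‖ ≤ T + ‖u - P₀.orthogonalProjectionOnto X‖ := by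
    have h4 := norm_sub_le_norm_sub_add_norm_sub u (P₀.orthogonalProjectionOnto X)
      (P₀.orthogonalProjectionOnto (x 0))
    have h5 := norm_proj_sub_le (P₀ := P₀) X (x 0)
    have h6 := (hx 0).1
    rw [mem_closedBall, dist_comm, dist_eq_norm] at h6
    linarith
  have hdec : a u - b u = (a (P₀.orthogonalProjectionOnto (x 0)) -
      b (P₀.orthogonalProjectionOnto (x 0))) + ∑ i, Λ v i •
      (a (P₀.orthogonalProjectionOnto (x i)) - b (P₀.orthogonalProjectionOnto (x i))) := by
    simp only [smul_sub, Finset.sum_sub_distrib]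
    rw [sum_smul_affineMap a (h0 v), sum_smul_affineMap b (h0 v), h1,
      affineMap_apply_eq a u (P₀.orthogonalProjectionOnto (x 0)),
      affineMap_apply_eq b u (P₀.orthogonalProjectionOnto (x 0))]
    abel
  have hκκ : 0 ≤ κ + κ' := by positivity
  have hsum : ‖∑ i, Λ v i • (a (P₀.orthogonalProjectionOnto (x i)) -
      b (P₀.orthogonalProjectionOnto (x i)))‖ ≤ (n + 1) * (‖v‖ / (h * T / 4) * (κ + κ')) := by
    refine (norm_sum_le _ _).trans ?_
    calc _ ≤ ∑ _i : Fin (n + 1), ‖v‖ / (h * T / 4) * (κ + κ') := Finset.sum_le_sum fun i _ => by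
            rw [norm_smul, Real.norm_eq_abs]
            exact mul_le_mul (h3 v i) (hab i) (norm_nonneg _) (by positivity)
      _ = _ := by simp
  rw [hdec]
  refine (norm_add_le _ _).trans ((add_le_add (hab 0) hsum).trans ?_)
  set r := ‖u - P₀.orthogonalProjectionOnto X‖ with hr
  have hr0 : 0 ≤ r := norm_nonneg _
  calc κ + κ' + (n + 1) * (‖v‖ / (h * T / 4) * (κ + κ'))
      ≤ κ + κ' + (n + 1) * ((T + r) / (h * T / 4) * (κ + κ')) := by gcongr
    _ = (1 + 4 * (n + 1) / h * (1 + r / T)) * (κ + κ') := by field_simp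
    _ ≤ ((1 + 4 * (n + 1) / h) * (1 + r / T)) * (κ + κ') := by
        gcongr
        have : 0 ≤ r / T := by positivity
        nlinarith
    _ = _ := by rw [hκ, hκ']; field_simp

/-! ### Flat systems -/

/-- A family `S` of balls, closed under enlargement up to radius `50`, each of which has large mass
and carries a graph `a B` over `P₀` of slope at most `1` that is `ε`-close in the mean to `μ`. -/
structure FlatSystem {N : ℕ} (n : ℕ) (P₀ : Submodule ℝ (Euc N)) (μ : Measure (Euc N)) (lam ε : ℝ)
    (S : Set (Euc N × ℝ)) (a : Euc N × ℝ → (P₀ →ᵃ[ℝ] P₀ᗮ)) : Prop where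
  pos : ∀ x t, (x, t) ∈ S → 0 < t
  lt : ∀ x t, (x, t) ∈ S → t < 50
  norm_le : ∀ x t, (x, t) ∈ S → ‖x‖ ≤ 5
  up : ∀ x s t, (x, s) ∈ S → s ≤ t → t < 50 → (x, t) ∈ S
  mass : ∀ x t, (x, t) ∈ S → ENNReal.ofReal (lam * t ^ n) ≤ μ (closedBall x t)
  slope : ∀ x t, (x, t) ∈ S → ∀ v, ‖(a (x, t)).linear v‖ ≤ ‖v‖
  flat : ∀ x t, (x, t) ∈ S →
    ∫⁻ w in closedBall x (4 * t), ENNReal.ofReal (vertDist (a (x, t)) w) ∂μ ≤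
      ENNReal.ofReal (4 * ε * t ^ (n + 1))

set_option maxHeartbeats 1000000 in
/-- In a flat system the graphs belonging to comparable balls are close, the centre of a ball is
close to its graph, and the centres lie almost on a Lipschitz graph. -/
theorem exists_flatSystem_const (n : ℕ) {C₁ lam : ℝ} (hC₁ : 0 ≤ C₁) (hlam : 0 < lam) :
    ∃ M ε₀ : ℝ, 0 < M ∧ 0 < ε₀ ∧ ∀ (N : ℕ) (μ : Measure (Euc N)) [IsFiniteMeasure μ],
      (∀ x r, 0 < r → μ (closedBall x r) ≤ ENNReal.ofReal (C₁ * r ^ n)) →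
      ∀ P₀ : Submodule ℝ (Euc N), finrank ℝ P₀ = n → ∀ ε S a, 0 < ε → ε ≤ ε₀ →
      FlatSystem n P₀ μ lam ε S a →
      (∀ x t, (x, t) ∈ S → vertDist (a (x, t)) x ≤ 3 * t) ∧
      (∀ x t y s, (x, t) ∈ S → (y, s) ∈ S →
        ‖x - y‖ ≤ 4 * ‖P₀.orthogonalProjectionOnto x - P₀.orthogonalProjectionOnto y‖ +
          6 * (t + s)) ∧
      ∀ x t y s L u, (x, t) ∈ S → (y, s) ∈ S → 1 ≤ L → s ≤ L * t →
        ‖u - P₀.orthogonalProjectionOnto x‖ ≤ L * t →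
        ‖u - P₀.orthogonalProjectionOnto y‖ ≤ L * s →
        ‖a (x, t) u - a (y, s) u‖ ≤ M * L ^ 6 * ε * t := by
  obtain ⟨K, ε₁, hK, hε₁, hcomp⟩ := exists_compare n hC₁ hlam
  set K₂ := 4 * K * (1 + 4 ^ (n + 1)) with hK₂
  have hK₂0 : 0 < K₂ := by positivity
  refine ⟨12 * 8000 * K₂, min (ε₁ / 4) (min (lam / 8) (1 / (10 * K₂))), by positivity,
    by positivity, ?_⟩
  intro N μ _ hμ P₀ hP₀ ε S a hε hεs hS
  have hε1 : 4 * ε ≤ ε₁ := by linarith [hεs.trans (min_le_left _ _)]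
  have hε2 : 4 * ε < lam := by
    linarith [hεs.trans ((min_le_right _ _).trans (min_le_left _ _))]
  have hε3 : 10 * K₂ * ε ≤ 1 := by
    have := hεs.trans ((min_le_right _ _).trans (min_le_right _ _))
    rw [le_div_iff₀ (by positivity)] at this
    linarith
  clear hεs
  -- two balls of comparable size, the first well inside the fourfold second
  have cmp : ∀ x t y s u, (x, t) ∈ S → (y, s) ∈ S → ‖x - y‖ + t ≤ 4 * s → s ≤ 4 * t →
      ‖a (x, t) u - a (y, s) u‖ ≤ K₂ * ε * (t + ‖u - P₀.orthogonalProjectionOnto x‖) := by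
    intro x t y s u hx hy hxy hst
    have ht := hS.pos x t hx
    have hs := hS.pos y s hy
    have h1 := hcomp N μ hμ P₀ hP₀ x t ht (hS.mass x t hx) (a (x, t)) (hS.slope x t hx) (a (y, s))
      (4 * ε * t ^ (n + 1)) (4 * ε * s ^ (n + 1)) (by positivity) (by positivity) (by gcongr)
      ((lintegral_mono_set (closedBall_subset_closedBall (by linarith))).trans (hS.flat x t hx))
      ((lintegral_mono_set (closedBall_subset_closedBall' (by
        rw [dist_eq_norm]; linarith))).trans (hS.flat y s hy)) u
    refine h1.trans ?_
    set r := ‖u - P₀.orthogonalProjectionOnto x‖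
    have hr : 0 ≤ r := norm_nonneg _
    calc K * (1 + r / t) * ((4 * ε * t ^ (n + 1) + 4 * ε * s ^ (n + 1)) / t ^ n)
        ≤ K * (1 + r / t) * ((4 * ε * t ^ (n + 1) + 4 * ε * (4 * t) ^ (n + 1)) / t ^ n) := by
          gcongr
      _ = _ := by
          rw [hK₂, mul_pow, pow_succ t]
          field_simp
  -- one centre, two scales: the dyadic scales in between contribute a geometric series
  have chain1' : ∀ (k : ℕ) y s t u L, (y, s) ∈ S → s ≤ t → t < 50 → 0 ≤ L →
      ‖u - P₀.orthogonalProjectionOnto y‖ ≤ L * s → t ≤ 2 ^ k * s →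
      ‖a (y, s) u - a (y, t) u‖ ≤ 2 * K₂ * (1 + L) * ε * t := by
    intro k
    induction k with
    | zero =>
      intro y s t u L hy hst ht hL hu hk
      rw [show t = s by linarith, sub_self, norm_zero]
      have := hS.pos y s hy
      positivity
    | succ k ih =>
      intro y s t u L hy hst ht hL hu hk
      have hs := hS.pos y s hy
      have hy' := hS.up y s t hy hst ht
      rcases le_or_gt t (2 * s) with h2 | h2
      · have := cmp y s y t u hy hy' (by simp; linarith) (by linarith)
        refine this.trans ?_
        have ht0 : 0 < t := by linarith
        calc K₂ * ε * (s + ‖u - P₀.orthogonalProjectionOnto y‖) ≤ K₂ * ε * (t + L * t) := by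
              gcongr; exact hu.trans (by gcongr)
          _ ≤ 2 * (K₂ * ε * (t + L * t)) := by
              have : 0 ≤ K₂ * ε * (t + L * t) := by positivity
              linarith
          _ = _ := by ring
      · have h3 := ih y s (t / 2) u L hy (by linarith) (by linarith) hL hu
          (by rw [pow_succ] at hk; linarith)
        have hy2 := hS.up y s (t / 2) hy (by linarith) (by linarith)
        have h4 := cmp y (t / 2) y t u hy2 hy' (by simp; linarith) (by linarith)
        have h5 := norm_sub_le_norm_sub_add_norm_sub (a (y, s) u) (a (y, t / 2) u) (a (y, t) u)
        have h6 : K₂ * ε * (t / 2 + ‖u - P₀.orthogonalProjectionOnto y‖) ≤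
            K₂ * ε * (t / 2 + L * (t / 2)) := by
          gcongr; exact hu.trans (by gcongr; linarith)
        have : 2 * K₂ * (1 + L) * ε * t = 2 * K₂ * (1 + L) * ε * (t / 2) +
          2 * (K₂ * ε * (t / 2 + L * (t / 2))) := by ring
        have : 0 ≤ K₂ * ε * (t / 2 + L * (t / 2)) := by
          have : 0 < t := by linarith
          positivity
        linarith
  have chain1 : ∀ y s t u L, (y, s) ∈ S → s ≤ t → t < 50 → 0 ≤ L →
      ‖u - P₀.orthogonalProjectionOnto y‖ ≤ L * s →
      ‖a (y, s) u - a (y, t) u‖ ≤ 2 * K₂ * (1 + L) * ε * t := by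
    intro y s t u L hy hst ht hL hu
    obtain ⟨k, hk⟩ := pow_unbounded_of_one_lt (t / s) (one_lt_two)
    rw [div_lt_iff₀ (hS.pos y s hy)] at hk
    exact chain1' k y s t u L hy hst ht hL hu hk.le
  have hdist : ∀ x t y s, (x, t) ∈ S → (y, s) ∈ S → ‖x - y‖ ≤ 10 := by
    intro x t y s hx hy
    linarith [norm_sub_le x y, hS.norm_le x t hx, hS.norm_le y s hy]
  -- two centres: both balls are enlarged to the common radius `T`, where they can be compared
  -- directly
  have chain2 : ∀ x t y s L u, (x, t) ∈ S → (y, s) ∈ S → 1 ≤ L → s ≤ L * t → ‖x - y‖ ≤ L * t →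
      ‖u - P₀.orthogonalProjectionOnto y‖ ≤ L * s →
      ‖a (x, t) u - a (y, s) u‖ ≤ 12 * K₂ * L ^ 3 * ε * t := by
    intro x t y s L u hx hy hL hst hxy hu
    have ht := hS.pos x t hx
    have hs := hS.pos y s hy
    set T := max (max t s) ‖x - y‖ with hT
    have hTt : t ≤ T := (le_max_left _ _).trans (le_max_left _ _)
    have hTs : s ≤ T := (le_max_right _ _).trans (le_max_left _ _)
    have hTx : ‖x - y‖ ≤ T := le_max_right _ _
    have hT50 : T < 50 := max_lt (max_lt (hS.lt x t hx) (hS.lt y s hy))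
      (by linarith [hdist x t y s hx hy])
    have hTL : T ≤ L * t := max_le (max_le (by nlinarith) hst) hxy
    have hux : ‖u - P₀.orthogonalProjectionOnto x‖ ≤ (L ^ 2 + L) * t := by
      have h1 := norm_sub_le_norm_sub_add_norm_sub u (P₀.orthogonalProjectionOnto y)
        (P₀.orthogonalProjectionOnto x)
      have h2 := norm_proj_sub_le (P₀ := P₀) y x
      rw [norm_sub_rev y x] at h2
      have : L * s ≤ L * (L * t) := by gcongr
      nlinarith
    have h1 := chain1 x t T u (L ^ 2 + L) hx hTt hT50 (by positivity) hux
    have h2 := chain1 y s T u L hy hTs hT50 (by positivity) hu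
    have h3 := cmp y T x T u (hS.up y s T hy hTs hT50) (hS.up x t T hx hTt hT50)
      (by rw [norm_sub_rev]; linarith) (by linarith)
    have h4 : ‖a (x, t) u - a (y, s) u‖ ≤ ‖a (x, t) u - a (x, T) u‖ +
        ‖a (y, T) u - a (x, T) u‖ + ‖a (y, s) u - a (y, T) u‖ := by
      have h5 := norm_sub_le_norm_sub_add_norm_sub (a (x, t) u) (a (x, T) u) (a (y, s) u)
      have h6 := norm_sub_le_norm_sub_add_norm_sub (a (x, T) u) (a (y, T) u) (a (y, s) u)
      rw [norm_sub_rev (a (x, T) u) (a (y, T) u), norm_sub_rev (a (y, T) u) (a (y, s) u)] at h6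
      linarith
    have hT0 : 0 < T := by linarith
    have h5 : K₂ * ε * (T + ‖u - P₀.orthogonalProjectionOnto y‖) ≤ K₂ * ε * (T + L * T) := by
      gcongr; exact hu.trans (by gcongr)
    have h6 : ‖a (x, t) u - a (y, s) u‖ ≤ K₂ * ε * T * (5 + 5 * L + 2 * L ^ 2) := by
      linarith
    have h7 : 5 + 5 * L + 2 * L ^ 2 ≤ 12 * L ^ 2 := by nlinarith
    calc _ ≤ K₂ * ε * T * (5 + 5 * L + 2 * L ^ 2) := h6
      _ ≤ K₂ * ε * (L * t) * (12 * L ^ 2) := by gcongr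
      _ = _ := by ring
  -- `B(x, t)` has large mass, so it contains a point at distance at most `t` from the graph
  have vert : ∀ x t, (x, t) ∈ S → vertDist (a (x, t)) x ≤ 3 * t := by
    intro x t hx
    have ht := hS.pos x t hx
    obtain ⟨w, hw, hwt⟩ : ∃ w ∈ closedBall x t, vertDist (a (x, t)) w ≤ t := by
      by_contra! hcon
      have h1 : ENNReal.ofReal t * ENNReal.ofReal (lam * t ^ n) ≤
          ENNReal.ofReal (4 * ε * t ^ (n + 1)) := by
        refine le_trans ?_ ((lintegral_mono_set (closedBall_subset_closedBall
          (by linarith : t ≤ 4 * t))).trans (hS.flat x t hx))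
        refine le_trans (mul_le_mul_right (hS.mass x t hx) _) ?_
        rw [← setLIntegral_const]
        exact setLIntegral_mono' isClosed_closedBall.measurableSet fun w hw =>
          ENNReal.ofReal_le_ofReal (hcon w hw).le
      rw [← ENNReal.ofReal_mul ht.le, ENNReal.ofReal_le_ofReal_iff (by positivity), pow_succ] at h1
      have : 0 < t ^ n * t := by positivity
      nlinarith
    have h2 := vertDist_le_add (zero_le_one) (by simpa using hS.slope x t hx) x w
    rw [mem_closedBall, dist_comm, dist_eq_norm] at hw
    linarith
  -- at the scale `r = ‖x - y‖` the graphs of both centres are `K₂ ε r`-close, so the vertical part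
  -- of `x - y` exceeds the horizontal one by little more than the distances of the centres to the
  -- graphs
  have lip : ∀ x t y s, (x, t) ∈ S → (y, s) ∈ S →
        ‖x - y‖ ≤ 4 * ‖P₀.orthogonalProjectionOnto x - P₀.orthogonalProjectionOnto y‖ +
          6 * (t + s) := by
    intro x t y s hx hy
    have ht := hS.pos x t hx
    have hs := hS.pos y s hy
    have hpn := norm_nonneg (P₀.orthogonalProjectionOnto x - P₀.orthogonalProjectionOnto y)
    set r := ‖x - y‖ with hr
    rcases le_or_gt r t with hrt | hrt
    · linarith
    rcases le_or_gt r s with hrs | hrs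
    · linarith
    have hr50 : r < 50 := by linarith [hdist x t y s hx hy]
    have h1 := chain1 x t r (P₀.orthogonalProjectionOnto x) 0 hx hrt.le hr50 le_rfl (by simp)
    have h2 := chain1 y s r (P₀.orthogonalProjectionOnto y) 0 hy hrs.le hr50 le_rfl (by simp)
    have hxr := hS.up x t r hx hrt.le hr50
    have hyr := hS.up y s r hy hrs.le hr50
    have h3 := cmp x r y r (P₀.orthogonalProjectionOnto x) hxr hyr (by linarith) (by linarith)
    rw [sub_self, norm_zero, add_zero] at h3
    have h4 := vert x t hx
    have h5 := vert y s hy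
    have h6 := hS.slope y r hyr (P₀.orthogonalProjectionOnto x - P₀.orthogonalProjectionOnto y)
    unfold vertDist at h4 h5
    have h7 : P₀ᗮ.orthogonalProjectionOnto (x - y) =
        (P₀ᗮ.orthogonalProjectionOnto x - a (x, t) (P₀.orthogonalProjectionOnto x)) +
        (a (x, t) (P₀.orthogonalProjectionOnto x) - a (x, r) (P₀.orthogonalProjectionOnto x)) +
        (a (x, r) (P₀.orthogonalProjectionOnto x) - a (y, r) (P₀.orthogonalProjectionOnto x)) +
        (a (y, r)).linear (P₀.orthogonalProjectionOnto x - P₀.orthogonalProjectionOnto y) +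
        (-(a (y, s) (P₀.orthogonalProjectionOnto y) - a (y, r) (P₀.orthogonalProjectionOnto y))) +
        (-(P₀ᗮ.orthogonalProjectionOnto y - a (y, s) (P₀.orthogonalProjectionOnto y))) := by
      rw [map_sub, affineMap_apply_eq (a (y, r)) (P₀.orthogonalProjectionOnto x)
        (P₀.orthogonalProjectionOnto y)]
      abel
    have h8 : ‖P₀ᗮ.orthogonalProjectionOnto (x - y)‖ ≤ 3 * t + 2 * K₂ * (1 + 0) * ε * r +
        K₂ * ε * r + ‖P₀.orthogonalProjectionOnto x - P₀.orthogonalProjectionOnto y‖ +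
        2 * K₂ * (1 + 0) * ε * r + 3 * s := by
      rw [h7]
      refine (norm_add_le _ _).trans (add_le_add ?_ (by rwa [norm_neg]))
      refine (norm_add_le _ _).trans (add_le_add ?_ (by rwa [norm_neg]))
      refine (norm_add_le _ _).trans (add_le_add ?_ h6)
      refine (norm_add_le _ _).trans (add_le_add ?_ h3)
      exact (norm_add_le _ _).trans (add_le_add h4 h1)
    have h9 := norm_le_proj_add (P₀ := P₀) (x - y)
    rw [map_sub P₀.orthogonalProjectionOnto] at h9
    have h10 : 10 * K₂ * ε * r ≤ 1 * r := by gcongr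
    linarith
  refine ⟨vert, lip, ?_⟩
  intro x t y s L u hx hy hL hst hux huy
  have ht := hS.pos x t hx
  have h1 := lip x t y s hx hy
  have h2 := norm_sub_le_norm_sub_add_norm_sub (P₀.orthogonalProjectionOnto x) u
    (P₀.orthogonalProjectionOnto y)
  rw [norm_sub_rev _ u] at h2
  have h3 : L * s ≤ L * (L * t) := by gcongr
  have h4 : L * t ≤ L ^ 2 * t := by gcongr; nlinarith
  have h5 : t ≤ L ^ 2 * t := by nlinarith
  have h6 : ‖x - y‖ ≤ 20 * L ^ 2 * t := by nlinarith
  have hL2 : L ≤ 20 * L ^ 2 := by nlinarith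
  have hs := hS.pos y s hy
  refine (chain2 x t y s (20 * L ^ 2) u hx hy (by nlinarith) (by nlinarith) h6
    (huy.trans (by gcongr))).trans (le_of_eq (by ring))

/-! ### Good balls and the function `D` -/

theorem besicovitchNumber_pos (N : ℕ) : 0 < besicovitchNumber N := by
  have h := Nat.sInf_mem (exists_isBesicovitchNumber N)
  rw [Nat.pos_iff_ne_zero]
  intro h0
  change IsBesicovitchNumber N (besicovitchNumber N) at h
  rw [h0] at h
  obtain ⟨G, -, hG⟩ := h {((0 : Euc N), (1 : ℝ))} (by simp) ⟨1, by simp⟩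
  have : (0 : Euc N) ∈ ⋃ i, ⋃ B ∈ G i, closedBall B.1 B.2 := hG ⟨_, rfl, rfl⟩
  simp at this

theorem deltaConst_pos (N n : ℕ) : 0 < deltaConst N n := by
  have : (0 : ℝ) < besicovitchNumber N := by exact_mod_cast besicovitchNumber_pos N
  unfold deltaConst
  positivity

namespace IsSetting

variable {N n : ℕ} {p C₀ k η α ε : ℝ} {K : (Fin (n + 2) → Euc N) → ℝ≥0}
  {P₀ : Submodule ℝ (Euc N)} {μ : Measure (Euc N)}

theorem measure_closedBall_le (h : IsSetting n p K C₀ k η P₀ μ) (hC₀ : 0 ≤ C₀) (x : Euc N) (r : ℝ)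
    (hr : 0 < r) : μ (closedBall x r) ≤ ENNReal.ofReal (C₀ * 2 ^ n * r ^ n) := by
  refine (h.upper_regular x r hr).trans (ENNReal.ofReal_le_ofReal ?_)
  rw [mul_assoc, ← mul_pow]
  gcongr
  exact diam_closedBall hr.le

theorem isFiniteMeasure (h : IsSetting n p K C₀ k η P₀ μ) : IsFiniteMeasure μ := by
  refine ⟨?_⟩
  rw [← union_compl_self (closedBall (0 : Euc N) 5)]
  refine (measure_union_le _ _).trans_lt ?_
  rw [h.measure_compl, add_zero]
  exact (h.upper_regular 0 5 (by norm_num)).trans_lt ENNReal.ofReal_lt_top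

theorem norm_le_of_mem_support (h : IsSetting n p K C₀ k η P₀ μ) {x : Euc N}
    (hx : x ∈ μ.support) : ‖x‖ ≤ 5 := by
  have := Measure.support_subset_of_isClosed isClosed_closedBall
    (mem_ae_iff.2 h.measure_compl) hx
  simpa using this

theorem support_nonempty (h : IsSetting n p K C₀ k η P₀ μ) : μ.support.Nonempty := by
  refine Measure.nonempty_support ?_
  rintro rfl
  simpa using h.one_le_measure

/-- Balls of radius at least `10` centred in the support belong to `STotal`, with the plane `P₀`. -/
theorem mem_STotal_of_large (h : IsSetting n p K C₀ k η P₀ μ) (hk : 4 ≤ k) (hα : 0 < α)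
    (hε : 0 < ε) (hηε : η ≤ ε) {x : Euc N} (hx : x ∈ μ.support) {t : ℝ} (ht : 10 ≤ t)
    (ht' : t < 50) : (x, t) ∈ STotal n k α ε P₀ μ := by
  have hplane : IsPlane n P₀.toAffineSubspace := ⟨⟨0, P₀.zero_mem⟩, by
    rw [Submodule.toAffineSubspace_direction]; exact h.finrank_eq⟩
  have htn : (0 : ℝ) < t ^ n := by positivity
  have hbeta : betaPlane n k μ P₀.toAffineSubspace x t ≤ ENNReal.ofReal ε := by
    refine le_trans ?_ (h.beta_le.trans (ENNReal.ofReal_le_ofReal hηε))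
    unfold betaPlane
    refine ENNReal.div_le_div ?_ (ENNReal.ofReal_le_ofReal (by gcongr; linarith))
    calc _ ≤ ∫⁻ y, ENNReal.ofReal (infDist y (P₀.toAffineSubspace : Set (Euc N)) / t) ∂μ :=
          setLIntegral_le_lintegral _ _
      _ = ∫⁻ y in closedBall 0 5,
          ENNReal.ofReal (infDist y (P₀.toAffineSubspace : Set (Euc N)) / t) ∂μ := by
          rw [Measure.restrict_eq_self_of_ae_mem]
          exact mem_ae_iff.2 h.measure_compl
      _ ≤ ∫⁻ y in closedBall 0 (k * 5),
          ENNReal.ofReal (infDist y (P₀.toAffineSubspace : Set (Euc N)) / t) ∂μ :=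
          lintegral_mono_set (closedBall_subset_closedBall (by linarith))
      _ ≤ _ := by
          refine lintegral_mono fun y => ENNReal.ofReal_le_ofReal ?_
          have : 0 ≤ infDist y (P₀.toAffineSubspace : Set (Euc N)) := infDist_nonneg
          gcongr
          linarith
  refine ⟨hx, ⟨by simp; linarith, ht'⟩, ?_, ?_, P₀.toAffineSubspace, hplane,
    hbeta.trans (ENNReal.ofReal_le_ofReal (by linarith)), ?_⟩
  · unfold quotient
    rw [ENNReal.le_div_iff_mul_le (by simp [htn]) (by simp),
      ← ENNReal.ofReal_mul (by have := deltaConst_pos N n; positivity)]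
    calc ENNReal.ofReal (deltaConst N n / 2 * t ^ n) ≤ 1 := by
          rw [ENNReal.ofReal_le_one]
          have : deltaConst N n ≤ 2 / 50 ^ n := min_le_right _ _
          calc deltaConst N n / 2 * t ^ n ≤ 2 / 50 ^ n / 2 * 50 ^ n := by gcongr
            _ = 1 := by field_simp
      _ ≤ μ (closedBall 0 5) := h.one_le_measure
      _ ≤ μ (closedBall x t) := measure_mono (closedBall_subset_closedBall' (by
          have := h.norm_le_of_mem_support hx
          rw [dist_zero_left]; linarith))
  · refine lt_of_le_of_lt ((iInf₂_le _ hplane).trans hbeta) ?_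
    rw [ENNReal.ofReal_lt_ofReal_iff (by linarith)]
    linarith
  · simp [angle, hα.le]

/-- A scale `t ≥ 40` is not bad, as it only tests balls of radius at least `t / 4 ≥ 10`. -/
theorem lt_of_mem_badScales (h : IsSetting n p K C₀ k η P₀ μ) (hk : 4 ≤ k) (hα : 0 < α)
    (hε : 0 < ε) (hηε : η ≤ ε) {x : Euc N} {t : ℝ} (ht : t ∈ badScales n k α ε P₀ μ x) :
    t < 40 := by
  obtain ⟨ht, y, hy, τ, h1, h2, -, h3⟩ := ht
  by_contra! hcon
  exact h3 (h.mem_STotal_of_large hk hα hε hηε hy (by linarith) (by linarith [ht.2]))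

theorem bddAbove_badScales (h : IsSetting n p K C₀ k η P₀ μ) (hk : 4 ≤ k) (hα : 0 < α)
    (hε : 0 < ε) (hηε : η ≤ ε) (x : Euc N) : BddAbove (badScales n k α ε P₀ μ x ∪ {0}) := by
  refine ⟨40, ?_⟩
  rintro t (ht | rfl)
  · exact (h.lt_of_mem_badScales hk hα hε hηε ht).le
  · norm_num

theorem hFun_nonneg (h : IsSetting n p K C₀ k η P₀ μ) (hk : 4 ≤ k) (hα : 0 < α)
    (hε : 0 < ε) (hηε : η ≤ ε) (x : Euc N) : 0 ≤ hFun n k α ε P₀ μ x :=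
  le_csSup (h.bddAbove_badScales hk hα hε hηε x) (Or.inr rfl)

theorem hFun_le (h : IsSetting n p K C₀ k η P₀ μ) (hk : 4 ≤ k) (hα : 0 < α)
    (hε : 0 < ε) (hηε : η ≤ ε) (x : Euc N) : hFun n k α ε P₀ μ x ≤ 40 := by
  refine csSup_le ⟨0, Or.inr rfl⟩ ?_
  rintro t (ht | rfl)
  · exact (h.lt_of_mem_badScales hk hα hε hηε ht).le
  · norm_num

/-- The good balls are exactly the balls centred in the support of radius in `(0, 50)` and at least
`h`. -/
theorem mem_goodBalls_iff (h : IsSetting n p K C₀ k η P₀ μ) (hk : 4 ≤ k) (hα : 0 < α)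
    (hε : 0 < ε) (hηε : η ≤ ε) {x : Euc N} {t : ℝ} :
    (x, t) ∈ goodBalls n k α ε P₀ μ ↔
      x ∈ μ.support ∧ 0 < t ∧ t < 50 ∧ hFun n k α ε P₀ μ x ≤ t := by
  refine ⟨fun hx => ⟨hx.1.1, hx.1.2.1.1, hx.1.2.1.2, hx.2⟩, ?_⟩
  rintro ⟨hx, ht, ht', hh⟩
  refine ⟨?_, hh⟩
  rcases le_or_gt 10 t with h10 | h10
  · exact h.mem_STotal_of_large hk hα hε hηε hx h10 ht'
  by_contra hcon
  -- the radius `t` lies between a quarter and a third of `7 / 2 * t`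
  have h1 : 7 / 2 * t ∈ badScales n k α ε P₀ μ x :=
    ⟨⟨by linarith, by linarith⟩, x, hx, t, by linarith, by linarith, by simp [ht], hcon⟩
  have h2 := le_csSup (h.bddAbove_badScales hk hα hε hηε x) (Or.inl h1)
  change _ ≤ hFun n k α ε P₀ μ x at h2
  linarith

theorem mem_goodBalls_of_mem_zSet (h : IsSetting n p K C₀ k η P₀ μ) (hk : 4 ≤ k) (hα : 0 < α)
    (hε : 0 < ε) (hηε : η ≤ ε) {z : Euc N} (hz : z ∈ zSet n k α ε P₀ μ) {t : ℝ} (ht : 0 < t)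
    (ht' : t < 50) : (z, t) ∈ goodBalls n k α ε P₀ μ :=
  (h.mem_goodBalls_iff hk hα hε hηε).2 ⟨hz.1, ht, ht', by rw [hz.2]; exact ht.le⟩

/-- The good balls, with the graphs of their admissible planes, form a flat system. -/
theorem exists_flatSystem (h : IsSetting n p K C₀ k η P₀ μ) (hk : 4 ≤ k) (hα : 0 < α)
    (hα' : α ≤ 1 / 4) (hε : 0 < ε) (hηε : η ≤ ε) {plane : Euc N × ℝ → AffineSubspace ℝ (Euc N)}
    (hplane : ∀ B ∈ STotal n k α ε P₀ μ, IsGoodPlane n k α ε P₀ μ B (plane B)) :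
    ∃ a : Euc N × ℝ → (P₀ →ᵃ[ℝ] P₀ᗮ),
      FlatSystem n P₀ μ (deltaConst N n / 2) ε (goodBalls n k α ε P₀ μ) a ∧
      ∀ B ∈ goodBalls n k α ε P₀ μ, ∀ u, graphMap P₀ (plane B) u = a B u := by
  have hgraph : ∀ B : Euc N × ℝ, ∃ a : P₀ →ᵃ[ℝ] P₀ᗮ, B ∈ goodBalls n k α ε P₀ μ →
      (∀ v, ‖a.linear v‖ ≤ ‖v‖) ∧ (∀ u, graphMap P₀ (plane B) u = a u) ∧
      ∀ w, vertDist a w ≤ 2 * infDist w (plane B : Set (Euc N)) := by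
    intro B
    by_cases hB : B ∈ goodBalls n k α ε P₀ μ
    · obtain ⟨a, ha⟩ := IsPlane.exists_graph h.finrank_eq (hplane B hB.1).1
        ((hplane B hB.1).2.2.trans hα')
      exact ⟨a, fun _ => ha⟩
    · exact ⟨0, fun h => absurd h hB⟩
  choose a ha using hgraph
  refine ⟨a, ?_, fun B hB => (ha B hB).2.1⟩
  have hiff := fun x t => h.mem_goodBalls_iff hk hα hε hηε (x := x) (t := t)
  refine ⟨fun x t hx => hx.1.2.1.1, fun x t hx => hx.1.2.1.2,
    fun x t hx => h.norm_le_of_mem_support hx.1.1, ?_, ?_, fun x t hx => (ha _ hx).1, ?_⟩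
  · intro x s t hx hst ht
    rw [hiff] at hx ⊢
    exact ⟨hx.1, hx.2.1.trans_le hst, ht, hx.2.2.2.trans hst⟩
  · intro x t hx
    have ht : 0 < t := hx.1.2.1.1
    have htn : (0 : ℝ) < t ^ n := by positivity
    have h1 := hx.1.2.2.1
    unfold quotient at h1
    rwa [ENNReal.le_div_iff_mul_le (by simp [htn]) (by simp),
      ← ENNReal.ofReal_mul (by have := deltaConst_pos N n; positivity)] at h1
  · intro x t hx
    have ht : 0 < t := hx.1.2.1.1
    have htn : (0 : ℝ) < t ^ n := by positivity
    have h1 := (hplane _ hx.1).2.1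
    unfold betaPlane at h1
    rw [ENNReal.div_le_iff_le_mul (by simp [htn]) (by simp),
      ← ENNReal.ofReal_mul (by positivity)] at h1
    calc ∫⁻ w in closedBall x (4 * t), ENNReal.ofReal (vertDist (a (x, t)) w) ∂μ
        ≤ ∫⁻ w in closedBall x (k * t), ENNReal.ofReal (vertDist (a (x, t)) w) ∂μ :=
          lintegral_mono_set (closedBall_subset_closedBall (by gcongr))
      _ ≤ ∫⁻ w in closedBall x (k * t), ENNReal.ofReal (2 * t) *
            ENNReal.ofReal (infDist w (plane (x, t) : Set (Euc N)) / t) ∂μ := by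
          refine lintegral_mono fun w => ?_
          rw [← ENNReal.ofReal_mul (by positivity)]
          refine ENNReal.ofReal_le_ofReal (((ha _ hx).2.2 w).trans (le_of_eq ?_))
          field_simp
      _ = ENNReal.ofReal (2 * t) * ∫⁻ w in closedBall x (k * t),
            ENNReal.ofReal (infDist w (plane (x, t) : Set (Euc N)) / t) ∂μ :=
          lintegral_const_mul' _ _ ENNReal.ofReal_ne_top
      _ ≤ ENNReal.ofReal (2 * t) * ENNReal.ofReal (2 * ε * t ^ n) := by gcongr
      _ = _ := by
          rw [← ENNReal.ofReal_mul (by positivity)]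
          congr 1
          ring

end IsSetting

section Distance

variable {N n : ℕ} {k α ε : ℝ} {P₀ : Submodule ℝ (Euc N)} {μ : Measure (Euc N)}

theorem dFun_bddBelow (x : Euc N) :
    BddBelow ((fun B : Euc N × ℝ => dist B.1 x + B.2) '' goodBalls n k α ε P₀ μ) := by
  refine ⟨0, ?_⟩
  rintro _ ⟨B, hB, rfl⟩
  have := hB.1.2.1.1
  positivity

theorem dFun_nonneg (x : Euc N) : 0 ≤ dFun n k α ε P₀ μ x := by
  refine Real.sInf_nonneg ?_
  rintro _ ⟨B, hB, rfl⟩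
  have := hB.1.2.1.1
  positivity

theorem DFun_nonneg (u : P₀) : 0 ≤ DFun n k α ε P₀ μ u := by
  refine Real.sInf_nonneg ?_
  rintro _ ⟨x, -, rfl⟩
  exact dFun_nonneg x

/-- `D` at `u` is the infimum of `‖π X - u‖ + t` over the good balls `(X, t)`: the point over `u` at
the height of `X` gives the upper bound. -/
theorem DFun_le {X : Euc N} {t : ℝ} (hX : (X, t) ∈ goodBalls n k α ε P₀ μ) (u : P₀) :
    DFun n k α ε P₀ μ u ≤ ‖P₀.orthogonalProjectionOnto X - u‖ + t := by
  set x : Euc N := (u : Euc N) + P₀ᗮ.orthogonalProjectionOnto X with hx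
  have h1 : P₀.orthogonalProjectionOnto x = u := by
    rw [hx, map_add, Submodule.orthogonalProjectionOnto_mem_subspace_eq_self,
      Submodule.orthogonalProjectionOnto_apply_of_mem_orthogonal
      (P₀ᗮ.orthogonalProjectionOnto X).2, add_zero]
  have h2 : dist X x = ‖P₀.orthogonalProjectionOnto X - u‖ := by
    rw [dist_eq_norm, Submodule.coe_norm, Submodule.coe_sub]
    congr 1
    nth_rewrite 1 [← proj_add_proj (P₀ := P₀) X]
    rw [hx]
    abel
  rw [← h2]
  have h3 : dFun n k α ε P₀ μ x ∈
      dFun n k α ε P₀ μ '' {y | P₀.orthogonalProjectionOnto y = u} := mem_image_of_mem _ h1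
  have h4 : BddBelow (dFun n k α ε P₀ μ '' {y | P₀.orthogonalProjectionOnto y = u}) := by
    refine ⟨0, ?_⟩
    rintro _ ⟨y, -, rfl⟩
    exact dFun_nonneg y
  have h5 : dist X x + t ∈ (fun B : Euc N × ℝ => dist B.1 x + B.2) '' goodBalls n k α ε P₀ μ :=
    ⟨(X, t), hX, rfl⟩
  exact (csInf_le h4 h3).trans (csInf_le (dFun_bddBelow x) h5)

/-- The converse bound in the description of `D` as an infimum over the good balls. -/
theorem exists_of_DFun_lt (hne : (goodBalls n k α ε P₀ μ).Nonempty) {u : P₀} {r : ℝ}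
    (hr : DFun n k α ε P₀ μ u < r) : ∃ X t, (X, t) ∈ goodBalls n k α ε P₀ μ ∧
      ‖P₀.orthogonalProjectionOnto X - u‖ + t < r := by
  obtain ⟨_, ⟨x, hx, rfl⟩, hxr⟩ := exists_lt_of_csInf_lt
    (Set.Nonempty.image _ ⟨(u : Euc N), Submodule.orthogonalProjectionOnto_mem_subspace_eq_self u⟩)
    hr
  obtain ⟨_, ⟨B, hB, rfl⟩, hBr⟩ := exists_lt_of_csInf_lt (hne.image _) hxr
  refine ⟨B.1, B.2, hB, lt_of_le_of_lt ?_ hBr⟩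
  have h1 := norm_proj_sub_le (P₀ := P₀) B.1 x
  rw [mem_ofPred_eq] at hx
  rw [hx] at h1
  simpa [dist_eq_norm] using h1

theorem DFun_le_add (hne : (goodBalls n k α ε P₀ μ).Nonempty) (u v : P₀) :
    DFun n k α ε P₀ μ u ≤ DFun n k α ε P₀ μ v + ‖u - v‖ := by
  refine le_of_forall_pos_le_add fun ρ hρ => ?_
  obtain ⟨X, t, hX, h1⟩ := exists_of_DFun_lt hne (lt_add_of_pos_right (DFun n k α ε P₀ μ v) hρ)
  have h2 := DFun_le hX u
  have h3 := norm_sub_le_norm_sub_add_norm_sub (P₀.orthogonalProjectionOnto X) v u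
  rw [norm_sub_rev v u] at h3
  linarith

theorem continuous_DFun (hne : (goodBalls n k α ε P₀ μ).Nonempty) :
    Continuous (DFun n k α ε P₀ μ) := by
  refine (LipschitzWith.of_le_add fun u v => ?_).continuous
  rw [dist_eq_norm]
  exact DFun_le_add hne u v

end Distance

namespace IsSetting

variable {N n : ℕ} {p C₀ k η α ε : ℝ} {K : (Fin (n + 2) → Euc N) → ℝ≥0}
  {P₀ : Submodule ℝ (Euc N)} {μ : Measure (Euc N)}

theorem exists_mem_goodBalls (h : IsSetting n p K C₀ k η P₀ μ) (hk : 4 ≤ k) (hα : 0 < α)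
    (hε : 0 < ε) (hηε : η ≤ ε) : ∃ x, (x, 40) ∈ goodBalls n k α ε P₀ μ := by
  obtain ⟨x, hx⟩ := h.support_nonempty
  exact ⟨x, (h.mem_goodBalls_iff hk hα hε hηε).2 ⟨hx, by norm_num, by norm_num,
    h.hFun_le hk hα hε hηε x⟩⟩

theorem DFun_le_of_norm_le (h : IsSetting n p K C₀ k η P₀ μ) (hk : 4 ≤ k) (hα : 0 < α)
    (hε : 0 < ε) (hηε : η ≤ ε) (u : P₀) : DFun n k α ε P₀ μ u ≤ 45 + ‖u‖ := by
  obtain ⟨x, hx⟩ := h.exists_mem_goodBalls hk hα hε hηε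
  have h1 := DFun_le hx u
  have h2 := norm_sub_le (P₀.orthogonalProjectionOnto x) u
  have h3 := P₀.norm_orthogonalProjectionOnto_apply_le x
  have h4 := h.norm_le_of_mem_support hx.1.1
  linarith

theorem DFun_eq_zero_of_mem (h : IsSetting n p K C₀ k η P₀ μ) (hk : 4 ≤ k) (hα : 0 < α)
    (hε : 0 < ε) (hηε : η ≤ ε) {u : P₀}
    (hu : u ∈ P₀.orthogonalProjectionOnto '' zSet n k α ε P₀ μ) : DFun n k α ε P₀ μ u = 0 := by
  obtain ⟨z, hz, rfl⟩ := hu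
  refine le_antisymm (le_of_forall_pos_le_add fun ρ hρ => ?_) (DFun_nonneg _)
  have := DFun_le (h.mem_goodBalls_of_mem_zSet hk hα hε hηε hz (t := min ρ 1) (by positivity)
    ((min_le_right _ _).trans_lt (by norm_num))) (P₀.orthogonalProjectionOnto z)
  rw [sub_self, norm_zero] at this
  exact this.trans (by gcongr; exact min_le_left _ _)

/-- The zero set of `D` is the projection of `Z`, by compactness of the support. -/
theorem mem_of_DFun_eq_zero (h : IsSetting n p K C₀ k η P₀ μ) (hk : 4 ≤ k) (hα : 0 < α)
    (hε : 0 < ε) (hηε : η ≤ ε) {u : P₀} (hu : DFun n k α ε P₀ μ u = 0) :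
    u ∈ P₀.orthogonalProjectionOnto '' zSet n k α ε P₀ μ := by
  have hne : (goodBalls n k α ε P₀ μ).Nonempty :=
    let ⟨x, hx⟩ := h.exists_mem_goodBalls hk hα hε hηε; ⟨_, hx⟩
  have h1 : ∀ m : ℕ, ∃ X t, (X, t) ∈ goodBalls n k α ε P₀ μ ∧
      ‖P₀.orthogonalProjectionOnto X - u‖ + t < 1 / ((m : ℝ) + 1) := fun m =>
    exists_of_DFun_lt hne (by rw [hu]; positivity)
  choose X t hXt hlt using h1
  have hlim := tendsto_one_div_add_atTop_nhds_zero_nat (𝕜 := ℝ)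
  -- a limit of centres of good balls whose radii tend to zero; no scale is bad for the limit, as a
  -- bad scale is bad for nearby points as well
  obtain ⟨x, hx, φ, hφ, hφx⟩ := h.isCompact_support.tendsto_subseq fun m => (hXt m).1.1
  have hlim' := hlim.comp hφ.tendsto_atTop
  have hpx : P₀.orthogonalProjectionOnto x = u := by
    have h2 : Filter.Tendsto (fun m => P₀.orthogonalProjectionOnto (X (φ m))) Filter.atTop
        (nhds (P₀.orthogonalProjectionOnto x)) :=
      (P₀.orthogonalProjectionOnto.continuous.tendsto x).comp hφx
    refine tendsto_nhds_unique h2 ?_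
    rw [tendsto_iff_norm_sub_tendsto_zero]
    refine squeeze_zero (fun _ => norm_nonneg _) (fun m => ?_) hlim'
    have := (hXt (φ m)).1.2.1.1
    have h3 := hlt (φ m)
    simp only [Function.comp] at this h3 ⊢
    linarith
  refine ⟨x, ⟨hx, le_antisymm (csSup_le ⟨0, Or.inr rfl⟩ ?_) (h.hFun_nonneg hk hα hε hηε x)⟩, hpx⟩
  rintro s (⟨hs, y, hy, τ, h1, h2, h3, h4⟩ | rfl)
  · exfalso
    have h5 : Filter.Tendsto (fun m => dist (X (φ m)) y) Filter.atTop (nhds (dist x y)) :=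
      hφx.dist tendsto_const_nhds
    obtain ⟨m, hm1, hm2⟩ :=
      ((h5.eventually_lt_const h3).and (hlim'.eventually_lt_const hs.1)).exists
    have h6 : s ∈ badScales n k α ε P₀ μ (X (φ m)) := ⟨hs, y, hy, τ, h1, h2, hm1, h4⟩
    have h7 := le_csSup (h.bddAbove_badScales hk hα hε hηε _) (Or.inl h6)
    have h8 := (hXt (φ m)).2
    have h9 := hlt (φ m)
    simp only [hFun] at h8
    simp only [Function.comp] at hm2
    have := norm_nonneg (P₀.orthogonalProjectionOnto (X (φ m)) - u)
    linarith
  · exact le_rfl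

end IsSetting

/-! ### Dyadic cells and the Whitney decomposition -/

section Cells

variable {N n : ℕ} {P₀ : Submodule ℝ (Euc N)} (e : OrthonormalBasis (Fin n) ℝ P₀)

/-- The diameter of a dyadic cell of generation `j`, that is, of side length `2 ^ j`. -/
noncomputable def cellDiam (n : ℕ) (j : ℤ) : ℝ := √n * (2 : ℝ) ^ j

theorem cellDiam_pos (hn : 1 ≤ n) (j : ℤ) : 0 < cellDiam n j := by
  have : (0 : ℝ) < n := by exact_mod_cast hn
  unfold cellDiam
  positivity

theorem cellDiam_add_one (j : ℤ) : cellDiam n (j + 1) = 2 * cellDiam n j := by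
  unfold cellDiam
  rw [zpow_add_one₀ two_ne_zero]
  ring

theorem norm_le_of_coord_le {x : P₀} {c : ℝ} (hx : ∀ l, |e.repr x l| ≤ c) :
    ‖x‖ ≤ √n * c := by
  rw [← e.repr.norm_map, EuclideanSpace.norm_eq]
  rcases isEmpty_or_nonempty (Fin n) with h0 | ⟨⟨l⟩⟩
  · obtain rfl : n = 0 := by rw [← Fintype.card_fin n]; exact Fintype.card_eq_zero
    simp
  have hc : 0 ≤ c := (abs_nonneg _).trans (hx l)
  rw [← Real.sqrt_sq hc, ← Real.sqrt_mul (Nat.cast_nonneg n)]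
  apply Real.sqrt_le_sqrt
  calc ∑ l, ‖e.repr x l‖ ^ 2 ≤ ∑ _l : Fin n, c ^ 2 := Finset.sum_le_sum fun l _ => by
        rw [Real.norm_eq_abs]; gcongr; exact hx l
    _ = n * c ^ 2 := by simp

theorem abs_coord_le (x : P₀) (l : Fin n) : |e.repr x l| ≤ ‖x‖ := by
  rw [← e.repr.norm_map]
  exact PiLp.norm_apply_le (e.repr x) l

theorem norm_sub_le_of_mem_cube {i : ℤ × (Fin n → ℤ)} {r s : ℝ} {u v : P₀} (hu : u ∈ cube e i r)
    (hv : v ∈ cube e i s) : ‖u - v‖ ≤ (r + s) / 2 * cellDiam n i.1 := by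
  refine (norm_le_of_coord_le e (c := (r + s) / 2 * 2 ^ i.1) fun l => ?_).trans
    (le_of_eq (by unfold cellDiam; ring))
  have h1 := abs_sub_le (e.repr u l) (((i.2 l : ℝ) + 1 / 2) * (2 : ℝ) ^ i.1) (e.repr v l)
  have h2 := hu l
  have h3 := hv l
  rw [abs_sub_comm] at h3
  rw [map_sub, PiLp.sub_apply]
  linarith

theorem exists_coord_eq (f : Fin n → ℝ) : ∃ x : P₀, ∀ l, e.repr x l = f l :=
  ⟨e.repr.symm (WithLp.toLp 2 f), by simp⟩

theorem mem_cube_one {i : ℤ × (Fin n → ℤ)} {x : P₀} :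
    x ∈ cube e i 1 ↔ ∀ l, (i.2 l : ℝ) * 2 ^ i.1 ≤ e.repr x l ∧
      e.repr x l ≤ ((i.2 l : ℝ) + 1) * 2 ^ i.1 := by
  refine forall_congr' fun l => ?_
  rw [abs_le]
  constructor <;> rintro ⟨h1, h2⟩ <;> constructor <;> linarith

theorem cube_mono {i : ℤ × (Fin n → ℤ)} {r s : ℝ} (hrs : r ≤ s) : cube e i r ⊆ cube e i s :=
  fun x hx l => (hx l).trans (by gcongr)

theorem exists_mem_cube_one (i : ℤ × (Fin n → ℤ)) : ∃ x, x ∈ cube e i 1 := by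
  obtain ⟨x, hx⟩ := exists_coord_eq e fun l => (i.2 l : ℝ) * 2 ^ i.1
  have : (0 : ℝ) < 2 ^ i.1 := by positivity
  exact ⟨x, (mem_cube_one e).2 fun l => by rw [hx]; constructor <;> linarith⟩

theorem diam_cube (i : ℤ × (Fin n → ℤ)) : diam (cube e i 1) = cellDiam n i.1 := by
  have h2 : (0 : ℝ) < 2 ^ i.1 := by positivity
  have hle : ∀ u ∈ cube e i 1, ∀ v ∈ cube e i 1, dist u v ≤ cellDiam n i.1 := fun u hu v hv => by
    rw [dist_eq_norm]
    simpa using norm_sub_le_of_mem_cube e hu hv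
  apply le_antisymm
  · exact diam_le_of_forall_dist_le (by unfold cellDiam; positivity) hle
  · obtain ⟨x, hx⟩ := exists_coord_eq e fun l => (i.2 l : ℝ) * 2 ^ i.1
    obtain ⟨y, hy⟩ := exists_coord_eq e fun l => ((i.2 l : ℝ) + 1) * 2 ^ i.1
    have h1 : dist y x = cellDiam n i.1 := by
      rw [dist_eq_norm, ← e.repr.norm_map, EuclideanSpace.norm_eq]
      have : ∀ l, e.repr (y - x) l = 2 ^ i.1 := fun l => by
        rw [map_sub, PiLp.sub_apply, hx, hy]; ring
      simp only [this, Real.norm_eq_abs, abs_of_pos h2, Finset.sum_const, Finset.card_univ,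
        Fintype.card_fin, nsmul_eq_mul]
      rw [Real.sqrt_mul (Nat.cast_nonneg n), Real.sqrt_sq h2.le, cellDiam]
    rw [← h1]
    refine dist_le_diam_of_mem (isBounded_iff.2 ⟨_, fun u hu v hv => hle u hu v hv⟩) ?_ ?_
    · exact (mem_cube_one e).2 fun l => by rw [hy]; constructor <;> nlinarith
    · exact (mem_cube_one e).2 fun l => by rw [hx]; constructor <;> nlinarith

/-- The dyadic cell of twice the side length that contains a given one. -/
def parentCell (i : ℤ × (Fin n → ℤ)) : ℤ × (Fin n → ℤ) := (i.1 + 1, fun l => i.2 l / 2)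

theorem cube_subset_parentCell (i : ℤ × (Fin n → ℤ)) : cube e i 1 ⊆ cube e (parentCell i) 1 := by
  intro x hx
  rw [mem_cube_one] at hx ⊢
  intro l
  obtain ⟨h1, h2⟩ := hx l
  have h3 : (0 : ℝ) < 2 ^ i.1 := by positivity
  have h4 : 2 * ((i.2 l / 2 : ℤ) : ℝ) ≤ i.2 l := by
    have : 2 * (i.2 l / 2) ≤ i.2 l := by omega
    exact_mod_cast this
  have h5 : (i.2 l : ℝ) + 1 ≤ 2 * ((i.2 l / 2 : ℤ) : ℝ) + 2 := by
    have : i.2 l + 1 ≤ 2 * (i.2 l / 2) + 2 := by omega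
    exact_mod_cast this
  simp only [parentCell]
  rw [zpow_add_one₀ two_ne_zero]
  constructor <;> nlinarith

end Cells

section Whitney

variable {N n : ℕ} {k α ε : ℝ} {P₀ : Submodule ℝ (Euc N)} {μ : Measure (Euc N)}
  (e : OrthonormalBasis (Fin n) ℝ P₀)

theorem isSmallCell_iff {i : ℤ × (Fin n → ℤ)} : IsSmallCell k α ε μ e i ↔
    ∀ u ∈ cube e i 1, 20 * cellDiam n i.1 ≤ DFun n k α ε P₀ μ u := by
  unfold IsSmallCell
  rw [diam_cube]
  exact forall₂_congr fun u _ => by constructor <;> intro h <;> linarith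

/-- The parent of a Whitney cell is not small. -/
theorem exists_parent_DFun_lt {i : ℤ × (Fin n → ℤ)} (hi : i ∈ whitneyIndex k α ε μ e) :
    ∃ v ∈ cube e (parentCell i) 1, DFun n k α ε P₀ μ v < 40 * cellDiam n i.1 := by
  by_contra! hcon
  have h1 : IsSmallCell k α ε μ e (parentCell i) := (isSmallCell_iff e).2 fun u hu => by
    have := hcon u hu
    simp only [parentCell]
    rw [cellDiam_add_one]
    linarith
  have h2 := congrArg Prod.fst (hi.2 _ h1 (cube_subset_parentCell e i))
  simp [parentCell] at h2

theorem le_DFun_of_mem_cube (hne : (goodBalls n k α ε P₀ μ).Nonempty) {i : ℤ × (Fin n → ℤ)}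
    (hi : i ∈ whitneyIndex k α ε μ e) {u : P₀} (hu : u ∈ cube e i 3) :
    18 * cellDiam n i.1 ≤ DFun n k α ε P₀ μ u := by
  obtain ⟨v, hv⟩ := exists_mem_cube_one e i
  have h1 := norm_sub_le_of_mem_cube e hv hu
  have h2 := (isSmallCell_iff e).1 hi.1 v hv
  have h3 := DFun_le_add hne v u
  linarith

theorem DFun_lt_of_mem_cube (hne : (goodBalls n k α ε P₀ μ).Nonempty) {i : ℤ × (Fin n → ℤ)}
    (hi : i ∈ whitneyIndex k α ε μ e) {u : P₀} (hu : u ∈ cube e i 3) :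
    DFun n k α ε P₀ μ u < 44 * cellDiam n i.1 := by
  obtain ⟨v, hv⟩ := exists_mem_cube_one e i
  obtain ⟨w, hw, hlt⟩ := exists_parent_DFun_lt e hi
  have h1 := norm_sub_le_of_mem_cube e hu hv
  have h2 := norm_sub_le_of_mem_cube e (cube_subset_parentCell e i hv) hw
  simp only [parentCell] at h2
  rw [cellDiam_add_one] at h2
  have h3 := DFun_le_add hne u w
  have h4 := norm_sub_le_norm_sub_add_norm_sub u v w
  linarith

/-- The Whitney cells cover the set where `D` is positive. -/
theorem exists_whitneyIndex (hn : 1 ≤ n) (hne : (goodBalls n k α ε P₀ μ).Nonempty) {u : P₀}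
    (hu : 0 < DFun n k α ε P₀ μ u) : ∃ i ∈ whitneyIndex k α ε μ e, u ∈ cube e i 1 := by
  -- the cell of generation `j` with `u` in its half-open version
  let Q : ℤ → ℤ × (Fin n → ℤ) := fun j => (j, fun l => ⌊e.repr u l / 2 ^ j⌋)
  have hQ : ∀ j l, ((Q j).2 l : ℝ) * 2 ^ j ≤ e.repr u l ∧
      e.repr u l < ((Q j).2 l + 1 : ℝ) * 2 ^ j := by
    intro j l
    have h2 : (0 : ℝ) < 2 ^ j := by positivity
    rw [← le_div_iff₀ h2, ← div_lt_iff₀ h2]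
    exact ⟨Int.floor_le _, Int.lt_floor_add_one _⟩
  have huQ : ∀ j, u ∈ cube e (Q j) 1 := fun j =>
    (mem_cube_one e).2 fun l => ⟨(hQ j l).1, (hQ j l).2.le⟩
  have hn0 : (0 : ℝ) < √n := Real.sqrt_pos.2 (by exact_mod_cast hn)
  have hbdd : ∃ b : ℤ, ∀ j, IsSmallCell k α ε μ e (Q j) → j ≤ b := by
    obtain ⟨m, hm⟩ := pow_unbounded_of_one_lt (DFun n k α ε P₀ μ u / (20 * √n)) one_lt_two
    refine ⟨m, fun j hj => ?_⟩
    have h1 := (isSmallCell_iff e).1 hj u (huQ j)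
    unfold cellDiam at h1
    rw [div_lt_iff₀ (by positivity)] at hm
    have h3 : (2 : ℝ) ^ j < 2 ^ (m : ℤ) := by
      rw [zpow_natCast]
      by_contra! hcon
      have := mul_le_mul_of_nonneg_right hcon (by positivity : 0 ≤ 20 * √n)
      change 20 * (√n * 2 ^ j) ≤ _ at h1
      linarith
    exact ((zpow_lt_zpow_iff_right₀ (one_lt_two)).1 h3).le
  have hex : ∃ j, IsSmallCell k α ε μ e (Q j) := by
    obtain ⟨m, hm⟩ := exists_pow_lt_of_lt_one (x := DFun n k α ε P₀ μ u / (21 * √n))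
      (by positivity) (by norm_num : (1 / 2 : ℝ) < 1)
    refine ⟨-m, (isSmallCell_iff e).2 fun v hv => ?_⟩
    have h1 := norm_sub_le_of_mem_cube e (huQ (-m)) hv
    have h2 := DFun_le_add hne u v
    rw [lt_div_iff₀ (by positivity)] at hm
    change ‖u - v‖ ≤ (1 + 1) / 2 * cellDiam n (-m) at h1
    change 20 * cellDiam n (-m) ≤ _
    have h3 : cellDiam n (-m) * 21 ≤ DFun n k α ε P₀ μ u := by
      unfold cellDiam
      rw [zpow_neg, zpow_natCast, ← inv_pow, ← one_div]
      linarith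
    linarith
  obtain ⟨j, hj, hmax⟩ := Int.exists_greatest_of_bdd hbdd hex
  refine ⟨Q j, ⟨hj, fun i' hi' hsub => ?_⟩, huQ j⟩
  -- a small cell containing `Q j` is `Q j'` for a larger generation `j'`
  obtain ⟨x, hx⟩ := exists_coord_eq e fun l => ((Q j).2 l : ℝ) * 2 ^ j
  obtain ⟨y, hy⟩ := exists_coord_eq e fun l => ((Q j).2 l + 1 : ℝ) * 2 ^ j
  have h2 : (0 : ℝ) < 2 ^ j := by positivity
  have hx' := (mem_cube_one e).1 (hsub ((mem_cube_one e).2 fun l => by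
    rw [hx]; exact ⟨le_rfl, by change _ ≤ ((Q j).2 l + 1 : ℝ) * 2 ^ j; nlinarith⟩))
  have hy' := (mem_cube_one e).1 (hsub ((mem_cube_one e).2 fun l => by
    rw [hy]; exact ⟨by change ((Q j).2 l : ℝ) * 2 ^ j ≤ _; nlinarith, le_rfl⟩))
  have h2' : (0 : ℝ) < 2 ^ i'.1 := by positivity
  have heq : i' = Q i'.1 := by
    refine Prod.ext rfl (funext fun l => ?_)
    symm
    change ⌊e.repr u l / 2 ^ i'.1⌋ = i'.2 l
    rw [Int.floor_eq_iff, le_div_iff₀ h2', div_lt_iff₀ h2']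
    have h3 := (hx' l).1
    have h4 := (hy' l).2
    rw [hx] at h3
    rw [hy] at h4
    exact ⟨h3.trans (hQ j l).1, (hQ j l).2.trans_le h4⟩
  have hle : i'.1 ≤ j := hmax _ (heq ▸ hi')
  have hge : j ≤ i'.1 := by
    have l : Fin n := ⟨0, hn⟩
    have h3 := (hx' l).1
    have h4 := (hy' l).2
    rw [hx] at h3
    rw [hy] at h4
    have h5 : (2 : ℝ) ^ j ≤ 2 ^ i'.1 := by linarith
    exact (zpow_le_zpow_iff_right₀ one_lt_two).1 h5
  rw [heq, le_antisymm hle hge]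

/-- Only boundedly many of the cubes `3 R_i` come close to a given point, at the scale of `D`. -/
theorem whitney_finite (hn : 1 ≤ n) (hne : (goodBalls n k α ε P₀ μ).Nonempty) {q : P₀}
    (hq : 0 < DFun n k α ε P₀ μ q) :
    ∃ J : Finset (ℤ × (Fin n → ℤ)), J.card ≤ 3 * (4 * n + 1) ^ n ∧
      ∀ i ∈ whitneyIndex k α ε μ e, ∀ u ∈ cube e i 3,
        ‖u - q‖ ≤ DFun n k α ε P₀ μ q / 100 → i ∈ J := by
  set D := DFun n k α ε P₀ μ q with hD
  by_cases hex : ∃ i ∈ whitneyIndex k α ε μ e, ∃ u ∈ cube e i 3, ‖u - q‖ ≤ D / 100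
  swap
  · push Not at hex
    exact ⟨∅, by simp, fun i hi u hu hlt => absurd hlt (not_le.2 (hex i hi u hu))⟩
  have hw : ∀ i ∈ whitneyIndex k α ε μ e, ∀ u ∈ cube e i 3, ‖u - q‖ ≤ D / 100 →
      18 * cellDiam n i.1 ≤ 101 / 100 * D ∧ 99 / 100 * D < 44 * cellDiam n i.1 := by
    intro i hi u hu huq
    have h1 := le_DFun_of_mem_cube e hne hi hu
    have h2 := DFun_lt_of_mem_cube e hne hi hu
    have h3 := DFun_le_add hne u q
    have h4 := DFun_le_add hne q u
    rw [norm_sub_rev] at h4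
    constructor <;> linarith
  -- all cells in question have a generation within `1` of that of `i₀`, and coordinates in a range
  -- of at most `4 * n + 1` integers
  obtain ⟨i₀, hi₀, u₀, hu₀, huq₀⟩ := hex
  have hw₀ := hw i₀ hi₀ u₀ hu₀ huq₀
  let F : ℤ → Finset (ℤ × (Fin n → ℤ)) := fun j =>
    (Fintype.piFinset fun l => Finset.Icc ⌈e.repr q l / 2 ^ j - 1 / 2 - 2 * n⌉
      ⌊e.repr q l / 2 ^ j - 1 / 2 + 2 * n⌋).map ⟨fun m => (j, m), fun _ _ h => (Prod.ext_iff.1 h).2⟩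
  have hF : ∀ j, (F j).card ≤ (4 * n + 1) ^ n := by
    intro j
    rw [Finset.card_map, Fintype.card_piFinset]
    refine (Finset.prod_le_pow_card _ _ (4 * n + 1) fun l _ => ?_).trans (by simp)
    rw [Int.card_Icc]
    have h1 := Int.le_ceil (e.repr q l / 2 ^ j - 1 / 2 - 2 * (n : ℝ))
    have h2 := Int.floor_le (e.repr q l / 2 ^ j - 1 / 2 + 2 * (n : ℝ))
    have h3 : ((⌊e.repr q l / 2 ^ j - 1 / 2 + 2 * (n : ℝ)⌋ -
      ⌈e.repr q l / 2 ^ j - 1 / 2 - 2 * (n : ℝ)⌉ : ℤ) : ℝ) ≤ ((4 * n : ℤ) : ℝ) := by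
      push_cast
      linarith
    have h4 := Int.cast_le.1 h3
    omega
  refine ⟨(Finset.Icc (i₀.1 - 1) (i₀.1 + 1)).biUnion F, ?_, fun i hi u hu huq => ?_⟩
  · refine (Finset.card_biUnion_le_card_mul _ _ _ fun j _ => hF j).trans ?_
    rw [Int.card_Icc]
    gcongr
    omega
  · have hwi := hw i hi u hu huq
    have hn1 : (1 : ℝ) ≤ n := by exact_mod_cast hn
    have hn0 : (0 : ℝ) < √n := Real.sqrt_pos.2 (by linarith)
    have hlt : ∀ a b : ℤ, cellDiam n a < 4 * cellDiam n b → a ≤ b + 1 := by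
      intro a b hab
      have h4 : 4 * cellDiam n b = cellDiam n (b + 1 + 1) := by
        rw [cellDiam_add_one, cellDiam_add_one]; ring
      rw [h4] at hab
      unfold cellDiam at hab
      have := (zpow_lt_zpow_iff_right₀ (one_lt_two (α := ℝ))).1 (lt_of_mul_lt_mul_left hab hn0.le)
      omega
    have h1 := hlt i.1 i₀.1 (by linarith)
    have h2 := hlt i₀.1 i.1 (by linarith)
    refine Finset.mem_biUnion.2 ⟨i.1, Finset.mem_Icc.2 ⟨by omega, h1⟩, ?_⟩
    refine Finset.mem_map.2 ⟨i.2, Fintype.mem_piFinset.2 fun l => ?_, rfl⟩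
    have hs : (0 : ℝ) < 2 ^ i.1 := by positivity
    have hsn : √(n : ℝ) ≤ n := by
      rw [Real.sqrt_le_left (by linarith)]; nlinarith
    have h3 : |e.repr q l - ((i.2 l : ℝ) + 1 / 2) * 2 ^ i.1| ≤ 2 * n * 2 ^ i.1 := by
      have h4 := abs_sub_le (e.repr q l) (e.repr u l) (((i.2 l : ℝ) + 1 / 2) * 2 ^ i.1)
      have h5 := hu l
      have h6 := abs_coord_le e (u - q) l
      rw [map_sub, PiLp.sub_apply, abs_sub_comm] at h6
      have h7 : D / 100 ≤ 45 / 100 * (n * 2 ^ i.1) := by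
        have : cellDiam n i.1 ≤ n * 2 ^ i.1 := by unfold cellDiam; gcongr
        linarith
      have h8 : (2 : ℝ) ^ i.1 ≤ n * 2 ^ i.1 := by nlinarith
      linarith
    have h4 : |e.repr q l / 2 ^ i.1 - (i.2 l + 1 / 2)| ≤ 2 * n := by
      rw [show e.repr q l / 2 ^ i.1 - (i.2 l + 1 / 2) =
        (e.repr q l - ((i.2 l : ℝ) + 1 / 2) * 2 ^ i.1) / 2 ^ i.1 by field_simp, abs_div,
        abs_of_pos hs, div_le_iff₀ hs]
      exact h3
    rw [abs_le] at h4
    rw [Finset.mem_Icc, Int.ceil_le, Int.le_floor]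
    constructor <;> linarith

end Whitney

/-- Cut-off functions with the required properties exist: they are obtained by scaling from one
product of one-dimensional bump functions. -/
theorem exists_bump {n : ℕ} (hn : 1 ≤ n) : ∃ b : ℝ, 0 < b ∧ ∀ (N : ℕ) (P₀ : Submodule ℝ (Euc N))
    (e : OrthonormalBasis (Fin n) ℝ P₀) (i : ℤ × (Fin n → ℤ)), ∃ f : P₀ → ℝ,
      ContDiff ℝ (⊤ : ℕ∞) f ∧ (∀ a, f a ∈ Icc (0 : ℝ) 1) ∧ (∀ a ∈ cube e i 2, f a = 1) ∧
      (∀ a ∉ cube e i 3, f a = 0) ∧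
      ∀ m : ℕ, 1 ≤ m → m ≤ 2 → ∀ a, ‖iteratedFDeriv ℝ m f a‖ ≤ b / cellDiam n i.1 ^ m := by
  let ψ : ContDiffBump (0 : ℝ) := ⟨1, 3 / 2, one_pos, by norm_num⟩
  let Ψ : EuclideanSpace ℝ (Fin n) → ℝ := fun x => ∏ l, ψ (x l)
  have hΨ : ContDiff ℝ (⊤ : ℕ∞) Ψ := by
    refine contDiff_prod fun l _ => ψ.contDiff.comp ?_
    fun_prop
  have hsupp : HasCompactSupport Ψ := by
    refine HasCompactSupport.of_support_subset_isCompact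
      (isCompact_closedBall (0 : EuclideanSpace ℝ (Fin n)) (√n * (3 / 2))) ?_
    intro x hx
    rw [mem_closedBall_zero_iff, EuclideanSpace.norm_eq]
    rw [← Real.sqrt_sq (by norm_num : (0 : ℝ) ≤ 3 / 2), ← Real.sqrt_mul (Nat.cast_nonneg n)]
    apply Real.sqrt_le_sqrt
    calc ∑ l, ‖x l‖ ^ 2 ≤ ∑ _l : Fin n, ((3 / 2 : ℝ)) ^ 2 := Finset.sum_le_sum fun l _ => by
          gcongr
          by_contra! hcon
          refine hx (Finset.prod_eq_zero (Finset.mem_univ l) (ψ.zero_of_le_dist ?_))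
          rw [dist_zero_right]
          exact hcon.le
      _ = _ := by simp
  have hB : ∀ m : ℕ, ∃ B, ∀ x, ‖iteratedFDeriv ℝ m Ψ x‖ ≤ B := fun m =>
    (hΨ.continuous_iteratedFDeriv (by exact_mod_cast le_top)).bounded_above_of_compact_support
      (hsupp.iteratedFDeriv m)
  choose B hB using hB
  have hB0 : ∀ m, 0 ≤ B m := fun m => (norm_nonneg _).trans (hB m 0)
  refine ⟨B 1 * √n ^ 1 + B 2 * √n ^ 2 + 1, by have := hB0 1; have := hB0 2; positivity, ?_⟩
  intro N P₀ e i
  have hs : (0 : ℝ) < 2 ^ i.1 := by positivity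
  let c : EuclideanSpace ℝ (Fin n) := WithLp.toLp 2 fun l => (i.2 l : ℝ) + 1 / 2
  let L : P₀ →L[ℝ] EuclideanSpace ℝ (Fin n) :=
    ((2 : ℝ) ^ i.1)⁻¹ • (e.repr.toContinuousLinearEquiv : P₀ →L[ℝ] EuclideanSpace ℝ (Fin n))
  have hL : ∀ a l, L a l = e.repr a l / 2 ^ i.1 := fun a l => by
    simp [L, div_eq_inv_mul]
  have hLn : ‖L‖ ≤ ((2 : ℝ) ^ i.1)⁻¹ := by
    refine L.opNorm_le_bound (by positivity) fun a => ?_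
    simp [L, norm_smul]
  have hcoord : ∀ a l, (L a - c) l = (e.repr a l - ((i.2 l : ℝ) + 1 / 2) * 2 ^ i.1) / 2 ^ i.1 := by
    intro a l
    rw [PiLp.sub_apply, hL]
    simp only [c]
    field_simp
  let f : P₀ → ℝ := (fun x => Ψ (x - c)) ∘ L
  have hshift : ContDiff ℝ (⊤ : ℕ∞) fun x => Ψ (x - c) := hΨ.comp (contDiff_id.sub contDiff_const)
  refine ⟨f, hshift.comp L.contDiff, fun a => ?_, fun a ha => ?_, fun a ha => ?_,
    fun m hm1 hm2 a => ?_⟩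
  · exact ⟨Finset.prod_nonneg fun l _ => ψ.nonneg,
      Finset.prod_le_one (fun l _ => ψ.nonneg) fun l _ => ψ.le_one⟩
  · refine Finset.prod_eq_one fun l _ => ψ.one_of_mem_closedBall ?_
    rw [mem_closedBall_zero_iff, hcoord, Real.norm_eq_abs, abs_div, abs_of_pos hs, div_le_iff₀ hs]
    have := ha l
    change _ ≤ (1 : ℝ) * _
    linarith
  · have hex : ∃ l, ¬ |e.repr a l - ((i.2 l : ℝ) + 1 / 2) * 2 ^ i.1| ≤ 3 * 2 ^ i.1 / 2 := by
      by_contra! hcon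
      exact ha hcon
    obtain ⟨l, hl⟩ := hex
    refine Finset.prod_eq_zero (Finset.mem_univ l) (ψ.zero_of_le_dist ?_)
    rw [dist_zero_right, hcoord, Real.norm_eq_abs, abs_div, abs_of_pos hs, le_div_iff₀ hs]
    change (3 / 2 : ℝ) * _ ≤ _
    linarith [not_le.1 hl]
  · have h1 : ‖iteratedFDeriv ℝ m f a‖ ≤ B m * (((2 : ℝ) ^ i.1)⁻¹) ^ m := by
      rw [ContinuousLinearMap.iteratedFDeriv_comp_right L hshift a (by exact_mod_cast le_top),
        iteratedFDeriv_comp_sub]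
      refine (ContinuousMultilinearMap.norm_compContinuousLinearMap_le _ _).trans ?_
      rw [Fin.prod_const]
      exact mul_le_mul (hB _ _) (by gcongr) (by positivity) (hB0 m)
    refine h1.trans ?_
    have h2 : B m * √n ^ m ≤ B 1 * √n ^ 1 + B 2 * √n ^ 2 + 1 := by
      have h3 : 0 ≤ B 1 * √n ^ 1 := by have := hB0 1; positivity
      have h4 : 0 ≤ B 2 * √n ^ 2 := by have := hB0 2; positivity
      interval_cases m <;> linarith
    unfold cellDiam
    have hn0 : (0 : ℝ) < √n := Real.sqrt_pos.2 (by exact_mod_cast hn)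
    rw [le_div_iff₀ (by positivity), mul_pow, inv_pow]
    refine le_trans (le_of_eq ?_) h2
    field_simp

/-! ### The choices, and `A` at the scale of a good ball -/

section Construction

variable {N n : ℕ} {p C₀ k η α ε b : ℝ} {K : (Fin (n + 2) → Euc N) → ℝ≥0}
  {P₀ : Submodule ℝ (Euc N)} {μ : Measure (Euc N)} {e : OrthonormalBasis (Fin n) ℝ P₀}

theorem cellDiam_lt_of_mem_index12 (h : IsSetting n p K C₀ k η P₀ μ) (hk : 4 ≤ k) (hα : 0 < α)
    (hε : 0 < ε) (hηε : η ≤ ε) {i : ℤ × (Fin n → ℤ)} (hi : i ∈ index12 k α ε μ e) :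
    cellDiam n i.1 < 3 := by
  obtain ⟨hi, u, hu, hu'⟩ := hi
  have h1 := (isSmallCell_iff e).1 hi.1 u hu
  have h2 := h.DFun_le_of_norm_le hk hα hε hηε u
  rw [mem_closedBall_zero_iff] at hu'
  linarith

/-- For every Whitney cell there is a good ball of comparable size nearby. -/
theorem exists_ball (h : IsSetting n p K C₀ k η P₀ μ) (hn : 1 ≤ n) (hnN : n < N) (hk : 4 ≤ k)
    (hα : 0 < α) (hε : 0 < ε) (hηε : η ≤ ε) {i : ℤ × (Fin n → ℤ)} (hi : i ∈ index12 k α ε μ e) :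
    ∃ X t, (X, t) ∈ goodBalls n k α ε P₀ μ ∧ diam (cube e i 1) ≤ diam (closedBall X t) ∧
      diam (closedBall X t) ≤ 200 * diam (cube e i 1) ∧
      setDist (P₀.orthogonalProjectionOnto '' closedBall X t) (cube e i 1) ≤
        100 * diam (cube e i 1) := by
  have hne : (goodBalls n k α ε P₀ μ).Nonempty :=
    let ⟨x, hx⟩ := h.exists_mem_goodBalls hk hα hε hηε; ⟨_, hx⟩
  have hw := cellDiam_lt_of_mem_index12 h hk hα hε hηε hi
  have hw0 := cellDiam_pos hn i.1
  obtain ⟨v, hv, hlt⟩ := exists_parent_DFun_lt e hi.1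
  obtain ⟨X, t, hX, hXt⟩ := exists_of_DFun_lt hne hlt
  rw [h.mem_goodBalls_iff hk hα hε hηε] at hX
  have hpn := norm_nonneg (P₀.orthogonalProjectionOnto X - v)
  -- a good ball near a point of the parent cell, enlarged to a radius of at least the size of the
  -- cell
  have hball : (X, max t (cellDiam n i.1)) ∈ goodBalls n k α ε P₀ μ := by
    rw [h.mem_goodBalls_iff hk hα hε hηε]
    exact ⟨hX.1, lt_max_of_lt_left hX.2.1, max_lt hX.2.2.1 (by linarith),
      hX.2.2.2.trans (le_max_left _ _)⟩
  have : Nontrivial (Euc N) := by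
    have : Nonempty (Fin N) := ⟨⟨0, by omega⟩⟩
    infer_instance
  have h1 : cellDiam n i.1 ≤ max t (cellDiam n i.1) := le_max_right _ _
  refine ⟨X, _, hball, ?_⟩
  rw [Metric.diam_closedBall_eq X (hw0.le.trans h1), diam_cube]
  refine ⟨by linarith, ?_, ?_⟩
  · have : max t (cellDiam n i.1) ≤ 40 * cellDiam n i.1 := max_le (by linarith) (by linarith)
    linarith
  · obtain ⟨x, hx⟩ := exists_mem_cube_one e i
    refine (csInf_le ⟨0, ?_⟩ (mem_image2_of_mem (mem_image_of_mem _
      (mem_closedBall_self (hw0.le.trans h1))) hx)).trans ?_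
    · rintro _ ⟨y, -, z, -, rfl⟩
      exact dist_nonneg
    · have h2 := norm_sub_le_of_mem_cube e hv (cube_subset_parentCell e i hx)
      simp only [parentCell] at h2
      rw [cellDiam_add_one] at h2
      rw [dist_eq_norm]
      have h3 := norm_sub_le_norm_sub_add_norm_sub (P₀.orthogonalProjectionOnto X) v x
      linarith [hX.2.1]

/-- The choices in the construction are possible. -/
theorem nonempty_choices (h : IsSetting n p K C₀ k η P₀ μ) (hn : 1 ≤ n) (hnN : n < N) (hk : 4 ≤ k)
    (hα : 0 < α) (hε : 0 < ε) (hηε : η ≤ ε) {b₁ : ℝ} (hb : b₁ ≤ b)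
    (hbump : ∀ i : ℤ × (Fin n → ℤ), ∃ f : P₀ → ℝ,
      ContDiff ℝ (⊤ : ℕ∞) f ∧ (∀ a, f a ∈ Icc (0 : ℝ) 1) ∧ (∀ a ∈ cube e i 2, f a = 1) ∧
      (∀ a ∉ cube e i 3, f a = 0) ∧
      ∀ m : ℕ, 1 ≤ m → m ≤ 2 → ∀ a, ‖iteratedFDeriv ℝ m f a‖ ≤ b₁ / cellDiam n i.1 ^ m) :
    Nonempty (Choices k α ε b μ e) := by
  have hball : ∀ i : ℤ × (Fin n → ℤ), ∃ B : Euc N × ℝ, i ∈ index12 k α ε μ e →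
      B ∈ goodBalls n k α ε P₀ μ ∧ diam (cube e i 1) ≤ diam (closedBall B.1 B.2) ∧
      diam (closedBall B.1 B.2) ≤ 200 * diam (cube e i 1) ∧
      setDist (P₀.orthogonalProjectionOnto '' closedBall B.1 B.2) (cube e i 1) ≤
        100 * diam (cube e i 1) := by
    intro i
    by_cases hi : i ∈ index12 k α ε μ e
    · obtain ⟨X, t, hX⟩ := exists_ball h hn hnN hk hα hε hηε hi
      exact ⟨(X, t), fun _ => hX⟩
    · exact ⟨0, fun hi' => absurd hi' hi⟩
  have hplane : ∀ B : Euc N × ℝ, ∃ P : AffineSubspace ℝ (Euc N),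
      B ∈ STotal n k α ε P₀ μ → IsGoodPlane n k α ε P₀ μ B P := by
    intro B
    by_cases hB : B ∈ STotal n k α ε P₀ μ
    · obtain ⟨P, hP⟩ := hB.2.2.2.2
      exact ⟨P, fun _ => hP⟩
    · exact ⟨⊥, fun hB' => absurd hB' hB⟩
  choose B hB using hball
  choose P hP using hplane
  choose f hf using hbump
  exact ⟨{
    center := fun i => (B i).1
    radius := fun i => (B i).2
    plane := P
    bump := f
    ball_mem := fun i hi => (hB i hi).1
    diam_le := fun i hi => (hB i hi).2.1
    le_diam := fun i hi => (hB i hi).2.2.1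
    setDist_le := fun i hi => (hB i hi).2.2.2
    plane_good := hP
    bump_contDiff := fun i _ => (hf i).1
    bump_mem := fun i _ => (hf i).2.1
    bump_one := fun i _ => (hf i).2.2.1
    bump_zero := fun i _ => (hf i).2.2.2.1
    bump_deriv := fun i _ m hm1 hm2 a => ((hf i).2.2.2.2 m hm1 hm2 a).trans (by
      rw [diam_cube]
      have := cellDiam_pos hn i.1
      gcongr) }⟩

/-- The radius of `B_i` and the position of its centre, in terms of the size of the cell `R_i`. -/
theorem Choices.center_radius (c : Choices k α ε b μ e) (hn : 1 ≤ n) (hnN : n < N)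
    {i : ℤ × (Fin n → ℤ)} (hi : i ∈ index12 k α ε μ e) :
    cellDiam n i.1 ≤ 2 * c.radius i ∧ c.radius i ≤ 100 * cellDiam n i.1 ∧
    ∀ u ∈ cube e i 3, ‖u - P₀.orthogonalProjectionOnto (c.center i)‖ ≤ 207 * c.radius i := by
  have : Nontrivial (Euc N) := by
    have : Nonempty (Fin N) := ⟨⟨0, by omega⟩⟩
    infer_instance
  have hr : 0 < c.radius i := (c.ball_mem i hi).1.2.1.1
  have hw0 := cellDiam_pos hn i.1
  have h1 := c.diam_le i hi
  have h2 := c.le_diam i hi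
  have h3 := c.setDist_le i hi
  rw [Metric.diam_closedBall_eq _ hr.le, diam_cube] at h1 h2
  rw [diam_cube] at h3
  refine ⟨h1, by linarith, fun u hu => ?_⟩
  obtain ⟨x, hx⟩ := exists_mem_cube_one e i
  have hne : (image2 dist (P₀.orthogonalProjectionOnto ''
      closedBall (c.center i) (c.radius i)) (cube e i 1)).Nonempty :=
    ⟨_, mem_image2_of_mem (mem_image_of_mem _ (mem_closedBall_self hr.le)) hx⟩
  obtain ⟨_, ⟨_, ⟨y, hy, rfl⟩, z, hz, rfl⟩, hlt⟩ := exists_lt_of_csInf_lt hne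
    (lt_of_le_of_lt h3 (by linarith : 100 * cellDiam n i.1 < 101 * cellDiam n i.1))
  have h4 := norm_sub_le_of_mem_cube e hu hz
  rw [dist_comm, dist_eq_norm] at hlt
  have h5 := norm_proj_sub_le (P₀ := P₀) y (c.center i)
  rw [mem_closedBall, dist_eq_norm] at hy
  have h6 := norm_sub_le_norm_sub_add_norm_sub u z (P₀.orthogonalProjectionOnto (c.center i))
  have h7 := norm_sub_le_norm_sub_add_norm_sub z (P₀.orthogonalProjectionOnto y)
    (P₀.orthogonalProjectionOnto (c.center i))
  linarith

/-- Off the projection of `Z`, the function `A` is locally a finite convex combination. -/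
theorem Choices.A_eq (c : Choices k α ε b μ e) (h : IsSetting n p K C₀ k η P₀ μ) (hn : 1 ≤ n)
    (hk : 4 ≤ k) (hα : 0 < α) (hε : 0 < ε) (hηε : η ≤ ε)
    {a : Euc N × ℝ → (P₀ →ᵃ[ℝ] P₀ᗮ)}
    (ha : ∀ B ∈ goodBalls n k α ε P₀ μ, ∀ u, graphMap P₀ (c.plane B) u = a B u)
    {u : P₀} (hu : ‖u‖ ≤ 12) (hD : 0 < DFun n k α ε P₀ μ u) {J : Finset (ℤ × (Fin n → ℤ))}
    (hJ : ∀ i ∈ J, i ∈ index12 k α ε μ e)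
    (hJ' : ∀ i ∈ index12 k α ε μ e, u ∈ cube e i 3 → i ∈ J) :
    1 ≤ ∑ i ∈ J, c.bump i u ∧
      c.A u = (∑ i ∈ J, c.bump i u)⁻¹ • ∑ i ∈ J, c.bump i u • a (c.center i, c.radius i) u := by
  have hne : (goodBalls n k α ε P₀ μ).Nonempty :=
    let ⟨x, hx⟩ := h.exists_mem_goodBalls hk hα hε hηε; ⟨_, hx⟩
  have hZ : u ∉ P₀.orthogonalProjectionOnto '' zSet n k α ε P₀ μ := fun hu =>
    hD.ne' (h.DFun_eq_zero_of_mem hk hα hε hηε hu)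
  have hsum : ∑ᶠ j ∈ index12 k α ε μ e, c.bump j u = ∑ i ∈ J, c.bump i u := by
    refine finsum_mem_eq_sum_of_inter_support_eq _ (Set.ext fun i => ?_)
    refine ⟨fun hi => ⟨hJ' i hi.1 ?_, hi.2⟩, fun hi => ⟨hJ i hi.1, hi.2⟩⟩
    by_contra hcon
    exact hi.2 (c.bump_zero i hi.1 u hcon)
  refine ⟨?_, ?_⟩
  · obtain ⟨i, hi, hui⟩ := exists_whitneyIndex e hn hne hD
    have hi12 : i ∈ index12 k α ε μ e := ⟨hi, u, hui, by simpa using hu⟩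
    rw [← c.bump_one i hi12 u (cube_mono e (by norm_num) hui)]
    exact Finset.single_le_sum (f := fun i => c.bump i u)
      (fun j hj => (c.bump_mem j (hJ j hj) u).1) (hJ' i hi12 (cube_mono e (by norm_num) hui))
  · unfold Choices.A
    rw [if_neg hZ, finsum_mem_eq_sum_of_inter_support_eq (t := J), Finset.smul_sum]
    · refine Finset.sum_congr rfl fun i hi => ?_
      rw [ha _ (c.ball_mem i (hJ i hi)), smul_smul, Choices.phi, hsum, div_eq_inv_mul]
    · refine Set.ext fun i => ?_
      refine ⟨fun hi => ⟨hJ' i hi.1 ?_, hi.2⟩, fun hi => ⟨hJ i hi.1, hi.2⟩⟩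
      by_contra hcon
      refine hi.2 ?_
      simp [Choices.phi, c.bump_zero i hi.1 u hcon]

/-- At every scale, the function `A` stays `ε`-close to the graphs of the good balls of that
scale. -/
theorem Choices.norm_A_sub_le (c : Choices k α ε b μ e) (h : IsSetting n p K C₀ k η P₀ μ)
    (hn : 1 ≤ n) (hnN : n < N) (hk : 4 ≤ k) (hα : 0 < α) (hε : 0 < ε) (hηε : η ≤ ε)
    {a : Euc N × ℝ → (P₀ →ᵃ[ℝ] P₀ᗮ)}
    (ha : ∀ B ∈ goodBalls n k α ε P₀ μ, ∀ u, graphMap P₀ (c.plane B) u = a B u) {M : ℝ}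
    (hvert : ∀ x t, (x, t) ∈ goodBalls n k α ε P₀ μ → vertDist (a (x, t)) x ≤ 3 * t)
    (hchain : ∀ x t y s L u, (x, t) ∈ goodBalls n k α ε P₀ μ → (y, s) ∈ goodBalls n k α ε P₀ μ →
      1 ≤ L → s ≤ L * t → ‖u - P₀.orthogonalProjectionOnto x‖ ≤ L * t →
        ‖u - P₀.orthogonalProjectionOnto y‖ ≤ L * s →
        ‖a (x, t) u - a (y, s) u‖ ≤ M * L ^ 6 * ε * t)
    {x : Euc N} {t L : ℝ} (hx : (x, t) ∈ goodBalls n k α ε P₀ μ) (hL : 1 ≤ L) {u : P₀}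
    (hu : ‖u‖ ≤ 12) (hux : ‖u - P₀.orthogonalProjectionOnto x‖ ≤ L * t) :
    ‖c.A u - a (x, t) u‖ ≤ M * (207 * L) ^ 6 * ε * t := by
  have hne : (goodBalls n k α ε P₀ μ).Nonempty := ⟨_, hx⟩
  have ht : 0 < t := hx.1.2.1.1
  have ht' : t < 50 := hx.1.2.1.2
  have h207 : L * t ≤ 207 * L * t := by nlinarith
  rcases (DFun_nonneg (n := n) (k := k) (α := α) (ε := ε) (μ := μ) u).eq_or_lt with hD | hD
  · have hZ := h.mem_of_DFun_eq_zero hk hα hε hηε hD.symm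
    have hz : zInv n k α ε P₀ μ u ∈ zSet n k α ε P₀ μ ∧
        P₀.orthogonalProjectionOnto (zInv n k α ε P₀ μ u) = u := by
      refine Classical.epsilon_spec
        (p := fun x => x ∈ zSet n k α ε P₀ μ ∧ P₀.orthogonalProjectionOnto x = u) ?_
      obtain ⟨z, hz, hzu⟩ := hZ
      exact ⟨z, hz, hzu⟩
    have hA : c.A u = P₀ᗮ.orthogonalProjectionOnto (zInv n k α ε P₀ μ u) := by
      unfold Choices.A
      rw [if_pos hZ]
    rw [hA]
    set z := zInv n k α ε P₀ μ u
    refine le_of_forall_pos_le_add fun ρ hρ => ?_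
    -- the balls around `z` of arbitrarily small radius are good
    set s := min t (ρ / 3) with hs
    have hst : s ≤ t := min_le_left _ _
    have hsρ : s ≤ ρ / 3 := min_le_right _ _
    have hs0 : 0 < s := by positivity
    have hzs := h.mem_goodBalls_of_mem_zSet hk hα hε hηε hz.1 hs0 (hst.trans_lt ht')
    have h1 := hvert z s hzs
    unfold vertDist at h1
    rw [hz.2] at h1
    have h2 := hchain x t z s (207 * L) u hx hzs (by linarith) (by nlinarith) (by linarith)
      (by rw [hz.2, sub_self, norm_zero]; positivity)
    rw [norm_sub_rev] at h2
    have h3 := norm_sub_le_norm_sub_add_norm_sub (P₀ᗮ.orthogonalProjectionOnto z) (a (z, s) u)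
      (a (x, t) u)
    linarith
  · obtain ⟨J, -, hJ⟩ := whitney_finite e hn hne hD
    classical
    have hA := c.A_eq h hn hk hα hε hηε ha hu hD (J := J.filter (· ∈ index12 k α ε μ e))
      (fun i hi => (Finset.mem_filter.1 hi).2)
      (fun i hi hui => Finset.mem_filter.2
        ⟨hJ i hi.1 u hui (by rw [sub_self, norm_zero]; positivity), hi⟩)
    set J' := J.filter (· ∈ index12 k α ε μ e) with hJ'
    set s := ∑ i ∈ J', c.bump i u with hs
    have hs0 : s ≠ 0 := by linarith [hA.1]
    have hdiff : c.A u - a (x, t) u = s⁻¹ • ∑ i ∈ J', c.bump i u •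
        (a (c.center i, c.radius i) u - a (x, t) u) := by
      simp only [smul_sub, Finset.sum_sub_distrib, ← Finset.sum_smul]
      rw [hA.2, ← hs, smul_smul, inv_mul_cancel₀ hs0, one_smul]
    have hterm : ∀ i ∈ J', ‖c.bump i u • (a (c.center i, c.radius i) u - a (x, t) u)‖ ≤
        c.bump i u * (M * (207 * L) ^ 6 * ε * t) := by
      intro i hi
      have hi12 := (Finset.mem_filter.1 hi).2
      have hb0 := (c.bump_mem i hi12 u).1
      rw [norm_smul, Real.norm_eq_abs, abs_of_nonneg hb0]
      by_cases hui : u ∈ cube e i 3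
      · refine mul_le_mul_of_nonneg_left ?_ hb0
        obtain ⟨-, h2, h3⟩ := c.center_radius hn hnN hi12
        have h4 := le_DFun_of_mem_cube e hne hi12.1 hui
        have h5 := DFun_le hx u
        rw [norm_sub_rev] at h5
        have h6 : 0 < c.radius i := (c.ball_mem i hi12).1.2.1.1
        have h7 : t ≤ L * t := by nlinarith
        rw [norm_sub_rev]
        exact hchain x t _ _ (207 * L) u hx (c.ball_mem i hi12) (by linarith) (by nlinarith)
          (by linarith) ((h3 u hui).trans (by nlinarith))
      · simp [c.bump_zero i hi12 u hui]
    rw [hdiff, norm_smul, Real.norm_eq_abs, abs_inv, abs_of_pos (by linarith [hA.1] : 0 < s)]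
    calc s⁻¹ * ‖_‖ ≤ s⁻¹ * ∑ i ∈ J', c.bump i u * (M * (207 * L) ^ 6 * ε * t) := by
          have : 0 < s := by linarith [hA.1]
          gcongr
          exact (norm_sum_le _ _).trans (Finset.sum_le_sum hterm)
      _ = _ := by
          rw [← Finset.sum_mul, ← hs]
          field_simp

end Construction

/-! ### Jets, and `A` at scales small compared with `D` -/

section Jet

variable {V W : Type*} [NormedAddCommGroup V] [NormedSpace ℝ V] [NormedAddCommGroup W]
  [NormedSpace ℝ W]

/-- On the ball `B(q,t)` the function `f` agrees with a first order Taylor polynomial up to a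
quadratic error; value, derivative and error are of size `M` at the length scale `D`. -/
def IsJet (f : V → W) (q : V) (D t M : ℝ) : Prop :=
  ∃ (c : W) (L : V →L[ℝ] W), ‖c‖ ≤ M ∧ ‖L‖ ≤ M / D ∧
    ∀ u ∈ closedBall q t, ‖f u - c - L (u - q)‖ ≤ M * (‖u - q‖ / D) ^ 2

theorem IsJet.mono {f : V → W} {q : V} {D t M M' : ℝ} (hf : IsJet f q D t M) (hD : 0 < D)
    (hM : M ≤ M') : IsJet f q D t M' := by
  obtain ⟨c, L, h1, h2, h3⟩ := hf
  exact ⟨c, L, h1.trans hM, h2.trans (by gcongr), fun u hu => (h3 u hu).trans (by gcongr)⟩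

theorem IsJet.sum {ι : Type*} {f : ι → V → W} {q : V} {D t M : ℝ} (J : Finset ι)
    (hf : ∀ i ∈ J, IsJet (f i) q D t M) : IsJet (fun u => ∑ i ∈ J, f i u) q D t (J.card * M) := by
  classical
  have : ∀ i, ∃ (c : W) (L : V →L[ℝ] W), i ∈ J → ‖c‖ ≤ M ∧ ‖L‖ ≤ M / D ∧
      ∀ u ∈ closedBall q t, ‖f i u - c - L (u - q)‖ ≤ M * (‖u - q‖ / D) ^ 2 := by
    intro i
    by_cases hi : i ∈ J
    · obtain ⟨c, L, h⟩ := hf i hi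
      exact ⟨c, L, fun _ => h⟩
    · exact ⟨0, 0, fun h => absurd h hi⟩
  choose c L h using this
  refine ⟨∑ i ∈ J, c i, ∑ i ∈ J, L i, ?_, ?_, fun u hu => ?_⟩
  · refine (norm_sum_le _ _).trans ((Finset.sum_le_sum fun i hi => (h i hi).1).trans ?_)
    simp
  · refine (norm_sum_le _ _).trans ((Finset.sum_le_sum fun i hi => (h i hi).2.1).trans ?_)
    simp [mul_div_assoc]
  · rw [_root_.sum_apply, ← Finset.sum_sub_distrib, ← Finset.sum_sub_distrib]
    refine (norm_sum_le _ _).trans ((Finset.sum_le_sum fun i hi => (h i hi).2.2 u hu).trans ?_)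
    simp [mul_assoc]

theorem IsJet.smul {f : V → ℝ} {g : V → W} {q : V} {D t M₁ M₂ : ℝ} (hD : 0 < D) (htD : t ≤ D)
    (hf : IsJet f q D t M₁) (hg : IsJet g q D t M₂) :
    IsJet (fun u => f u • g u) q D t (6 * M₁ * M₂) := by
  obtain ⟨c, L, h1, h2, h3⟩ := hf
  obtain ⟨d, R, k1, k2, k3⟩ := hg
  have hM₁ : 0 ≤ M₁ := (norm_nonneg _).trans h1
  have hM₂ : 0 ≤ M₂ := (norm_nonneg _).trans k1
  refine ⟨c • d, c • R + L.smulRight d, ?_, ?_, fun u hu => ?_⟩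
  · rw [norm_smul]
    calc ‖c‖ * ‖d‖ ≤ M₁ * M₂ := by gcongr
      _ ≤ 6 * M₁ * M₂ := by nlinarith [mul_nonneg hM₁ hM₂]
  · refine (norm_add_le _ _).trans ?_
    rw [norm_smul, ContinuousLinearMap.norm_smulRight_apply]
    calc ‖c‖ * ‖R‖ + ‖L‖ * ‖d‖ ≤ M₁ * (M₂ / D) + M₁ / D * M₂ := by gcongr
      _ = 2 * (M₁ * M₂) / D := by ring
      _ ≤ 6 * M₁ * M₂ / D :=
          div_le_div_of_nonneg_right (by nlinarith [mul_nonneg hM₁ hM₂]) hD.le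
  · set x := ‖u - q‖ / D with hx
    have hx0 : 0 ≤ x := by positivity
    have hx1 : x ≤ 1 := by
      rw [hx, div_le_one hD]
      rw [mem_closedBall, dist_eq_norm] at hu
      exact hu.trans htD
    have hL : ‖L (u - q)‖ ≤ M₁ * x := by
      refine (L.le_opNorm _).trans ((mul_le_mul_of_nonneg_right h2 (norm_nonneg _)).trans ?_)
      rw [hx]
      exact le_of_eq (by ring)
    have hR : ‖R (u - q)‖ ≤ M₂ * x := by
      refine (R.le_opNorm _).trans ((mul_le_mul_of_nonneg_right k2 (norm_nonneg _)).trans ?_)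
      rw [hx]
      exact le_of_eq (by ring)
    have hef := h3 u hu
    have heg := k3 u hu
    set r := f u - c - L (u - q) with hr
    set s := g u - d - R (u - q) with hs
    have hfu : f u = c + L (u - q) + r := by rw [hr]; ring
    have hgu : g u = d + R (u - q) + s := by rw [hs]; abel
    have hxx : x ^ 2 ≤ 1 := by nlinarith
    have hgn : ‖g u‖ ≤ 3 * M₂ := by
      rw [hgu]
      refine (norm_add_le _ _).trans ((add_le_add (norm_add_le _ _) le_rfl).trans ?_)
      nlinarith
    have hcn : ‖c + L (u - q)‖ ≤ 2 * M₁ := (norm_add_le _ _).trans (by nlinarith)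
    -- the error of the product, as a sum of three terms of second order
    have hdec : f u • g u - c • d - (c • R + L.smulRight d) (u - q) =
        L (u - q) • R (u - q) + (c + L (u - q)) • s + r • g u := by
      rw [_root_.add_apply, _root_.smul_apply, ContinuousLinearMap.smulRight_apply]
      rw [show f u • g u = (c + L (u - q)) • g u + r • g u by rw [← add_smul, ← hfu]]
      nth_rewrite 1 [hgu]
      simp only [smul_add, add_smul]
      abel
    rw [hdec]
    refine (norm_add₃_le).trans ?_
    rw [norm_smul, norm_smul, norm_smul]
    calc ‖L (u - q)‖ * ‖R (u - q)‖ + ‖c + L (u - q)‖ * ‖s‖ + ‖r‖ * ‖g u‖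
        ≤ (M₁ * x) * (M₂ * x) + (2 * M₁) * (M₂ * x ^ 2) + (M₁ * x ^ 2) * (3 * M₂) := by gcongr
      _ = 6 * M₁ * M₂ * x ^ 2 := by ring

/-- The reciprocal of a function bounded below by `1` has a jet. -/
theorem IsJet.inv {f : V → ℝ} {q : V} {D t M : ℝ} (hD : 0 < D) (ht : 0 ≤ t) (htD : t ≤ D)
    (hf : IsJet f q D t M) (hf1 : ∀ u ∈ closedBall q t, 1 ≤ f u) :
    IsJet (fun u => (f u)⁻¹) q D t (1 + M + 4 * M ^ 2) := by
  obtain ⟨c, L, h1, h2, h3⟩ := hf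
  have hM : 0 ≤ M := (norm_nonneg _).trans h1
  have hc : c = f q := by
    have := h3 q (mem_closedBall_self ht)
    simp only [sub_self, map_zero, sub_zero, norm_zero, zero_div] at this
    have := norm_le_zero_iff.1 (this.trans (by simp))
    linarith
  have hc1 : 1 ≤ c := hc ▸ hf1 q (mem_closedBall_self ht)
  have hc0 : 0 < c := by linarith
  have hci : c⁻¹ ≤ 1 := inv_le_one_of_one_le₀ hc1
  have hci2 : (c ^ 2)⁻¹ ≤ 1 := inv_le_one_of_one_le₀ (one_le_pow₀ hc1)
  refine ⟨c⁻¹, -((c ^ 2)⁻¹ • L), ?_, ?_, fun u hu => ?_⟩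
  · rw [Real.norm_eq_abs, abs_of_pos (by positivity)]
    nlinarith
  · rw [norm_neg, norm_smul, Real.norm_eq_abs, abs_of_pos (by positivity)]
    calc (c ^ 2)⁻¹ * ‖L‖ ≤ 1 * (M / D) := by gcongr
      _ ≤ _ := by rw [one_mul]; gcongr; nlinarith
  · set x := ‖u - q‖ / D with hx
    have hx0 : 0 ≤ x := by positivity
    have hx1 : x ≤ 1 := by
      rw [hx, div_le_one hD]
      rw [mem_closedBall, dist_eq_norm] at hu
      exact hu.trans htD
    have hL : |L (u - q)| ≤ M * x := by
      refine (L.le_opNorm _).trans ((mul_le_mul_of_nonneg_right h2 (norm_nonneg _)).trans ?_)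
      rw [hx]
      exact le_of_eq (by ring)
    have hef := h3 u hu
    rw [Real.norm_eq_abs] at hef ⊢
    set r := f u - c - L (u - q) with hr
    have hfu1 := hf1 u hu
    have hfu0 : 0 < f u := by linarith
    have hdiff : |f u - c| ≤ 2 * M * x := by
      rw [show f u - c = L (u - q) + r by rw [hr]; ring]
      refine (abs_add_le _ _).trans ?_
      nlinarith [mul_le_mul_of_nonneg_left hx1 (mul_nonneg hM hx0)]
    -- the expansion of `1 / f` at `c` with its exact second order remainder
    have hdec : (f u)⁻¹ - c⁻¹ - (-((c ^ 2)⁻¹ • L)) (u - q) =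
        -((c ^ 2)⁻¹ * r) + (f u)⁻¹ * (c ^ 2)⁻¹ * (f u - c) ^ 2 := by
      rw [_root_.neg_apply, _root_.smul_apply, smul_eq_mul, hr]
      field_simp
      ring
    rw [hdec]
    refine (abs_add_le _ _).trans ?_
    rw [abs_neg, abs_mul, abs_of_pos (by positivity : 0 < (c ^ 2)⁻¹),
      abs_of_nonneg (by positivity : 0 ≤ (f u)⁻¹ * (c ^ 2)⁻¹ * (f u - c) ^ 2), ← sq_abs (f u - c)]
    have hfi : (f u)⁻¹ ≤ 1 := inv_le_one_of_one_le₀ hfu1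
    calc (c ^ 2)⁻¹ * |r| + (f u)⁻¹ * (c ^ 2)⁻¹ * |f u - c| ^ 2
        ≤ 1 * (M * x ^ 2) + 1 * 1 * (2 * M * x) ^ 2 := by gcongr
      _ ≤ _ := by nlinarith [sq_nonneg x]

/-- Taylor's formula of second order, from a bound on the second derivative. -/
theorem isJet_of_contDiff {f : V → ℝ} (hf : ContDiff ℝ (⊤ : ℕ∞) f) {q : V} {D t M : ℝ}
    (hD : 0 < D) (h0 : |f q| ≤ M) (h1 : ‖iteratedFDeriv ℝ 1 f q‖ ≤ M / D)
    (h2 : ∀ u, ‖iteratedFDeriv ℝ 2 f u‖ ≤ M / D ^ 2) : IsJet f q D t M := by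
  have hd : Differentiable ℝ f := hf.differentiable (by simp)
  have hd2 : Differentiable ℝ (fderiv ℝ f) :=
    (hf.fderiv_right (m := ((⊤ : ℕ∞) : WithTop ℕ∞)) (by simp)).differentiable (by simp)
  have hb : ∀ u, ‖fderiv ℝ (fderiv ℝ f) u‖ ≤ M / D ^ 2 := fun u => by
    have h3 : ‖iteratedFDeriv ℝ 2 f u‖ = ‖fderiv ℝ (fderiv ℝ f) u‖ := by
      rw [← norm_iteratedFDeriv_fderiv (n := 1), norm_iteratedFDeriv_one]
    rw [← h3]
    exact h2 u
  have hlip : ∀ u, ‖fderiv ℝ f u - fderiv ℝ f q‖ ≤ M / D ^ 2 * ‖u - q‖ := fun u =>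
    convex_univ.norm_image_sub_le_of_norm_fderiv_le (fun x _ => hd2 x) (fun x _ => hb x)
      (mem_univ q) (mem_univ u)
  refine ⟨f q, fderiv ℝ f q, h0, by rwa [norm_iteratedFDeriv_one] at h1, fun u hu => ?_⟩
  have h3 := (convex_closedBall q ‖u - q‖).norm_image_sub_le_of_norm_hasFDerivWithin_le'
    (f := f) (f' := fderiv ℝ f) (φ := fderiv ℝ f q) (C := M / D ^ 2 * ‖u - q‖) (x := q) (y := u)
    (fun x _ => (hd x).hasFDerivAt.hasFDerivWithinAt) (fun x hx => (hlip x).trans (by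
      have : 0 ≤ M / D ^ 2 := (norm_nonneg (fderiv ℝ (fderiv ℝ f) q)).trans (hb q)
      rw [mem_closedBall, dist_eq_norm] at hx
      gcongr)) (mem_closedBall_self (norm_nonneg _)) (by simp [dist_eq_norm])
  refine h3.trans (le_of_eq ?_)
  field_simp

/-- An affine map of size `M` on a ball of radius `D` has a jet of that size. -/
theorem isJet_affineMap [FiniteDimensional ℝ V] (a : V →ᵃ[ℝ] W) {q : V} {D t M : ℝ} (hD : 0 < D)
    (h : ∀ u ∈ closedBall q D, ‖a u‖ ≤ M) : IsJet a q D t (2 * M) := by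
  have hM : 0 ≤ M := (norm_nonneg _).trans (h q (mem_closedBall_self hD.le))
  refine ⟨a q, LinearMap.toContinuousLinearMap a.linear, ?_, ?_, fun u _ => ?_⟩
  · linarith [h q (mem_closedBall_self hD.le)]
  · refine ContinuousLinearMap.opNorm_le_bound _ (by positivity) fun v => ?_
    change ‖a.linear v‖ ≤ _
    rcases eq_or_ne v 0 with rfl | hv
    · simp
    have hv0 : 0 < ‖v‖ := norm_pos_iff.2 hv
    set w := (D / ‖v‖) • v with hw
    have hwn : ‖w‖ = D := by
      rw [hw, norm_smul, Real.norm_eq_abs, abs_of_pos (by positivity)]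
      field_simp
    have h1 : a.linear w = a (q + w) - a q := by
      rw [affineMap_apply_eq a (q + w) q, add_sub_cancel_left, add_sub_cancel_left]
    have h2 : ‖a.linear w‖ ≤ 2 * M := by
      rw [h1]
      refine (norm_sub_le _ _).trans ?_
      have h3 := h (q + w) (by simp [hwn])
      have h4 := h q (mem_closedBall_self hD.le)
      linarith
    rw [hw, map_smul, norm_smul, Real.norm_eq_abs, abs_of_pos (by positivity)] at h2
    rw [div_mul_eq_mul_div, div_le_iff₀ hv0] at h2
    rw [div_mul_eq_mul_div, le_div_iff₀ hD]
    linarith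
  · change ‖a u - a q - a.linear (u - q)‖ ≤ _
    rw [affineMap_apply_eq a u q, add_sub_cancel_left, sub_self, norm_zero]
    positivity

end Jet

section Construction

variable {N n : ℕ} {p C₀ k η α ε b : ℝ} {K : (Fin (n + 2) → Euc N) → ℝ≥0}
  {P₀ : Submodule ℝ (Euc N)} {μ : Measure (Euc N)} {e : OrthonormalBasis (Fin n) ℝ P₀}

/-- The constant in the Taylor approximation of `A` at scales small compared with `D`. -/
noncomputable def jetConst (n : ℕ) (b M : ℝ) : ℝ :=
  let m : ℝ := 3 * (4 * n + 1) ^ n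
  let B := 2025 * b + 1
  6 * (1 + m * B + 4 * (m * B) ^ 2) * (m * (6 * B * (2 * (M * 600 ^ 6 * 6))))

theorem jetConst_nonneg (n : ℕ) {b M : ℝ} (hb : 0 ≤ b) (hM : 0 ≤ M) : 0 ≤ jetConst n b M := by
  simp only [jetConst]
  positivity

/-- At scales small compared with `D(q)`, the function `A` is `C^{1,1}`-close to an affine map. With
the graph `a₀` of one reference cell, `A - a₀ = (∑ φ̃_i)⁻¹ ∑ φ̃_i (a_i - a₀)` is built from
functions with jets of size `1` and from affine maps of size `ε D`. -/
theorem Choices.exists_affine_near (c : Choices k α ε b μ e) (h : IsSetting n p K C₀ k η P₀ μ)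
    (hn : 1 ≤ n) (hnN : n < N) (hk : 4 ≤ k) (hα : 0 < α) (hε : 0 < ε) (hηε : η ≤ ε) (hb : 0 < b)
    {a : Euc N × ℝ → (P₀ →ᵃ[ℝ] P₀ᗮ)}
    (ha : ∀ B ∈ goodBalls n k α ε P₀ μ, ∀ u, graphMap P₀ (c.plane B) u = a B u) {M : ℝ}
    (hM : 0 < M)
    (hchain : ∀ x t y s L u, (x, t) ∈ goodBalls n k α ε P₀ μ → (y, s) ∈ goodBalls n k α ε P₀ μ →
      1 ≤ L → s ≤ L * t → ‖u - P₀.orthogonalProjectionOnto x‖ ≤ L * t →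
        ‖u - P₀.orthogonalProjectionOnto y‖ ≤ L * s →
        ‖a (x, t) u - a (y, s) u‖ ≤ M * L ^ 6 * ε * t)
    {q : P₀} {t : ℝ} (hq : ‖q‖ ≤ 10) (ht : 0 < t) (ht2 : t < 2)
    (htD : t ≤ DFun n k α ε P₀ μ q / 100) :
    ∃ f : P₀ →ᵃ[ℝ] P₀ᗮ, ∀ u ∈ closedBall q t, ‖c.A u - f u‖ ≤
      jetConst n b M * ε * DFun n k α ε P₀ μ q * (t / DFun n k α ε P₀ μ q) ^ 2 := by
  have hne : (goodBalls n k α ε P₀ μ).Nonempty :=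
    let ⟨x, hx⟩ := h.exists_mem_goodBalls hk hα hε hηε; ⟨_, hx⟩
  set D := DFun n k α ε P₀ μ q with hDdef
  have hD : 0 < D := by linarith
  obtain ⟨J₀, hJcard, hJ₀⟩ := whitney_finite e hn hne hD
  classical
  -- the cells whose enlarged cubes come close to `q`: their number is bounded, and they have sizes
  -- comparable to `D`
  set J := (J₀.filter (· ∈ index12 k α ε μ e)).filter
    (fun i => ∃ u ∈ cube e i 3, ‖u - q‖ ≤ D / 100) with hJ
  have hcard : (J.card : ℝ) ≤ 3 * (4 * n + 1) ^ n := by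
    have h1 : J.card ≤ 3 * (4 * n + 1) ^ n :=
      ((Finset.card_filter_le _ _).trans (Finset.card_filter_le _ _)).trans hJcard
    exact_mod_cast h1
  have hJ12 : ∀ i ∈ J, i ∈ index12 k α ε μ e := fun i hi =>
    (Finset.mem_filter.1 (Finset.mem_filter.1 hi).1).2
  have hwJ : ∀ i ∈ J, 18 * cellDiam n i.1 ≤ 101 / 100 * D ∧ 99 / 100 * D < 44 * cellDiam n i.1 := by
    intro i hi
    obtain ⟨u, hu, huq⟩ := (Finset.mem_filter.1 hi).2
    have h1 := le_DFun_of_mem_cube e hne (hJ12 i hi).1 hu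
    have h2 := DFun_lt_of_mem_cube e hne (hJ12 i hi).1 hu
    have h3 := DFun_le_add hne u q
    have h4 := DFun_le_add hne q u
    rw [norm_sub_rev] at h4
    constructor <;> linarith
  -- the reference cell is the one that contains `q`
  obtain ⟨i₀, hi₀, hqi₀⟩ := exists_whitneyIndex e hn hne hD
  have hi₀12 : i₀ ∈ index12 k α ε μ e := ⟨hi₀, q, hqi₀, by
    rw [mem_closedBall_zero_iff]; linarith⟩
  have hqi₀' : q ∈ cube e i₀ 3 := cube_mono e (by norm_num) hqi₀
  have hi₀J : i₀ ∈ J := Finset.mem_filter.2 ⟨Finset.mem_filter.2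
    ⟨hJ₀ i₀ hi₀ q hqi₀' (by simp; positivity), hi₀12⟩, q, hqi₀', by simp; positivity⟩
  obtain ⟨g1, g2, g3⟩ := c.center_radius hn hnN hi₀12
  have hw₀ := hwJ i₀ hi₀J
  have hr₀ : 0 < c.radius i₀ := (c.ball_mem i₀ hi₀12).1.2.1.1
  set a₀ := a (c.center i₀, c.radius i₀) with ha₀
  have hjet_a : ∀ i ∈ J, IsJet (fun u => a (c.center i, c.radius i) u - a₀ u) q D t
      (2 * (M * 600 ^ 6 * 6 * ε * D)) := by
    intro i hi
    have hi12 := hJ12 i hi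
    have hwi := hwJ i hi
    obtain ⟨f1, f2, f3⟩ := c.center_radius hn hnN hi12
    obtain ⟨v, hv, hvq⟩ := (Finset.mem_filter.1 hi).2
    refine isJet_affineMap (a (c.center i, c.radius i) - a₀) hD fun u hu => ?_
    rw [mem_closedBall, dist_eq_norm] at hu
    have h1 := f3 v hv
    have h2 := g3 q hqi₀'
    have h3 := norm_sub_le_norm_sub_add_norm_sub u q (P₀.orthogonalProjectionOnto (c.center i₀))
    have h4 := norm_sub_le_norm_sub_add_norm_sub u q (P₀.orthogonalProjectionOnto (c.center i))
    have h5 := norm_sub_le_norm_sub_add_norm_sub q v (P₀.orthogonalProjectionOnto (c.center i))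
    rw [norm_sub_rev q v] at h5
    have h6 := hchain _ _ _ _ 600 u (c.ball_mem i₀ hi₀12) (c.ball_mem i hi12) (by norm_num)
      (by linarith) (by linarith) (by linarith)
    change ‖a (c.center i, c.radius i) u - a₀ u‖ ≤ _
    rw [norm_sub_rev]
    refine h6.trans ?_
    calc M * 600 ^ 6 * ε * c.radius i₀ ≤ M * 600 ^ 6 * ε * (6 * D) := by
          gcongr; linarith
      _ = _ := by ring
  set B := 2025 * b + 1 with hB
  have hjet_b : ∀ i ∈ J, IsJet (c.bump i) q D t B := by
    intro i hi
    have hi12 := hJ12 i hi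
    have hwi := hwJ i hi
    have hw0 := cellDiam_pos hn i.1
    have hDw : D ≤ 45 * cellDiam n i.1 := by linarith
    have hd := c.bump_deriv i hi12
    rw [diam_cube] at hd
    refine isJet_of_contDiff (c.bump_contDiff i hi12) hD ?_ ?_ ?_
    · rw [abs_of_nonneg (c.bump_mem i hi12 q).1]
      linarith [(c.bump_mem i hi12 q).2]
    · refine (hd 1 le_rfl (by norm_num) q).trans ?_
      rw [pow_one, div_le_div_iff₀ hw0 hD]
      calc b * D ≤ b * (45 * cellDiam n i.1) := by gcongr
        _ ≤ _ := by rw [hB]; nlinarith [mul_pos hb hw0]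
    · intro u
      refine (hd 2 (by norm_num) le_rfl u).trans ?_
      rw [div_le_div_iff₀ (by positivity) (by positivity)]
      calc b * D ^ 2 ≤ b * (45 * cellDiam n i.1) ^ 2 := by gcongr
        _ ≤ _ := by rw [hB, mul_pow]; nlinarith [mul_pos hb (pow_pos hw0 2), pow_pos hw0 2]
  set m : ℝ := 3 * (4 * n + 1) ^ n with hm
  have hB0 : 0 < B := by positivity
  have htD' : t ≤ D := by linarith
  have hA : ∀ u ∈ closedBall q t, 1 ≤ ∑ i ∈ J, c.bump i u ∧
      c.A u = (∑ i ∈ J, c.bump i u)⁻¹ • ∑ i ∈ J, c.bump i u • a (c.center i, c.radius i) u := by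
    intro u hu
    rw [mem_closedBall, dist_eq_norm] at hu
    have hu12 : ‖u‖ ≤ 12 := by
      have := norm_sub_norm_le u q
      linarith
    have hDu : 0 < DFun n k α ε P₀ μ u := by
      have := DFun_le_add hne q u
      rw [norm_sub_rev] at this
      linarith
    refine c.A_eq h hn hk hα hε hηε ha hu12 hDu hJ12 fun i hi hui => ?_
    exact Finset.mem_filter.2 ⟨Finset.mem_filter.2 ⟨hJ₀ i hi.1 u hui (by linarith), hi⟩,
      u, hui, by linarith⟩
  have hjet_S : IsJet (fun u => ∑ i ∈ J, c.bump i u) q D t (m * B) :=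
    (IsJet.sum J hjet_b).mono hD (by gcongr)
  have hjet_inv := hjet_S.inv hD ht.le htD' fun u hu => (hA u hu).1
  have hjet_N : IsJet (fun u => ∑ i ∈ J, c.bump i u • (a (c.center i, c.radius i) u - a₀ u)) q D t
      (m * (6 * B * (2 * (M * 600 ^ 6 * 6 * ε * D)))) :=
    (IsJet.sum J fun i hi => (hjet_b i hi).smul hD htD' (hjet_a i hi)).mono hD (by gcongr)
  obtain ⟨c₀, L, -, -, hL⟩ := hjet_inv.smul hD htD' hjet_N
  refine ⟨a₀ + ((L : P₀ →ₗ[ℝ] P₀ᗮ).toAffineMap + AffineMap.const ℝ P₀ (c₀ - L q)), fun u hu => ?_⟩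
  have h1 := hL u hu
  obtain ⟨hS1, hAu⟩ := hA u hu
  have h2 : c.A u - (a₀ + ((L : P₀ →ₗ[ℝ] P₀ᗮ).toAffineMap + AffineMap.const ℝ P₀ (c₀ - L q))) u =
      (∑ i ∈ J, c.bump i u)⁻¹ • ∑ i ∈ J, c.bump i u • (a (c.center i, c.radius i) u - a₀ u)
        - c₀ - L (u - q) := by
    simp only [smul_sub, Finset.sum_sub_distrib, ← Finset.sum_smul]
    rw [← hAu, smul_smul, inv_mul_cancel₀ (by linarith), one_smul]
    simp only [AffineMap.coe_add, Pi.add_apply, LinearMap.coe_toAffineMap,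
      ContinuousLinearMap.coe_coe, AffineMap.const_apply, map_sub]
    abel
  rw [h2]
  rw [mem_closedBall, dist_eq_norm] at hu
  refine h1.trans ?_
  calc _ ≤ 6 * (1 + m * B + 4 * (m * B) ^ 2) * (m * (6 * B * (2 * (M * 600 ^ 6 * 6 * ε * D)))) *
        (t / D) ^ 2 := by gcongr
    _ = _ := by rw [jetConst]; ring

end Construction

/-! ### Approximation of `A` by affine maps at large scales -/

/-- The volume of the unit ball of dimension `n`. -/
noncomputable def unitBallVolume (n : ℕ) : ℝ :=
  √Real.pi ^ n / Real.Gamma (n / 2 + 1)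

theorem unitBallVolume_pos (n : ℕ) : 0 < unitBallVolume n := by
  have h1 := Real.pi_pos
  have h2 : 0 < Real.Gamma ((n : ℝ) / 2 + 1) := Real.Gamma_pos_of_pos (by positivity)
  unfold unitBallVolume
  positivity

theorem hausdorffMeasure_closedBall {N n : ℕ} {P₀ : Submodule ℝ (Euc N)} (hn : 1 ≤ n)
    (hP₀ : finrank ℝ P₀ = n) (u : P₀) {r : ℝ} (hr : 0 ≤ r) :
    (μHE[n] : Measure P₀) (closedBall u r) = ENNReal.ofReal (unitBallVolume n * r ^ n) := by
  have : Nontrivial P₀ := Module.nontrivial_of_finrank_pos (R := ℝ) (by omega)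
  subst hP₀
  rw [InnerProductSpace.euclideanHausdorffMeasure_eq_volume, InnerProductSpace.volume_closedBall,
    ← ENNReal.ofReal_pow hr, ← ENNReal.ofReal_mul (by positivity), mul_comm, unitBallVolume]

/-- A flat system together with a map `A : P₀ → P₀ᗮ` that is close to the graphs of the system, and
the function `D` that measures the distance of points of `P₀` from the projected system. -/
structure GraphSystem {N : ℕ} (n : ℕ) (P₀ : Submodule ℝ (Euc N)) (μ : Measure (Euc N))
    (lam ε M : ℝ) (S : Set (Euc N × ℝ)) (a : Euc N × ℝ → (P₀ →ᵃ[ℝ] P₀ᗮ)) (A : P₀ → P₀ᗮ)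
    (D : P₀ → ℝ) : Prop extends FlatSystem n P₀ μ lam ε S a where
  lip : ∀ x t y s, (x, t) ∈ S → (y, s) ∈ S →
    ‖x - y‖ ≤ 4 * ‖P₀.orthogonalProjectionOnto x - P₀.orthogonalProjectionOnto y‖ + 6 * (t + s)
  approx : ∀ x t L u, (x, t) ∈ S → 1 ≤ L → ‖u‖ ≤ 12 → ‖u - P₀.orthogonalProjectionOnto x‖ ≤ L * t →
    ‖A u - a (x, t) u‖ ≤ M * L ^ 6 * ε * t
  dist_nonneg : ∀ u, 0 ≤ D u
  dist_le : ∀ u, ‖u‖ ≤ 12 → D u ≤ 57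
  dist_le_add : ∀ u v, D u ≤ D v + ‖u - v‖
  exists_of_dist_lt : ∀ u r, D u < r →
    ∃ x t, (x, t) ∈ S ∧ ‖P₀.orthogonalProjectionOnto x - u‖ + t < r

set_option maxHeartbeats 1000000 in
/-- The local form of the estimate of `A - f`: on a ball around `b` the map `A` is close to the
graph of a ball `B(x, r)` of the system, and this graph is close to that of `f` if `μ` is. -/
theorem exists_local_const (n : ℕ) {C₁ lam M ω : ℝ} (hC₁ : 0 ≤ C₁) (hlam : 0 < lam) (hM : 0 ≤ M)
    (hω : 0 < ω) :
    ∃ C ε₀ : ℝ, 0 < C ∧ 0 < ε₀ ∧ ∀ (N : ℕ) (μ : Measure (Euc N)) [IsFiniteMeasure μ],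
      (∀ x r, 0 < r → μ (closedBall x r) ≤ ENNReal.ofReal (C₁ * r ^ n)) →
      ∀ P₀ : Submodule ℝ (Euc N), finrank ℝ P₀ = n → ∀ ε S a A D, 0 < ε → ε ≤ ε₀ →
      GraphSystem n P₀ μ lam ε M S a A D →
      ∀ ν : Measure P₀, (∀ u r, 0 ≤ r → ν (closedBall u r) = ENNReal.ofReal (ω * r ^ n)) →
      ∀ (b : P₀) (ρ x r), (x, r) ∈ S → ‖P₀.orthogonalProjectionOnto x - b‖ ≤ 2 * r →
      r ≤ D b + ρ → ∀ (f : P₀ →ᵃ[ℝ] P₀ᗮ),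
      ∫⁻ u in closedBall b (20 * r) ∩ closedBall 0 12, ENNReal.ofReal ‖A u - f u‖ ∂ν ≤
        ENNReal.ofReal (C * ε) * ∫⁻ u in closedBall b (r / 4), ENNReal.ofReal (D u + ρ) ∂ν +
        ENNReal.ofReal C * ∫⁻ w in closedBall x r, ENNReal.ofReal (vertDist f w) ∂μ := by
  obtain ⟨K, ε₁, hK, hε₁, hcomp⟩ := exists_compare n hC₁ hlam
  set c := M * 22 ^ 6 + 23 * K * 5 with hc
  have hc0 : 0 < c := by positivity
  set C := max (20 ^ n * c * (4 / 3) * 4 ^ n) (ω * 20 ^ n * (23 * K)) with hC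
  have hC0 : 0 < C := lt_max_of_lt_left (by positivity)
  refine ⟨C, ε₁ / 4, hC0, by positivity, ?_⟩
  intro N μ _ hμ P₀ hP₀ ε S a A D hε hεs hS ν hν b ρ x r hx hxb hr f
  have hr0 := hS.pos x r hx
  by_cases hfin : ∫⁻ w in closedBall x r, ENNReal.ofReal (vertDist f w) ∂μ = ⊤
  · rw [hfin, ENNReal.mul_top (by simpa using hC0)]
    simp
  set Jm := (∫⁻ w in closedBall x r, ENNReal.ofReal (vertDist f w) ∂μ).toReal with hJm
  have hJeq : ENNReal.ofReal Jm = ∫⁻ w in closedBall x r, ENNReal.ofReal (vertDist f w) ∂μ :=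
    ENNReal.ofReal_toReal hfin
  have hJm0 : 0 ≤ Jm := ENNReal.toReal_nonneg
  -- the term `ε r ^ (n + 1)` is added because `exists_compare` asks for a positive bound
  have hcmp := hcomp N μ hμ P₀ hP₀ x r hr0 (hS.mass x r hx) (a (x, r)) (hS.slope x r hx) f
    (4 * ε * r ^ (n + 1)) (Jm + ε * r ^ (n + 1)) (by positivity) (by positivity)
    (by gcongr; linarith)
    ((lintegral_mono_set (closedBall_subset_closedBall (by linarith))).trans (hS.flat x r hx))
    (by
      rw [← hJeq]
      exact ENNReal.ofReal_le_ofReal (by linarith [show 0 < ε * r ^ (n + 1) by positivity]))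
  have hpt : ∀ u ∈ closedBall b (20 * r) ∩ closedBall 0 12,
      ‖A u - f u‖ ≤ c * ε * r + 23 * K * (Jm / r ^ n) := by
    rintro u ⟨hu1, hu2⟩
    rw [mem_closedBall, dist_eq_norm] at hu1
    rw [mem_closedBall_zero_iff] at hu2
    have h1 : ‖u - P₀.orthogonalProjectionOnto x‖ ≤ 22 * r := by
      have := norm_sub_le_norm_sub_add_norm_sub u b (P₀.orthogonalProjectionOnto x)
      rw [norm_sub_rev b] at this
      linarith
    have h2 := hS.approx x r 22 u hx (by norm_num) hu2 h1
    have h3 := hcmp u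
    have h4 : K * (1 + ‖u - P₀.orthogonalProjectionOnto x‖ / r) *
        ((4 * ε * r ^ (n + 1) + (Jm + ε * r ^ (n + 1))) / r ^ n) ≤
        K * (1 + 22) * ((4 * ε * r ^ (n + 1) + (Jm + ε * r ^ (n + 1))) / r ^ n) := by
      gcongr
      rwa [div_le_iff₀ hr0]
    have h5 : (4 * ε * r ^ (n + 1) + (Jm + ε * r ^ (n + 1))) / r ^ n = 5 * ε * r + Jm / r ^ n := by
      field_simp
      ring
    rw [h5] at h3 h4
    have h6 := norm_sub_le_norm_sub_add_norm_sub (A u) (a (x, r) u) (f u)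
    rw [hc]
    linarith
  have hup : ∫⁻ u in closedBall b (20 * r) ∩ closedBall 0 12, ENNReal.ofReal ‖A u - f u‖ ∂ν ≤
      ENNReal.ofReal ((c * ε * r + 23 * K * (Jm / r ^ n)) * (ω * (20 * r) ^ n)) := by
    calc _ ≤ ∫⁻ u in closedBall b (20 * r) ∩ closedBall 0 12,
          ENNReal.ofReal (c * ε * r + 23 * K * (Jm / r ^ n)) ∂ν :=
          setLIntegral_mono' (isClosed_closedBall.inter isClosed_closedBall).measurableSet
            fun u hu => ENNReal.ofReal_le_ofReal (hpt u hu)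
      _ ≤ ENNReal.ofReal (c * ε * r + 23 * K * (Jm / r ^ n)) * ν (closedBall b (20 * r)) := by
          rw [setLIntegral_const]
          gcongr
          exact inter_subset_left
      _ = _ := by rw [hν _ _ (by positivity), ← ENNReal.ofReal_mul (by positivity)]
  -- since `D` is `1`-Lipschitz, `D + ρ` is at least `3 / 4 * r` on `B(b, r / 4)`
  have hlow : ENNReal.ofReal (3 / 4 * r * (ω * (r / 4) ^ n)) ≤
      ∫⁻ u in closedBall b (r / 4), ENNReal.ofReal (D u + ρ) ∂ν := by
    calc _ = ∫⁻ u in closedBall b (r / 4), ENNReal.ofReal (3 / 4 * r) ∂ν := by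
          rw [setLIntegral_const, hν _ _ (by positivity), ← ENNReal.ofReal_mul (by positivity)]
      _ ≤ _ := by
          refine setLIntegral_mono' isClosed_closedBall.measurableSet fun u hu => ?_
          refine ENNReal.ofReal_le_ofReal ?_
          rw [mem_closedBall, dist_comm, dist_eq_norm] at hu
          have := hS.dist_le_add b u
          linarith
  refine hup.trans ?_
  rw [← hJeq]
  calc _ ≤ ENNReal.ofReal (C * ε * (3 / 4 * r * (ω * (r / 4) ^ n)) + C * Jm) := by
        refine ENNReal.ofReal_le_ofReal ?_
        have e1 : (c * ε * r + 23 * K * (Jm / r ^ n)) * (ω * (20 * r) ^ n) =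
            (20 ^ n * c * (4 / 3) * 4 ^ n) * (ε * (3 / 4 * r * (ω * (r / 4) ^ n))) +
              (ω * 20 ^ n * (23 * K)) * Jm := by
          rw [mul_pow, div_pow]
          field_simp
        rw [e1]
        have h1 : (20 ^ n * c * (4 / 3) * 4 ^ n) ≤ C := le_max_left _ _
        have h2 : (ω * 20 ^ n * (23 * K)) ≤ C := le_max_right _ _
        have h3 : 0 ≤ ε * (3 / 4 * r * (ω * (r / 4) ^ n)) := by positivity
        nlinarith [mul_le_mul_of_nonneg_right h1 h3, mul_le_mul_of_nonneg_right h2 hJm0]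
    _ = ENNReal.ofReal (C * ε) * ENNReal.ofReal (3 / 4 * r * (ω * (r / 4) ^ n)) +
          ENNReal.ofReal C * ENNReal.ofReal Jm := by
        rw [← ENNReal.ofReal_mul (by positivity), ← ENNReal.ofReal_mul hC0.le,
          ← ENNReal.ofReal_add (by positivity) (by positivity)]
    _ ≤ _ := by gcongr

/-- At scales not small compared with `D`, the mean distance of `A` from an affine map `f` is
controlled by the mean of `D` and by the mean distance of `μ` from the graph of `f`. A Vitali
covering of `closedBall q t` by balls that belong to the system reduces this to the local form. -/
theorem exists_covering_const (n : ℕ) {C₁ lam M ω : ℝ} (hC₁ : 0 ≤ C₁) (hlam : 0 < lam) (hM : 0 ≤ M)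
    (hω : 0 < ω) :
    ∃ C ε₀ : ℝ, 0 < C ∧ 0 < ε₀ ∧ ∀ (N : ℕ) (μ : Measure (Euc N)) [IsFiniteMeasure μ],
      (∀ x r, 0 < r → μ (closedBall x r) ≤ ENNReal.ofReal (C₁ * r ^ n)) →
      ∀ P₀ : Submodule ℝ (Euc N), finrank ℝ P₀ = n → ∀ ε S a A D, 0 < ε → ε ≤ ε₀ →
      GraphSystem n P₀ μ lam ε M S a A D →
      ∀ ν : Measure P₀, (∀ u r, 0 ≤ r → ν (closedBall u r) = ENNReal.ofReal (ω * r ^ n)) →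
      ∀ (q : P₀) (t ρ : ℝ), ‖q‖ ≤ 10 → 0 < t → t < 2 → 0 < ρ → ρ ≤ t → D q < 100 * t →
      ∃ X T, (X, T) ∈ S ∧ t ≤ T ∧ T ≤ 100 * t ∧ ‖P₀.orthogonalProjectionOnto X - q‖ ≤ 100 * t ∧
      ∀ (f : P₀ →ᵃ[ℝ] P₀ᗮ),
      ∫⁻ u in closedBall q t, ENNReal.ofReal ‖A u - f u‖ ∂ν ≤
        ENNReal.ofReal (C * ε) * ∫⁻ u in closedBall q (27 * t), ENNReal.ofReal (D u + ρ) ∂ν +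
        ENNReal.ofReal C * ∫⁻ w in closedBall X (2000 * T), ENNReal.ofReal (vertDist f w) ∂μ := by
  obtain ⟨C, ε₀, hC, hε₀, hloc⟩ := exists_local_const n hC₁ hlam hM hω
  refine ⟨C, ε₀, hC, hε₀, ?_⟩
  intro N μ _ hμ P₀ hP₀ ε S a A D hε hεs hS ν hν q t ρ hq ht ht2 hρ hρt hDq
  obtain ⟨X, T', hX', hXT⟩ := hS.exists_of_dist_lt q _ hDq
  have hT' := hS.pos X T' hX'
  have hT'lt := hS.lt X T' hX'
  have hXq := norm_nonneg (P₀.orthogonalProjectionOnto X - q)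
  set T := max T' t with hT
  have htT : t ≤ T := le_max_right _ _
  have hX : (X, T) ∈ S := hS.up X T' T hX' (le_max_left _ _) (max_lt hT'lt (by linarith))
  refine ⟨X, T, hX, htT, max_le (by linarith) (by linarith), by linarith, fun f => ?_⟩
  have hball : ∀ u ∈ closedBall q t, ‖u‖ ≤ 12 := by
    intro u hu
    rw [mem_closedBall, dist_eq_norm] at hu
    have := norm_le_norm_add_norm_sub' u q
    linarith
  -- near every `u` there is a ball of the system whose radius is comparable to `D u + ρ`
  have key : ∀ u ∈ closedBall q t, ∃ x r, (x, r) ∈ S ∧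
      ‖P₀.orthogonalProjectionOnto x - u‖ ≤ 2 * r ∧
      ‖P₀.orthogonalProjectionOnto x - u‖ ≤ 102 * t ∧ r ≤ D u + ρ ∧ r ≤ 102 * t := by
    intro u hu
    have hu12 := hball u hu
    have h0 := hS.dist_nonneg u
    obtain ⟨x, r, hx, hxr⟩ := hS.exists_of_dist_lt u (D u + ρ) (by linarith)
    rw [mem_closedBall, dist_eq_norm] at hu
    have h1 := hS.dist_le_add u q
    have hr := hS.pos x r hx
    have hrlt := hS.lt x r hx
    have h2 := hS.dist_le u hu12
    have h3 := norm_nonneg (P₀.orthogonalProjectionOnto x - u)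
    refine ⟨x, max r ((D u + ρ) / 2), hS.up x r _ hx (le_max_left _ _)
      (max_lt hrlt (by linarith)), ?_, by linarith, max_le (by linarith) (by linarith),
      max_le (by linarith) (by linarith)⟩
    linarith [le_max_right r ((D u + ρ) / 2)]
  choose! x r hxS hxu hxt hrD hrt using key
  have hr0 : ∀ u ∈ closedBall q t, 0 < r u := fun u hu => hS.pos _ _ (hxS u hu)
  obtain ⟨𝒟, h𝒟, hdisj, hcov⟩ := Vitali.exists_disjoint_subfamily_covering_enlargement_closedBall
    (closedBall q t) (fun u => u) (fun u => 4 * r u) (408 * t)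
    (fun u hu => by linarith [hrt u hu]) 5 (by norm_num)
  have hcount : 𝒟.Countable := by
    refine hdisj.countable_of_nonempty_interior fun b hb => ⟨b, ?_⟩
    exact ball_subset_interior_closedBall (mem_ball_self (by linarith [hr0 b (h𝒟 hb)]))
  have : Countable 𝒟 := hcount.to_subtype
  have hsub : closedBall q t ⊆ ⋃ b : 𝒟, closedBall (b : P₀) (20 * r b) ∩ closedBall 0 12 := by
    intro u hu
    obtain ⟨b, hb, hbu⟩ := hcov u hu
    refine mem_iUnion.2 ⟨⟨b, hb⟩, ?_, mem_closedBall_zero_iff.2 (hball u hu)⟩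
    have := hbu (mem_closedBall_self (by linarith [hr0 u hu]))
    rwa [← mul_assoc, show (5 : ℝ) * 4 = 20 by norm_num] at this
  have hd1 : Pairwise (Function.onFun Disjoint fun b : 𝒟 => closedBall (b : P₀) (r b / 4)) := by
    intro b b' hbb
    have h1 := hr0 b (h𝒟 b.2)
    have h2 := hr0 b' (h𝒟 b'.2)
    exact (hdisj b.2 b'.2 fun h => hbb (Subtype.ext h)).mono
      (closedBall_subset_closedBall (by linarith)) (closedBall_subset_closedBall (by linarith))
  -- the balls around the centres `x b` are disjoint since their projections to `P₀` are
  have hd2 : Pairwise (Function.onFun Disjoint fun b : 𝒟 => closedBall (x b) (r b)) := by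
    intro b b' hbb
    have hproj : ∀ d ∈ 𝒟, ∀ w ∈ closedBall (x d) (r d),
        P₀.orthogonalProjectionOnto w ∈ closedBall d (4 * r d) := by
      intro d hd w hw
      rw [mem_closedBall, dist_eq_norm] at hw ⊢
      have h1 := norm_proj_sub_le (P₀ := P₀) w (x d)
      have h2 := hxu d (h𝒟 hd)
      have h3 := norm_sub_le_norm_sub_add_norm_sub (P₀.orthogonalProjectionOnto w)
        (P₀.orthogonalProjectionOnto (x d)) d
      have h4 := hr0 d (h𝒟 hd)
      linarith
    refine Set.disjoint_left.2 fun w hw hw' => ?_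
    exact Set.disjoint_left.1 (hdisj b.2 b'.2 fun h => hbb (Subtype.ext h)) (hproj b b.2 w hw)
      (hproj b' b'.2 w hw')
  have hs1 : (⋃ b : 𝒟, closedBall (b : P₀) (r b / 4)) ⊆ closedBall q (27 * t) := by
    refine iUnion_subset fun b => closedBall_subset_closedBall' ?_
    have h1 := h𝒟 b.2
    have h2 := hrt b h1
    rw [mem_closedBall] at h1
    linarith
  have hs2 : (⋃ b : 𝒟, closedBall (x b) (r b)) ⊆ closedBall X (2000 * T) := by
    refine iUnion_subset fun b => closedBall_subset_closedBall' ?_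
    have h1 := h𝒟 b.2
    have h2 := hrt b h1
    have h3 := hxt b h1
    have h4 := hS.lip _ _ _ _ (hxS b h1) hX
    rw [mem_closedBall, dist_eq_norm] at h1
    have h5 := norm_sub_le_norm_sub_add_norm_sub (P₀.orthogonalProjectionOnto (x b)) b
      (P₀.orthogonalProjectionOnto X)
    have h6 := norm_sub_le_norm_sub_add_norm_sub (b : P₀) q (P₀.orthogonalProjectionOnto X)
    rw [norm_sub_rev q] at h6
    rw [dist_eq_norm]
    linarith
  calc _ ≤ ∑' b : 𝒟, ∫⁻ u in closedBall (b : P₀) (20 * r b) ∩ closedBall 0 12,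
        ENNReal.ofReal ‖A u - f u‖ ∂ν :=
        (lintegral_mono_set hsub).trans (lintegral_iUnion_le _ _)
    _ ≤ ∑' b : 𝒟, (ENNReal.ofReal (C * ε) *
          ∫⁻ u in closedBall (b : P₀) (r b / 4), ENNReal.ofReal (D u + ρ) ∂ν +
        ENNReal.ofReal C * ∫⁻ w in closedBall (x b) (r b), ENNReal.ofReal (vertDist f w) ∂μ) :=
        ENNReal.tsum_le_tsum fun b => hloc N μ hμ P₀ hP₀ ε S a A D hε hεs hS ν hν b ρ (x b) (r b)
          (hxS b (h𝒟 b.2)) (hxu b (h𝒟 b.2)) (hrD b (h𝒟 b.2)) f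
    _ ≤ _ := by
        rw [ENNReal.tsum_add, ENNReal.tsum_mul_left, ENNReal.tsum_mul_left,
          ← lintegral_iUnion (fun b => isClosed_closedBall.measurableSet) hd1,
          ← lintegral_iUnion (fun b => isClosed_closedBall.measurableSet) hd2]
        gcongr

/-! ### The estimate of `γ` at large scales -/

/-- Hölder's inequality against the constant function `1`. -/
theorem setLIntegral_rpow_le {X : Type*} [MeasurableSpace X] (μ : Measure X) {p : ℝ} (hp : 1 < p)
    {f : X → ℝ≥0∞} (hf : AEMeasurable f μ) (I : Set X) :
    (∫⁻ w in I, f w ∂μ) ^ p ≤ μ I ^ (p - 1) * ∫⁻ w in I, f w ^ p ∂μ := by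
  have hp0 : 0 < p := by linarith
  have hpq := Real.HolderConjugate.conjExponent hp
  have h := ENNReal.lintegral_mul_le_Lp_mul_Lq (μ.restrict I) hpq (f := f) (g := fun _ => 1)
    hf.restrict aemeasurable_const
  simp only [Pi.mul_apply, mul_one, ENNReal.one_rpow, lintegral_const, one_mul,
    Measure.restrict_apply_univ] at h
  refine (ENNReal.rpow_le_rpow h hp0.le).trans (le_of_eq ?_)
  rw [ENNReal.mul_rpow_of_nonneg _ _ hp0.le, ← ENNReal.rpow_mul, ← ENNReal.rpow_mul, mul_comm,
    one_div_mul_cancel hp0.ne', ENNReal.rpow_one, one_div, inv_mul_eq_div,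
    hpq.div_conj_eq_sub_one]

/-- The inequality of a proper integrand that bounds the distance of a point from the plane through
the vertices of a fat simplex, with given constants `c` and `l`. -/
def HasLowerBound {N : ℕ} (n : ℕ) (p : ℝ) (K : (Fin (n + 2) → Euc N) → ℝ≥0) (c l : ℝ) : Prop :=
  ∀ t C : ℝ, 0 < t → 1 ≤ C →
    ∀ (z : Euc N) (x : Fin (n + 1) → Euc N), IsFatSimplex n (t / C) x →
      convexHull ℝ (range x) ⊆ closedBall z (C * t) →
      ∀ w ∈ closedBall z (C * t),
        (infDist w (affineSpan ℝ (range x) : Set (Euc N)) / t) ^ p ≤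
          c * C ^ l * t ^ (n * (n + 1)) * (K (Fin.snoc (α := fun _ => Euc N) x w) : ℝ) ^ p

theorem IsFatSimplex.mono {N n : ℕ} {σ σ' : ℝ} {x : Fin (n + 1) → Euc N} (hx : IsFatSimplex n σ x)
    (h : σ' ≤ σ) : IsFatSimplex n σ' x :=
  ⟨hx.1, fun i => h.trans (hx.2 i)⟩

/-- The lower bound for the integrand, at the vertices of a fat tuple and integrated over the last
point. -/
theorem HasLowerBound.setLIntegral_le {N n : ℕ} {p c l h : ℝ} {K : (Fin (n + 2) → Euc N) → ℝ≥0}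
    (hK : HasLowerBound n p K c l) (hn : 1 ≤ n) (hp : 1 < p) (hc : 1 ≤ c) (hh : 0 < h)
    {C : ℝ} (hC : 2000 ≤ C) (hCh : 1 / h ≤ C) (μ : Measure (Euc N)) {X : Euc N} {T : ℝ} (hT : 0 < T)
    {x : Fin (n + 1) → Euc N} (hx : FatTuple (h * T) x) (hxT : ∀ i, x i ∈ closedBall X T) :
    ∫⁻ w in closedBall X (2000 * T),
        ENNReal.ofReal (infDist w (affineSpan ℝ (range x) : Set (Euc N))) ^ p ∂μ ≤
      ENNReal.ofReal (c * C ^ l * T ^ (n * (n + 1)) * T ^ p) *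
        ∫⁻ w in closedBall X (2000 * T),
          (K (Fin.snoc (α := fun _ => Euc N) x w) : ℝ≥0∞) ^ p ∂μ := by
  have hp0 : 0 < p := by linarith
  rw [← lintegral_const_mul' _ _ ENNReal.ofReal_ne_top]
  refine setLIntegral_mono' isClosed_closedBall.measurableSet fun w hw => ?_
  have hfat : IsFatSimplex n (T / C) x := by
    refine (hx.isFatSimplex hn (by positivity)).mono ?_
    rw [div_le_iff₀ (by linarith)]
    rw [div_le_iff₀ hh] at hCh
    nlinarith
  have h1 := hK T C hT (by linarith) X x hfat
    (convexHull_min (range_subset_iff.2 fun i =>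
      closedBall_subset_closedBall (by nlinarith) (hxT i)) (convex_closedBall _ _))
    w (closedBall_subset_closedBall (by nlinarith) hw)
  rw [Real.div_rpow infDist_nonneg hT.le, div_le_iff₀ (by positivity)] at h1
  have hC0 : 0 < C := by linarith
  rw [ENNReal.ofReal_rpow_of_nonneg infDist_nonneg hp0.le, ← ENNReal.ofReal_coe_nnreal,
    ENNReal.ofReal_rpow_of_nonneg (NNReal.coe_nonneg _) hp0.le,
    ← ENNReal.ofReal_mul (by positivity)]
  refine ENNReal.ofReal_le_ofReal (h1.trans (le_of_eq (by ring)))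

/-- Integrating over `x` in `G` and over a last point amounts to integrating over a set of longer
tuples. -/
theorem lintegral_lintegral_snoc_le {X : Type*} [MeasurableSpace X] (μ : Measure X) [SigmaFinite μ]
    {m : ℕ} {F : (Fin (m + 1) → X) → ℝ≥0∞} (hF : AEMeasurable F (Measure.pi fun _ => μ))
    {G : Set (Fin m → X)} (hG : MeasurableSet G) {W : Set (Fin (m + 1) → X)} (hW : MeasurableSet W)
    (hGW : ∀ x ∈ G, ∀ w, Fin.snoc (α := fun _ => X) x w ∈ W) (I : Set X) :
    ∫⁻ x in G, ∫⁻ w in I, F (Fin.snoc (α := fun _ => X) x w) ∂μ ∂(Measure.pi fun _ => μ) ≤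
      ∫⁻ y in W, F y ∂(Measure.pi fun _ => μ) := by
  have hmp := measurePreserving_snoc μ m
  have hF' : AEMeasurable (W.indicator F) (Measure.pi fun _ => μ) := hF.indicator hW
  rw [← hmp.map_eq] at hF'
  have h1 : ∫⁻ z, W.indicator F (Fin.snoc (α := fun _ => X) z.1 z.2)
      ∂((Measure.pi fun _ : Fin m => μ).prod μ) = _ :=
    lintegral_prod _ (hF'.comp_aemeasurable hmp.aemeasurable)
  rw [← lintegral_indicator hW, ← hmp.map_eq, lintegral_map' hF' hmp.aemeasurable, h1,
    ← lintegral_indicator hG]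
  refine lintegral_mono fun x => ?_
  by_cases hx : x ∈ G
  · rw [indicator_of_mem hx]
    refine (setLIntegral_le_lintegral _ _).trans (lintegral_mono fun w => ?_)
    rw [indicator_of_mem (hGW x hx w)]
  · rw [indicator_of_notMem hx]
    exact zero_le

/-- The tuples whose first two vertices are at distance comparable to `t` and at distance at most a
multiple of `t` from the fibre over `q`. -/
def scaleSet {N : ℕ} (n : ℕ) (P₀ : Submodule ℝ (Euc N)) (h : ℝ) (q : P₀) (t : ℝ) :
    Set (Fin (n + 2) → Euc N) :=
  {y | ‖P₀.orthogonalProjectionOnto (y 0) - q‖ ≤ 200 * t ∧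
    h * t ≤ dist (y 0) (y 1) ∧ dist (y 0) (y 1) ≤ 200 * t}

theorem isClosed_scaleSet {N : ℕ} (n : ℕ) (P₀ : Submodule ℝ (Euc N)) (h : ℝ) (q : P₀) (t : ℝ) :
    IsClosed (scaleSet n P₀ h q t) := by
  simp only [scaleSet, ofPred_and]
  refine IsClosed.inter (isClosed_le (by fun_prop) continuous_const)
    (IsClosed.inter (isClosed_le continuous_const (by fun_prop))
      (isClosed_le (by fun_prop) continuous_const))

theorem snoc_mem_scaleSet {N n : ℕ} (hn : 1 ≤ n) {P₀ : Submodule ℝ (Euc N)} {h t T : ℝ} {q : P₀}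
    {X : Euc N} (hh : 0 ≤ h) (htT : t ≤ T) (hTt : T ≤ 100 * t)
    (hXq : ‖P₀.orthogonalProjectionOnto X - q‖ ≤ 100 * t) {x : Fin (n + 1) → Euc N}
    (hx : FatTuple (h * T) x) (hxT : ∀ i, x i ∈ closedBall X T) (w : Euc N) :
    Fin.snoc (α := fun _ => Euc N) x w ∈ scaleSet n P₀ h q t := by
  obtain ⟨m, rfl⟩ : ∃ m, n = m + 1 := ⟨n - 1, by omega⟩
  have e0 : Fin.snoc (α := fun _ => Euc N) x w 0 = x 0 := by
    rw [← Fin.castSucc_zero, Fin.snoc_castSucc]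
  have e1 : Fin.snoc (α := fun _ => Euc N) x w 1 = x 1 := by
    rw [← Fin.castSucc_one, Fin.snoc_castSucc]
  simp only [scaleSet, mem_ofPred_eq, e0, e1]
  have h0 := hxT 0
  have h1 := hxT 1
  have h2 := hx.le_dist (i := 0) (j := 1) (by simp)
  have h3 := dist_triangle_right (x 0) (x 1) X
  rw [mem_closedBall] at h0 h1
  have h4 := norm_proj_sub_le (P₀ := P₀) (x 0) X
  rw [dist_eq_norm] at h0
  rw [dist_eq_norm (x 0) X] at h3
  have h5 := norm_sub_le_norm_sub_add_norm_sub (P₀.orthogonalProjectionOnto (x 0))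
    (P₀.orthogonalProjectionOnto X) q
  refine ⟨by linarith, le_trans (by gcongr) h2, by linarith⟩

/-- A constant that is bounded by `a + F` on `G` is bounded by `a` plus the average of `F`. -/
theorem le_add_div_of_forall_le {X : Type*} [MeasurableSpace X] (μ : Measure X) {G : Set X}
    (hG : MeasurableSet G) {g a m : ℝ≥0∞} {F : X → ℝ≥0∞} (hm : m ≤ μ G) (hm0 : m ≠ 0) (hmt : m ≠ ⊤)
    (h : ∀ x ∈ G, g ≤ a + F x) : g ≤ a + (∫⁻ x in G, F x ∂μ) / m := by
  rw [← tsub_le_iff_left, ENNReal.le_div_iff_mul_le (Or.inl hm0) (Or.inl hmt)]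
  calc (g - a) * m ≤ (g - a) * μ G := by gcongr
    _ = ∫⁻ x in G, (g - a) ∂μ := (setLIntegral_const _ _).symm
    _ ≤ _ := setLIntegral_mono' hG fun x hx => tsub_le_iff_left.2 (h x hx)

/-- Every affine map is a competitor in the definition of `γ`. -/
theorem gammaFun_le {N n : ℕ} {P₀ : Submodule ℝ (Euc N)} (g : P₀ → P₀ᗮ) (q : P₀) {t : ℝ}
    (ht : 0 < t) (f : P₀ →ᵃ[ℝ] P₀ᗮ) :
    gammaFun n g q t ≤ ENNReal.ofReal (1 / t ^ (n + 1)) *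
      ∫⁻ u in closedBall q t, ENNReal.ofReal ‖g u - f u‖ ∂μHE[n] := by
  refine (iInf_le _ f).trans (le_of_eq ?_)
  have h1 : ∀ u, ENNReal.ofReal (dist (g u) (f u) / t) =
      ENNReal.ofReal (1 / t) * ENNReal.ofReal ‖g u - f u‖ := fun u => by
    rw [← ENNReal.ofReal_mul (by positivity), dist_eq_norm]
    congr 1
    ring
  simp_rw [h1]
  rw [lintegral_const_mul' _ _ ENNReal.ofReal_ne_top, ENNReal.div_eq_inv_mul, ← mul_assoc,
    ← ENNReal.ofReal_inv_of_pos (by positivity), ← ENNReal.ofReal_mul (by positivity)]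
  congr 2
  rw [pow_succ]
  field_simp

/-- The powers of `t` in the estimate of `γ ^ p` combine to `t ^ (-n)`. -/
theorem rpow_scale_identity {a b t p : ℝ} (ha : 0 ≤ a) (hb : 0 ≤ b) (ht : 0 < t) (n : ℕ) :
    (a / t ^ (n + 1)) ^ p * (b * t ^ n) ^ (p - 1) * (100 * t) ^ p =
      a ^ p * b ^ (p - 1) * 100 ^ p / t ^ n := by
  have hs : 0 < t ^ n := by positivity
  rw [pow_succ, Real.div_rpow ha (by positivity), Real.mul_rpow hs.le ht.le,
    Real.mul_rpow hb hs.le, Real.mul_rpow (by norm_num) ht.le, Real.rpow_sub_one hs.ne']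
  field_simp

set_option maxHeartbeats 1000000 in
/-- The estimate of `γ` at scales not small compared with `D`. For most tuples of points of a ball
of the system the affine map that interpolates the tuple is a competitor in the definition of `γ`;
the estimate is averaged over these tuples, and the lower bound for the integrand controls the
distance of `μ` from the interpolating planes. -/
theorem exists_gamma_const (n : ℕ) (hn : 1 ≤ n) {C₁ lam M : ℝ} (hC₁ : 0 < C₁) (hlam : 0 < lam)
    (hM : 0 ≤ M) :
    ∃ h ε₀ : ℝ, 0 < h ∧ 0 < ε₀ ∧ ∀ p c l : ℝ, 1 < p → 1 ≤ c → 1 ≤ l → ∃ C : ℝ, 0 < C ∧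
      ∀ (N : ℕ) (μ : Measure (Euc N)) [IsFiniteMeasure μ],
      (∀ x r, 0 < r → μ (closedBall x r) ≤ ENNReal.ofReal (C₁ * r ^ n)) →
      ∀ P₀ : Submodule ℝ (Euc N), finrank ℝ P₀ = n → ∀ ε S a A D, 0 < ε → ε ≤ ε₀ →
      GraphSystem n P₀ μ lam ε M S a A D →
      ∀ K : (Fin (n + 2) → Euc N) → ℝ≥0, AEMeasurable K (Measure.pi fun _ => μ) →
      HasLowerBound n p K c l →
      ∀ (q : P₀) (t ρ : ℝ), ‖q‖ ≤ 10 → 0 < t → t < 2 → 0 < ρ → ρ ≤ t → D q < 100 * t →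
      gammaFun n A q t ^ p ≤
        ENNReal.ofReal (C * ε ^ p / t ^ (n + 1)) *
          ∫⁻ u in closedBall q (27 * t), ENNReal.ofReal (D u + ρ) ∂μHE[n] +
        ENNReal.ofReal (C / t ^ n) *
          ∫⁻ y in scaleSet n P₀ h q t, (K y : ℝ≥0∞) ^ p ∂(Measure.pi fun _ => μ) := by
  set ω := unitBallVolume n with hω
  have hω0 : 0 < ω := unitBallVolume_pos n
  obtain ⟨C₃, ε₁, hC₃, hε₁, hcov⟩ := exists_covering_const n hC₁.le hlam hM hω0
  obtain ⟨θ, hθ, htup⟩ := exists_fat_tuples n hC₁.le hlam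
  obtain ⟨h, hh, htup⟩ := htup n le_rfl
  set κ := h / (4 * (n + 1)) with hκ
  have hκ0 : 0 < κ := by positivity
  refine ⟨h, min ε₁ (θ * κ / 4), hh, by positivity, ?_⟩
  intro p c l hp hc hl
  have hp0 : 0 < p := by linarith
  set Cc := max 2000 (1 / h) with hCc
  have hCc0 : 0 < Cc := lt_max_of_lt_left (by norm_num)
  set Y := C₃ * (128 * ω * 27 ^ n) with hY
  have hY0 : 0 < Y := by positivity
  set Ca := Y ^ (p - 1) * C₃ with hCa
  set Cb := (C₃ * 3) ^ p * (C₁ * 200000 ^ n) ^ (p - 1) * 100 ^ p * (c * Cc ^ l) / θ ^ (n + 1)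
    with hCb
  have hCa0 : 0 < Ca := by positivity
  have hCb0 : 0 < Cb := by positivity
  refine ⟨2 ^ (p - 1) * max Ca Cb, by positivity, ?_⟩
  intro N μ _ hμ P₀ hP₀ ε S a A D hε hεs hS K hKm hK q t ρ hq ht ht2 hρ hρt hDq
  obtain ⟨X, T, hX, htT, hTt, hXq, hmain⟩ := hcov N μ hμ P₀ hP₀ ε S a A D hε
    (hεs.trans (min_le_left _ _)) hS μHE[n]
    (fun u r hr => hausdorffMeasure_closedBall hn hP₀ u hr) q t ρ hq ht ht2 hρ hρt hDq
  have hT : 0 < T := by linarith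
  have hTn : 0 < T ^ n := by positivity
  -- the points far from the graph of the ball `B(X, T)`: a fat tuple that avoids them can be
  -- interpolated by an affine map of controlled slope
  set E := {w | κ * T < vertDist (a (X, T)) w} with hE
  have hEm : MeasurableSet E :=
    measurableSet_lt measurable_const (continuous_vertDist _).measurable
  have hEμ : μ (closedBall X T ∩ E) ≤ ENNReal.ofReal (θ * T ^ n) := by
    refine (measure_lt_vertDist_le (a (X, T)) (by positivity)
      ((lintegral_mono_set (closedBall_subset_closedBall (by linarith))).trans
        (hS.flat X T hX))).trans (ENNReal.ofReal_le_ofReal ?_)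
    have h1 : ε ≤ θ * κ / 4 := hεs.trans (min_le_right _ _)
    rw [div_le_iff₀ (by positivity)]
    calc 4 * ε * T ^ (n + 1) ≤ 4 * (θ * κ / 4) * T ^ (n + 1) := by gcongr
      _ = _ := by ring
  have hG := htup N μ hμ X T hT (hS.mass X T hX) E hEm hEμ
  set G := {x : Fin (n + 1) → Euc N | (∀ i, x i ∈ closedBall X T \ E) ∧ FatTuple (h * T) x}
    with hGdef
  have hGm : MeasurableSet G := measurableSet_fatTuple X T (h * T) hEm
  set B := ∫⁻ u in closedBall q (27 * t), ENNReal.ofReal (D u + ρ) ∂μHE[n] with hB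
  -- the contribution of `D`: since `D ≤ 127 t` on the ball, `p - 1` of the `p` factors of the mean
  -- of `D` are estimated by a constant
  have hBle : B ≤ ENNReal.ofReal (128 * t * (ω * (27 * t) ^ n)) := by
    calc B ≤ ∫⁻ u in closedBall q (27 * t), ENNReal.ofReal (128 * t) ∂μHE[n] := by
          refine setLIntegral_mono' isClosed_closedBall.measurableSet fun u hu => ?_
          rw [mem_closedBall, dist_eq_norm] at hu
          have := hS.dist_le_add u q
          exact ENNReal.ofReal_le_ofReal (by linarith)
      _ = _ := by
          rw [setLIntegral_const, hausdorffMeasure_closedBall hn hP₀ _ (by positivity),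
            ← ENNReal.ofReal_mul (by positivity)]
  have hα : (ENNReal.ofReal (1 / t ^ (n + 1)) * (ENNReal.ofReal (C₃ * ε) * B)) ^ p ≤
      ENNReal.ofReal (Ca * ε ^ p / t ^ (n + 1)) * B := by
    set y := ENNReal.ofReal (C₃ / t ^ (n + 1)) * B with hy
    have hyY : y ≤ ENNReal.ofReal Y := by
      calc y ≤ ENNReal.ofReal (C₃ / t ^ (n + 1)) *
            ENNReal.ofReal (128 * t * (ω * (27 * t) ^ n)) := mul_le_mul_right hBle _
        _ = ENNReal.ofReal Y := by
            rw [← ENNReal.ofReal_mul (by positivity), mul_pow, pow_succ, hY]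
            congr 1
            field_simp
    have e1 : ENNReal.ofReal (1 / t ^ (n + 1)) * (ENNReal.ofReal (C₃ * ε) * B) =
        ENNReal.ofReal ε * y := by
      rw [hy, ← mul_assoc, ← mul_assoc, ← ENNReal.ofReal_mul (by positivity),
        ← ENNReal.ofReal_mul (by positivity)]
      congr 2
      ring
    have e2 : y ^ p = y ^ (p - 1) * y := by
      conv_rhs => rw [← ENNReal.rpow_one y, ← ENNReal.rpow_mul, one_mul]
      rw [← ENNReal.rpow_add_of_nonneg _ _ (by linarith) (by norm_num)]
      congr 1
      ring
    rw [e1, ENNReal.mul_rpow_of_nonneg _ _ hp0.le, e2]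
    calc _ ≤ ENNReal.ofReal ε ^ p * (ENNReal.ofReal Y ^ (p - 1) * y) := by
          gcongr
      _ = _ := by
          rw [ENNReal.ofReal_rpow_of_nonneg hε.le hp0.le,
            ENNReal.ofReal_rpow_of_nonneg hY0.le (by linarith), hy, ← mul_assoc, ← mul_assoc,
            ← ENNReal.ofReal_mul (by positivity), ← ENNReal.ofReal_mul (by positivity)]
          congr 2
          rw [hCa]
          ring
  -- the contribution of `μ`, by the inequality of Hölder and the lower bound for the integrand
  have hβ : ∀ x ∈ G, (ENNReal.ofReal (1 / t ^ (n + 1)) * (ENNReal.ofReal (C₃ * 3) *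
      ∫⁻ w in closedBall X (2000 * T),
        ENNReal.ofReal (infDist w (affineSpan ℝ (range x) : Set (Euc N))) ∂μ)) ^ p ≤
      ENNReal.ofReal (Cb * (θ * T ^ n) ^ (n + 1) / t ^ n) * ∫⁻ w in closedBall X (2000 * T),
          (K (Fin.snoc (α := fun _ => Euc N) x w) : ℝ≥0∞) ^ p ∂μ := by
    intro x hx
    have h1 := hK.setLIntegral_le hn hp hc hh (le_max_left _ _) (le_max_right _ _) μ hT hx.2
      (fun i => (hx.1 i).1)
    have h2 := setLIntegral_rpow_le μ hp (f := fun w => ENNReal.ofReal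
      (infDist w (affineSpan ℝ (range x) : Set (Euc N))))
      (by fun_prop) (closedBall X (2000 * T))
    have h3 : μ (closedBall X (2000 * T)) ≤ ENNReal.ofReal (C₁ * 200000 ^ n * t ^ n) := by
      refine (hμ X _ (by positivity)).trans (ENNReal.ofReal_le_ofReal ?_)
      rw [mul_assoc C₁, ← mul_pow]
      exact mul_le_mul_of_nonneg_left (pow_le_pow_left₀ (by positivity) (by linarith) n) hC₁.le
    rw [← mul_assoc, ← ENNReal.ofReal_mul (by positivity), ENNReal.mul_rpow_of_nonneg _ _ hp0.le]
    calc _ ≤ ENNReal.ofReal (1 / t ^ (n + 1) * (C₃ * 3)) ^ p *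
          (ENNReal.ofReal (C₁ * 200000 ^ n * t ^ n) ^ (p - 1) *
          (ENNReal.ofReal (c * Cc ^ l * T ^ (n * (n + 1)) * T ^ p) *
            ∫⁻ w in closedBall X (2000 * T),
              (K (Fin.snoc (α := fun _ => Euc N) x w) : ℝ≥0∞) ^ p ∂μ)) := by
          refine mul_le_mul_right (h2.trans ?_) _
          exact mul_le_mul' (ENNReal.rpow_le_rpow h3 (by linarith)) h1
      _ = ENNReal.ofReal ((1 / t ^ (n + 1) * (C₃ * 3)) ^ p * (C₁ * 200000 ^ n * t ^ n) ^ (p - 1) *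
            (c * Cc ^ l * T ^ (n * (n + 1)) * T ^ p)) * ∫⁻ w in closedBall X (2000 * T),
            (K (Fin.snoc (α := fun _ => Euc N) x w) : ℝ≥0∞) ^ p ∂μ := by
          rw [ENNReal.ofReal_rpow_of_nonneg (by positivity) hp0.le,
            ENNReal.ofReal_rpow_of_nonneg (by positivity) (by linarith), ← mul_assoc, ← mul_assoc,
            ← ENNReal.ofReal_mul (by positivity), ← ENNReal.ofReal_mul (by positivity)]
      _ ≤ _ := by
          refine mul_le_mul_left (ENNReal.ofReal_le_ofReal ?_) _
          have e1 := rpow_scale_identity (a := C₃ * 3) (b := C₁ * 200000 ^ n) (p := p)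
            (by positivity) (by positivity) ht n
          calc _ ≤ (1 / t ^ (n + 1) * (C₃ * 3)) ^ p * (C₁ * 200000 ^ n * t ^ n) ^ (p - 1) *
                (c * Cc ^ l * T ^ (n * (n + 1)) * (100 * t) ^ p) := by gcongr
            _ = ((C₃ * 3) / t ^ (n + 1)) ^ p * (C₁ * 200000 ^ n * t ^ n) ^ (p - 1) * (100 * t) ^ p *
                (c * Cc ^ l * T ^ (n * (n + 1))) := by
                rw [one_div_mul_eq_div]; ring
            _ = _ := by
                rw [e1, hCb, mul_pow θ, ← pow_mul]
                field_simp
  have hg : ∀ x ∈ G, gammaFun n A q t ^ p ≤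
      2 ^ (p - 1) * (ENNReal.ofReal (Ca * ε ^ p / t ^ (n + 1)) * B) +
      2 ^ (p - 1) * (ENNReal.ofReal (Cb * (θ * T ^ n) ^ (n + 1) / t ^ n) *
        ∫⁻ w in closedBall X (2000 * T),
          (K (Fin.snoc (α := fun _ => Euc N) x w) : ℝ≥0∞) ^ p ∂μ) := by
    intro x hx
    obtain ⟨f, hf⟩ := hx.2.exists_interpolation hP₀ (by positivity) (hS.slope X T hX)
      (fun i => not_lt.1 (hx.1 i).2) (by rw [hκ]; field_simp; exact le_rfl)
    have h1 := gammaFun_le (n := n) A q ht f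
    have h2 : ∫⁻ w in closedBall X (2000 * T), ENNReal.ofReal (vertDist f w) ∂μ ≤
        ENNReal.ofReal 3 * ∫⁻ w in closedBall X (2000 * T),
          ENNReal.ofReal (infDist w (affineSpan ℝ (range x) : Set (Euc N))) ∂μ := by
      rw [← lintegral_const_mul' _ _ ENNReal.ofReal_ne_top]
      refine lintegral_mono fun w => ?_
      rw [← ENNReal.ofReal_mul (by norm_num)]
      exact ENNReal.ofReal_le_ofReal (hf w)
    rw [← mul_add]
    refine le_trans ?_ (mul_le_mul_right (add_le_add hα (hβ x hx)) _)
    refine le_trans ?_ (ENNReal.rpow_add_le_mul_rpow_add_rpow _ _ hp.le)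
    refine ENNReal.rpow_le_rpow ?_ hp0.le
    rw [← mul_add]
    refine h1.trans (mul_le_mul_right ((hmain f).trans (add_le_add_right ?_ _)) _)
    rw [ENNReal.ofReal_mul hC₃.le, mul_assoc]
    gcongr
  have h4 := le_add_div_of_forall_le (Measure.pi fun _ : Fin (n + 1) => μ) hGm hG
    (by simp only [ne_eq, ENNReal.ofReal_eq_zero, not_le]; positivity) ENNReal.ofReal_ne_top hg
  rw [lintegral_const_mul' _ _ (by simp), lintegral_const_mul' _ _ ENNReal.ofReal_ne_top] at h4
  have h5 := lintegral_lintegral_snoc_le μ (F := fun y => (K y : ℝ≥0∞) ^ p)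
    (hKm.coe_nnreal_ennreal.pow_const p) hGm (isClosed_scaleSet n P₀ h q t).measurableSet
    (fun x hx w => snoc_mem_scaleSet hn hh.le htT hTt hXq hx.2 (fun i => (hx.1 i).1) w)
    (closedBall X (2000 * T))
  have e2 : (2 : ℝ≥0∞) ^ (p - 1) = ENNReal.ofReal (2 ^ (p - 1)) := by
    rw [← ENNReal.ofReal_rpow_of_nonneg (by norm_num) (by linarith)]
    simp
  rw [e2] at h4
  refine h4.trans (add_le_add ?_ ?_)
  · rw [← mul_assoc, ← ENNReal.ofReal_mul (by positivity)]
    refine mul_le_mul_left (ENNReal.ofReal_le_ofReal ?_) _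
    rw [mul_div_assoc, mul_div_assoc, ← mul_assoc]
    gcongr
    exact le_max_left _ _
  · rw [← mul_assoc, ← ENNReal.ofReal_mul (by positivity), ENNReal.mul_div_right_comm,
      ← ENNReal.ofReal_div_of_pos (by positivity)]
    refine mul_le_mul' (ENNReal.ofReal_le_ofReal ?_) h5
    rw [div_le_iff₀ (by positivity)]
    calc _ = 2 ^ (p - 1) * Cb / t ^ n * (θ * T ^ n) ^ (n + 1) := by ring
      _ ≤ _ := by
        gcongr
        exact le_max_right _ _

/-! ### Integration over points and scales -/

/-- Tonelli's theorem for three measures: the order of integration is reversed. -/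
theorem lintegral_reverse {X Y Z : Type*} [MeasurableSpace X] [MeasurableSpace Y]
    [MeasurableSpace Z] (ν : Measure X) (τ : Measure Y) (m : Measure Z) [SFinite ν] [SFinite τ]
    [SFinite m] {f : X → Y → Z → ℝ≥0∞} (hf : Measurable fun p : X × Y × Z => f p.1 p.2.1 p.2.2) :
    ∫⁻ x, ∫⁻ y, ∫⁻ z, f x y z ∂m ∂τ ∂ν = ∫⁻ z, ∫⁻ y, ∫⁻ x, f x y z ∂ν ∂τ ∂m := by
  have h1 : ∀ x, ∫⁻ y, ∫⁻ z, f x y z ∂m ∂τ = ∫⁻ z, ∫⁻ y, f x y z ∂τ ∂m := fun x =>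
    lintegral_lintegral_swap
      (hf.comp (f := fun p : Y × Z => (x, p.1, p.2)) (by fun_prop)).aemeasurable
  have h2 : ∀ z, ∫⁻ x, ∫⁻ y, f x y z ∂τ ∂ν = ∫⁻ y, ∫⁻ x, f x y z ∂ν ∂τ := fun z =>
    lintegral_lintegral_swap
      (hf.comp (f := fun p : X × Y => (p.1, p.2, z)) (by fun_prop)).aemeasurable
  have h3 : Measurable fun p : (X × Z) × Y => f p.1.1 p.2 p.1.2 :=
    hf.comp (f := fun p : (X × Z) × Y => (p.1.1, p.2, p.1.2)) (by fun_prop)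
  simp_rw [h1]
  rw [lintegral_lintegral_swap h3.lintegral_prod_right'.aemeasurable]
  simp_rw [h2]

theorem lintegral_Ioi_inv_sq {s : ℝ} (hs : 0 < s) :
    ∫⁻ t in Ioi s, ENNReal.ofReal (1 / t ^ 2) = ENNReal.ofReal (1 / s) := by
  have h1 : ∀ t ∈ Ioi s, t ^ (-2 : ℝ) = 1 / t ^ 2 := fun t ht => by
    have : 0 < t := hs.trans ht
    rw [Real.rpow_neg this.le, one_div]
    norm_cast
  have h2 := integrableOn_Ioi_rpow_of_lt (a := -2) (by norm_num) hs
  have h3 := integral_Ioi_rpow_of_lt (a := -2) (by norm_num) hs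
  rw [setLIntegral_congr_fun (g := fun t => ENNReal.ofReal (t ^ (-2 : ℝ))) measurableSet_Ioi
    (fun t ht => by simp only [h1 t ht]), ← ofReal_integral_eq_lintegral_ofReal h2, h3]
  · congr 1
    rw [show (-2 : ℝ) + 1 = -1 by norm_num, Real.rpow_neg_one]
    ring
  · filter_upwards [ae_restrict_mem measurableSet_Ioi] with t ht
    exact Real.rpow_nonneg (hs.trans ht).le _

section Scales

variable {N n : ℕ} {P₀ : Submodule ℝ (Euc N)}

theorem sigmaFinite_hausdorffMeasure (hP₀ : finrank ℝ P₀ = n) :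
    SigmaFinite (μHE[n] : Measure P₀) := by
  subst hP₀
  rw [InnerProductSpace.euclideanHausdorffMeasure_eq_volume]
  infer_instance

open Classical in
theorem measurable_distKernel {D : P₀ → ℝ} (hD : Continuous D) :
    Measurable fun p : P₀ × ℝ × P₀ =>
      if ‖p.2.2 - p.1‖ ≤ 27 * p.2.1 ∧ D p.2.2 ≤ 127 * p.2.1 then
        ENNReal.ofReal (D p.2.2 / p.2.1 ^ (n + 2)) else 0 := by
  have hDm := hD.measurable
  have hset : MeasurableSet {p : P₀ × ℝ × P₀ | ‖p.2.2 - p.1‖ ≤ 27 * p.2.1 ∧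
      D p.2.2 ≤ 127 * p.2.1} := by
    rw [ofPred_and]
    exact (measurableSet_le (by fun_prop) (by fun_prop)).inter
      (measurableSet_le (by fun_prop) (by fun_prop))
  exact Measurable.ite hset (by fun_prop) measurable_const

open Classical in
/-- The integral over all scales of the means of `D` at scales not small compared with `D`. For
fixed `u`, the integral over `q` gives a factor `t ^ n`, and the integral of `D u / t ^ 2` over `t ≥
D u / 127` is bounded. -/
theorem lintegral_dist_le (hn : 1 ≤ n) (hP₀ : finrank ℝ P₀ = n) {D : P₀ → ℝ} (hD : Continuous D)
    (hD0 : ∀ u, 0 ≤ D u) :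
    ∫⁻ q in closedBall (0 : P₀) 10, ∫⁻ t in Ioo (0 : ℝ) 2, ∫⁻ u in closedBall (0 : P₀) 64,
        (if ‖u - q‖ ≤ 27 * t ∧ D u ≤ 127 * t then ENNReal.ofReal (D u / t ^ (n + 2)) else 0)
          ∂μHE[n] ∂volume ∂μHE[n] ≤
      ENNReal.ofReal (unitBallVolume n * 27 ^ n * 128 * (unitBallVolume n * 64 ^ n)) := by
  have := sigmaFinite_hausdorffMeasure hP₀
  have hω := unitBallVolume_pos n
  rw [lintegral_reverse]
  · calc _ ≤ ∫⁻ u in closedBall (0 : P₀) 64, ENNReal.ofReal (unitBallVolume n * 27 ^ n * 128)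
          ∂μHE[n] := lintegral_mono fun u => ?_
      _ = _ := by
        rw [setLIntegral_const, hausdorffMeasure_closedBall hn hP₀ _ (by norm_num),
          ← ENNReal.ofReal_mul (by positivity)]
    have h1 : ∀ t ∈ Ioo (0 : ℝ) 2, ∫⁻ q in closedBall (0 : P₀) 10,
        (if ‖u - q‖ ≤ 27 * t ∧ D u ≤ 127 * t then ENNReal.ofReal (D u / t ^ (n + 2)) else 0)
          ∂μHE[n] ≤
        (Ioi (D u / 128)).indicator
          (fun t => ENNReal.ofReal (unitBallVolume n * 27 ^ n * D u) *
            ENNReal.ofReal (1 / t ^ 2)) t := by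
      rintro t ⟨ht, -⟩
      by_cases hDt : D u ≤ 127 * t
      · rw [indicator_of_mem (mem_Ioi.2 (by linarith : D u / 128 < t))]
        calc _ ≤ ∫⁻ q, (closedBall u (27 * t)).indicator
              (fun _ => ENNReal.ofReal (D u / t ^ (n + 2))) q ∂μHE[n] := by
              refine (setLIntegral_le_lintegral _ _).trans (lintegral_mono fun q => ?_)
              split_ifs with h
              · rw [indicator_of_mem]
                rw [mem_closedBall, dist_comm, dist_eq_norm]
                exact h.1
              · exact zero_le
          _ = _ := by
              rw [lintegral_indicator isClosed_closedBall.measurableSet, setLIntegral_const,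
                hausdorffMeasure_closedBall hn hP₀ _ (by positivity),
                ← ENNReal.ofReal_mul (by have := hD0 u; positivity),
                ← ENNReal.ofReal_mul (by have := hD0 u; positivity)]
              congr 1
              rw [mul_pow, pow_add]
              field_simp
      · simp [hDt]
    refine (setLIntegral_mono' measurableSet_Ioo h1).trans ?_
    refine (setLIntegral_le_lintegral _ _).trans ?_
    rw [lintegral_indicator measurableSet_Ioi, lintegral_const_mul' _ _ ENNReal.ofReal_ne_top]
    rcases (hD0 u).eq_or_lt with h0 | h0
    · simp [← h0]
    · rw [lintegral_Ioi_inv_sq (by positivity), ← ENNReal.ofReal_mul (by positivity)]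
      refine ENNReal.ofReal_le_ofReal (le_of_eq ?_)
      field_simp
  · exact measurable_distKernel hD

open Classical in
/-- The integral over all scales of the integrals of `F` over tuples of the given scale. A fixed
tuple belongs to the scale `t` only if `t` is comparable to the distance of its first two vertices,
and then only for `q` in a ball of radius `200 * t`. -/
theorem lintegral_scaleSet_le (hn : 1 ≤ n) (hP₀ : finrank ℝ P₀ = n) {h : ℝ} (hh : 0 < h)
    (m : Measure (Fin (n + 2) → Euc N)) [SFinite m] {F : (Fin (n + 2) → Euc N) → ℝ≥0∞}
    (hF : Measurable F) :
    ∫⁻ q in closedBall (0 : P₀) 10, ∫⁻ t in Ioo (0 : ℝ) 2, ∫⁻ y,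
        (if y ∈ scaleSet n P₀ h q t then ENNReal.ofReal (1 / t ^ (n + 1)) * F y else 0)
          ∂m ∂volume ∂μHE[n] ≤
      ENNReal.ofReal (unitBallVolume n * 200 ^ n * (200 / h)) * ∫⁻ y, F y ∂m := by
  have := sigmaFinite_hausdorffMeasure hP₀
  have hω := unitBallVolume_pos n
  rw [lintegral_reverse]
  · rw [← lintegral_const_mul' _ _ ENNReal.ofReal_ne_top]
    refine lintegral_mono fun y => ?_
    set s := dist (y 0) (y 1) with hs
    have h1 : ∀ t ∈ Ioo (0 : ℝ) 2, ∫⁻ q in closedBall (0 : P₀) 10,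
        (if y ∈ scaleSet n P₀ h q t then ENNReal.ofReal (1 / t ^ (n + 1)) * F y else 0) ∂μHE[n] ≤
        (Icc (s / 200) (s / h)).indicator
          (fun _ => ENNReal.ofReal (unitBallVolume n * 200 ^ n * (200 / s)) * F y) t := by
      rintro t ⟨ht, -⟩
      by_cases hst : h * t ≤ s ∧ s ≤ 200 * t
      · have hs0 : 0 < s := lt_of_lt_of_le (by positivity) hst.1
        rw [indicator_of_mem (mem_Icc.2
          ⟨by linarith [hst.2], by rw [le_div_iff₀ hh]; linarith [hst.1]⟩)]
        calc _ ≤ ∫⁻ q, (closedBall (P₀.orthogonalProjectionOnto (y 0)) (200 * t)).indicator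
              (fun _ => ENNReal.ofReal (1 / t ^ (n + 1)) * F y) q ∂μHE[n] := by
              refine (setLIntegral_le_lintegral _ _).trans (lintegral_mono fun q => ?_)
              split_ifs with hq
              · rw [indicator_of_mem]
                rw [mem_closedBall, dist_comm, dist_eq_norm]
                exact hq.1
              · exact zero_le
          _ = ENNReal.ofReal (unitBallVolume n * 200 ^ n * (1 / t)) * F y := by
              rw [lintegral_indicator isClosed_closedBall.measurableSet, setLIntegral_const,
                hausdorffMeasure_closedBall hn hP₀ _ (by positivity), mul_right_comm,
                ← ENNReal.ofReal_mul (by positivity)]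
              congr 2
              rw [mul_pow, pow_add]
              field_simp
          _ ≤ _ := by
              refine mul_le_mul_left (ENNReal.ofReal_le_ofReal ?_) _
              gcongr ?_ * ?_
              rw [div_le_div_iff₀ ht hs0]
              linarith [hst.2]
      · have : ∀ q, y ∉ scaleSet n P₀ h q t := fun q hq => hst hq.2
        simp [this]
    refine (setLIntegral_mono' measurableSet_Ioo h1).trans ?_
    refine (setLIntegral_le_lintegral _ _).trans ?_
    rw [lintegral_indicator measurableSet_Icc, setLIntegral_const, Real.volume_Icc, mul_right_comm,
      ← ENNReal.ofReal_mul (by positivity)]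
    refine mul_le_mul_left (ENNReal.ofReal_le_ofReal ?_) _
    have hs0 : 0 ≤ s := dist_nonneg
    rcases hs0.eq_or_lt with h0 | h0
    · rw [← h0]; simp; positivity
    · calc _ ≤ unitBallVolume n * 200 ^ n * (200 / s) * (s / h) := by
            gcongr; linarith [show 0 ≤ s / 200 by positivity]
        _ = _ := by field_simp
  · have hset : MeasurableSet {p : P₀ × ℝ × (Fin (n + 2) → Euc N) |
        p.2.2 ∈ scaleSet n P₀ h p.1 p.2.1} := by
      simp only [scaleSet, ofPred_and]
      exact (measurableSet_le (by fun_prop) (by fun_prop)).inter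
        ((measurableSet_le (by fun_prop) (by fun_prop)).inter
          (measurableSet_le (by fun_prop) (by fun_prop)))
    exact Measurable.ite hset (by fun_prop) measurable_const

/-- The estimate of `γ` at scales small compared with `D`, where `A` is smooth. -/
theorem gammaFun_rpow_div_le (hn : 1 ≤ n) (hP₀ : finrank ℝ P₀ = n) {p J ε d t : ℝ} (hp : 1 < p)
    (hJ : 0 ≤ J) (hε : 0 ≤ ε) (hd : 0 < d) (ht : 0 < t) (htd : t ≤ d) {A : P₀ → P₀ᗮ} {q : P₀}
    {f : P₀ →ᵃ[ℝ] P₀ᗮ} (hf : ∀ u ∈ closedBall q t, ‖A u - f u‖ ≤ J * ε * d * (t / d) ^ 2) :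
    gammaFun n A q t ^ p / ENNReal.ofReal t ≤
      ENNReal.ofReal ((J * unitBallVolume n) ^ p * ε ^ p / d) := by
  have hω := unitBallVolume_pos n
  have h1 : gammaFun n A q t ≤ ENNReal.ofReal (J * unitBallVolume n * ε * (t / d)) := by
    refine (gammaFun_le A q ht f).trans ?_
    calc _ ≤ ENNReal.ofReal (1 / t ^ (n + 1)) * ∫⁻ u in closedBall q t,
          ENNReal.ofReal (J * ε * d * (t / d) ^ 2) ∂μHE[n] := by
          refine mul_le_mul_right (setLIntegral_mono' isClosed_closedBall.measurableSet
            fun u hu => ENNReal.ofReal_le_ofReal (hf u hu)) _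
      _ = _ := by
          rw [setLIntegral_const, hausdorffMeasure_closedBall hn hP₀ _ ht.le,
            ← ENNReal.ofReal_mul (by positivity), ← ENNReal.ofReal_mul (by positivity)]
          congr 1
          rw [pow_succ]
          field_simp
  calc _ ≤ ENNReal.ofReal (J * unitBallVolume n * ε * (t / d)) ^ p / ENNReal.ofReal t := by
        gcongr
    _ = ENNReal.ofReal ((J * unitBallVolume n * ε * (t / d)) ^ p / t) := by
        rw [ENNReal.ofReal_rpow_of_nonneg (by positivity) (by linarith),
          ENNReal.ofReal_div_of_pos ht]
    _ ≤ _ := by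
        refine ENNReal.ofReal_le_ofReal ?_
        have h2 : (t / d) ^ p ≤ t / d := by
          have h3 : t / d ≤ 1 := by rwa [div_le_one hd]
          calc (t / d) ^ p ≤ (t / d) ^ (1 : ℝ) :=
                Real.rpow_le_rpow_of_exponent_ge (by positivity) h3 hp.le
            _ = _ := Real.rpow_one _
        rw [Real.mul_rpow (by positivity) (by positivity), Real.mul_rpow (by positivity) hε,
          div_le_iff₀ ht]
        calc _ ≤ (J * unitBallVolume n) ^ p * ε ^ p * (t / d) := by gcongr
          _ = _ := by ring

end Scales

/-! ### The integral of `γ ^ p` -/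

set_option maxHeartbeats 1000000 in
open Classical in
/-- The estimate of the integral of `γ ^ p` over all points and scales, for a map `A` that is close
to a system of graphs and smooth at scales small compared with `D`. -/
theorem exists_integral_const (n : ℕ) (hn : 1 ≤ n) {C₁ lam M J : ℝ} (hC₁ : 0 < C₁) (hlam : 0 < lam)
    (hM : 0 ≤ M) (hJ : 0 ≤ J) :
    ∃ ε₀ : ℝ, 0 < ε₀ ∧ ∀ p c l : ℝ, 1 < p → 1 ≤ c → 1 ≤ l → ∃ C : ℝ, 0 < C ∧
      ∀ (N : ℕ) (μ : Measure (Euc N)) [IsFiniteMeasure μ],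
      (∀ x r, 0 < r → μ (closedBall x r) ≤ ENNReal.ofReal (C₁ * r ^ n)) →
      ∀ P₀ : Submodule ℝ (Euc N), finrank ℝ P₀ = n → ∀ ε S a A D, 0 < ε → ε ≤ ε₀ →
      GraphSystem n P₀ μ lam ε M S a A D → Continuous D →
      (∀ (q : P₀) (t : ℝ), ‖q‖ ≤ 10 → 0 < t → t < 2 → t ≤ D q / 100 →
        ∃ f : P₀ →ᵃ[ℝ] P₀ᗮ, ∀ u ∈ closedBall q t, ‖A u - f u‖ ≤ J * ε * D q * (t / D q) ^ 2) →
      ∀ K : (Fin (n + 2) → Euc N) → ℝ≥0, AEMeasurable K (Measure.pi fun _ => μ) →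
      HasLowerBound n p K c l →
      ∫⁻ q in closedBall (0 : P₀) 10, ∫⁻ t in Ioo (0 : ℝ) 2,
          gammaFun n A q t ^ p / ENNReal.ofReal t ∂volume ∂μHE[n] ≤
        ENNReal.ofReal (C * ε ^ p) + ENNReal.ofReal C * mengerCurvature n p K μ := by
  obtain ⟨h, ε₀, hh, hε₀, hγ⟩ := exists_gamma_const n hn hC₁ hlam hM
  refine ⟨ε₀, hε₀, fun p c l hp hc hl => ?_⟩
  obtain ⟨C₂, hC₂, hγ⟩ := hγ p c l hp hc hl
  have hω := unitBallVolume_pos n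
  set ω := unitBallVolume n with hωdef
  set E₁ := (J * ω) ^ p / 100 * (ω * 10 ^ n) + C₂ * (ω * 27 ^ n / 4) * 2 * (ω * 10 ^ n) +
    C₂ * (ω * 27 ^ n * 128 * (ω * 64 ^ n)) with hE₁
  set E₂ := C₂ * (ω * 200 ^ n * (200 / h)) with hE₂
  have hE₁0 : 0 < E₁ := by positivity
  have hE₂0 : 0 < E₂ := by positivity
  refine ⟨max E₁ E₂, lt_max_of_lt_left hE₁0, ?_⟩
  intro N μ _ hμ P₀ hP₀ ε S a A D hε hεs hS hDc hsmall K hKm hK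
  have := sigmaFinite_hausdorffMeasure hP₀
  have hp0 : 0 < p := by linarith
  have hKp : AEMeasurable (fun y => (K y : ℝ≥0∞) ^ p) (Measure.pi fun _ => μ) :=
    hKm.coe_nnreal_ennreal.pow_const p
  -- the integrand is only almost everywhere measurable, and Tonelli needs a measurable version
  set F := hKp.mk _ with hF
  have hFm : Measurable F := hKp.measurable_mk
  have hFeq : ∫⁻ y, F y ∂(Measure.pi fun _ => μ) = mengerCurvature n p K μ :=
    (lintegral_congr_ae hKp.ae_eq_mk).symm
  set f₁ : P₀ → ℝ → ℝ≥0∞ := fun q =>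
    (Ioc 0 (D q / 100)).indicator fun _ => ENNReal.ofReal ((J * ω) ^ p * ε ^ p / D q) with hf₁
  set G : P₀ → ℝ → ℝ≥0∞ := fun q t => ∫⁻ u in closedBall (0 : P₀) 64,
    (if ‖u - q‖ ≤ 27 * t ∧ D u ≤ 127 * t then ENNReal.ofReal (D u / t ^ (n + 2)) else 0) ∂μHE[n]
    with hG
  set H : P₀ → ℝ → ℝ≥0∞ := fun q t => ∫⁻ y,
    (if y ∈ scaleSet n P₀ h q t then ENNReal.ofReal (1 / t ^ (n + 1)) * F y else 0)
      ∂(Measure.pi fun _ => μ) with hH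
  have hGm : Measurable fun z : P₀ × ℝ => G z.1 z.2 :=
    Measurable.lintegral_prod_right' ((measurable_distKernel hDc).comp
      (f := fun z : (P₀ × ℝ) × P₀ => (z.1.1, z.1.2, z.2)) (by fun_prop))
  -- at every point and scale, one of the two estimates of `γ` applies
  have hpt : ∀ q ∈ closedBall (0 : P₀) 10, ∀ t ∈ Ioo (0 : ℝ) 2,
      gammaFun n A q t ^ p / ENNReal.ofReal t ≤
        f₁ q t + (ENNReal.ofReal (C₂ * (ω * 27 ^ n / 4) * ε ^ p) +
        (ENNReal.ofReal (C₂ * ε ^ p) * G q t + ENNReal.ofReal C₂ * H q t)) := by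
    rintro q hq t ⟨ht, ht2⟩
    rw [mem_closedBall_zero_iff] at hq
    rcases le_or_gt t (D q / 100) with htD | htD
    · obtain ⟨f, hf⟩ := hsmall q t hq ht ht2 htD
      have h1 := gammaFun_rpow_div_le hn hP₀ hp hJ hε.le (by linarith : 0 < D q) ht (by linarith) hf
      have h2 : f₁ q t = ENNReal.ofReal ((J * ω) ^ p * ε ^ p / D q) :=
        indicator_of_mem (mem_Ioc.2 ⟨ht, htD⟩) _
      exact le_add_right (h1.trans h2.ge)
    · refine le_add_left ?_
      -- with `ρ = t ^ 2 / 4`, the mean of `ρ / t` is integrable with respect to `dt / t`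
      have h1 := hγ N μ hμ P₀ hP₀ ε S a A D hε hεs hS K hKm hK q t (t ^ 2 / 4) hq ht ht2
        (by positivity) (by nlinarith) (by linarith)
      have h2 : ENNReal.ofReal (1 / t ^ (n + 2)) *
          ∫⁻ u in closedBall q (27 * t), ENNReal.ofReal (D u + t ^ 2 / 4) ∂μHE[n] ≤
          ENNReal.ofReal (ω * 27 ^ n / 4) + G q t := by
        rw [← lintegral_const_mul' _ _ ENNReal.ofReal_ne_top]
        have e1 : ∀ u, ENNReal.ofReal (1 / t ^ (n + 2)) * ENNReal.ofReal (D u + t ^ 2 / 4) =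
            ENNReal.ofReal (1 / (4 * t ^ n)) + ENNReal.ofReal (D u / t ^ (n + 2)) := fun u => by
          have := hS.dist_nonneg u
          rw [← ENNReal.ofReal_mul (by positivity),
            ← ENNReal.ofReal_add (by positivity) (by positivity)]
          congr 1
          rw [pow_add]
          field_simp
          ring
        simp_rw [e1]
        rw [lintegral_add_left measurable_const, setLIntegral_const,
          hausdorffMeasure_closedBall hn hP₀ _ (by positivity),
          ← ENNReal.ofReal_mul (by positivity)]
        refine add_le_add (le_of_eq ?_) ?_
        · congr 1
          rw [mul_pow, ← hωdef]
          field_simp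
        · calc _ ≤ ∫⁻ u in closedBall q (27 * t), (if ‖u - q‖ ≤ 27 * t ∧ D u ≤ 127 * t then
                ENNReal.ofReal (D u / t ^ (n + 2)) else 0) ∂μHE[n] := by
                refine setLIntegral_mono' isClosed_closedBall.measurableSet fun u hu => ?_
                rw [mem_closedBall, dist_eq_norm] at hu
                have := hS.dist_le_add u q
                rw [if_pos ⟨hu, by linarith⟩]
            _ ≤ _ := by
                refine lintegral_mono_set (closedBall_subset_closedBall' ?_)
                rw [dist_zero_right]
                linarith
      have h3 : ENNReal.ofReal (1 / t ^ (n + 1)) *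
          ∫⁻ y in scaleSet n P₀ h q t, (K y : ℝ≥0∞) ^ p ∂(Measure.pi fun _ => μ) = H q t := by
        rw [setLIntegral_congr_fun_ae (isClosed_scaleSet n P₀ h q t).measurableSet
          (hKp.ae_eq_mk.mono fun y hy _ => hy),
          ← lintegral_indicator (isClosed_scaleSet n P₀ h q t).measurableSet,
          ← lintegral_const_mul' _ _ ENNReal.ofReal_ne_top]
        refine lintegral_congr fun y => ?_
        rw [indicator_apply]
        split_ifs
        · rfl
        · simp
      calc _ ≤ _ := ENNReal.div_le_div_right h1 _
        _ = ENNReal.ofReal (C₂ * ε ^ p) * (ENNReal.ofReal (1 / t ^ (n + 2)) *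
              ∫⁻ u in closedBall q (27 * t), ENNReal.ofReal (D u + t ^ 2 / 4) ∂μHE[n]) +
            ENNReal.ofReal C₂ * (ENNReal.ofReal (1 / t ^ (n + 1)) *
              ∫⁻ y in scaleSet n P₀ h q t, (K y : ℝ≥0∞) ^ p ∂(Measure.pi fun _ => μ)) := by
            rw [ENNReal.div_eq_inv_mul, ← ENNReal.ofReal_inv_of_pos ht, mul_add, ← mul_assoc,
              ← mul_assoc, ← mul_assoc, ← mul_assoc, ← ENNReal.ofReal_mul (by positivity),
              ← ENNReal.ofReal_mul (by positivity), ← ENNReal.ofReal_mul (by positivity),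
              ← ENNReal.ofReal_mul (by positivity)]
            congr 3
            · rw [pow_add, pow_add]
              field_simp
            · rw [pow_add]
              field_simp
        _ ≤ ENNReal.ofReal (C₂ * ε ^ p) * (ENNReal.ofReal (ω * 27 ^ n / 4) + G q t) +
            ENNReal.ofReal C₂ * H q t := by
            rw [h3]
            gcongr
        _ = _ := by
            rw [mul_add, ← ENNReal.ofReal_mul (by positivity), add_assoc]
            congr 2
            ring
  have hB10 : (μHE[n] : Measure P₀) (closedBall 0 10) = ENNReal.ofReal (ω * 10 ^ n) :=
    hausdorffMeasure_closedBall hn hP₀ _ (by norm_num)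
  have hin : ∀ q ∈ closedBall (0 : P₀) 10, ∫⁻ t in Ioo (0 : ℝ) 2,
      gammaFun n A q t ^ p / ENNReal.ofReal t ≤
      ENNReal.ofReal ((J * ω) ^ p / 100 * ε ^ p + C₂ * (ω * 27 ^ n / 4) * ε ^ p * 2) +
      (ENNReal.ofReal (C₂ * ε ^ p) * (∫⁻ t in Ioo (0 : ℝ) 2, G q t) +
        ENNReal.ofReal C₂ * ∫⁻ t in Ioo (0 : ℝ) 2, H q t) := by
    intro q hq
    refine (setLIntegral_mono' measurableSet_Ioo (hpt q hq)).trans ?_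
    have hGq : Measurable (G q) := hGm.comp (f := fun t : ℝ => (q, t)) (by fun_prop)
    rw [lintegral_add_left (measurable_const.indicator measurableSet_Ioc),
      lintegral_add_left measurable_const, lintegral_add_left (hGq.const_mul _),
      lintegral_const_mul' _ _ ENNReal.ofReal_ne_top,
      lintegral_const_mul' _ _ ENNReal.ofReal_ne_top, ← add_assoc]
    refine add_le_add_left ?_ _
    rw [ENNReal.ofReal_add (by positivity) (by positivity)]
    refine add_le_add ?_ (le_of_eq ?_)
    · refine (setLIntegral_le_lintegral _ _).trans ?_
      rw [lintegral_indicator measurableSet_Ioc, setLIntegral_const, Real.volume_Ioc, sub_zero]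
      have h0 := hS.dist_nonneg q
      rw [← ENNReal.ofReal_mul (by positivity)]
      refine ENNReal.ofReal_le_ofReal ?_
      rcases h0.eq_or_lt with h0 | h0
      · rw [← h0]
        simp only [div_zero, zero_div, mul_zero]
        positivity
      · refine le_of_eq ?_
        field_simp
    · rw [setLIntegral_const, Real.volume_Ioo, ← ENNReal.ofReal_mul (by positivity), sub_zero]
  calc _ ≤ _ := setLIntegral_mono' isClosed_closedBall.measurableSet hin
    _ = ENNReal.ofReal ((J * ω) ^ p / 100 * ε ^ p + C₂ * (ω * 27 ^ n / 4) * ε ^ p * 2) *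
          ENNReal.ofReal (ω * 10 ^ n) +
        (ENNReal.ofReal (C₂ * ε ^ p) *
            (∫⁻ q in closedBall (0 : P₀) 10, ∫⁻ t in Ioo (0 : ℝ) 2, G q t ∂volume ∂μHE[n]) +
          ENNReal.ofReal C₂ *
            ∫⁻ q in closedBall (0 : P₀) 10, ∫⁻ t in Ioo (0 : ℝ) 2, H q t ∂volume ∂μHE[n]) := by
        rw [lintegral_add_left measurable_const,
          lintegral_add_left (hGm.lintegral_prod_right'.const_mul _),
          lintegral_const_mul' _ _ ENNReal.ofReal_ne_top,
          lintegral_const_mul' _ _ ENNReal.ofReal_ne_top, setLIntegral_const, hB10]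
    _ ≤ ENNReal.ofReal ((J * ω) ^ p / 100 * ε ^ p + C₂ * (ω * 27 ^ n / 4) * ε ^ p * 2) *
          ENNReal.ofReal (ω * 10 ^ n) +
        (ENNReal.ofReal (C₂ * ε ^ p) * ENNReal.ofReal (ω * 27 ^ n * 128 * (ω * 64 ^ n)) +
          ENNReal.ofReal C₂ * (ENNReal.ofReal (ω * 200 ^ n * (200 / h)) *
            mengerCurvature n p K μ)) := by
        rw [← hFeq]
        gcongr
        · exact lintegral_dist_le hn hP₀ hDc hS.dist_nonneg
        · exact lintegral_scaleSet_le hn hP₀ hh _ hFm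
    _ = ENNReal.ofReal (E₁ * ε ^ p) + ENNReal.ofReal E₂ * mengerCurvature n p K μ := by
        rw [← add_assoc, ← ENNReal.ofReal_mul (by positivity), ← ENNReal.ofReal_mul (by positivity),
          ← ENNReal.ofReal_add (by positivity) (by positivity), ← mul_assoc (ENNReal.ofReal C₂),
          ← ENNReal.ofReal_mul hC₂.le]
        congr 2
        rw [hE₁]
        ring
    _ ≤ _ := by
        gcongr
        · exact le_max_left _ _
        · exact le_max_right _ _

end MengerGraph

theorem mainTheorem6 :
    ∃ k₁ : ℝ, 4 ≤ k₁ ∧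
    ∀ n : ℕ, 1 ≤ n →
    ∃ α₁ b₁ : ℝ, 0 < α₁ ∧ 0 < b₁ ∧
    ∀ N : ℕ, n < N → ∀ C₀ : ℝ, 10 ≤ C₀ → ∀ b : ℝ, b₁ ≤ b →
    ∃ ε₁ : ℝ → ℝ, (∀ α : ℝ, 0 < α → α ≤ α₁ → 0 < ε₁ α) ∧
    ∀ p : ℝ, 1 < p → ∀ K : (Fin (n + 2) → Euc N) → ℝ≥0, ∀ k : ℝ, k₁ ≤ k →
    ∃ C C' : ℝ, 0 < C ∧ 0 < C' ∧
    ∀ (α η : ℝ) (P₀ : Submodule ℝ (Euc N)) (μ : Measure (Euc N))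
      (e : OrthonormalBasis (Fin n) ℝ P₀),
      0 < α → α ≤ α₁ → 0 < η → η ≤ ε₁ α ^ p → IsSetting n p K C₀ k η P₀ μ →
    ∀ ε : ℝ, η ^ (1 / p) ≤ ε → ε ≤ ε₁ α →
      Nonempty (Choices k α ε b μ e) ∧
      ∀ c : Choices k α ε b μ e,
        ∫⁻ q in closedBall (0 : P₀) 10, ∫⁻ t in Ioo (0 : ℝ) 2,
            gammaFun n c.A q t ^ p / ENNReal.ofReal t ∂volume ∂μHE[n] ≤
          ENNReal.ofReal (C * ε ^ p) + ENNReal.ofReal C * mengerCurvature n p K μ ∧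
        ENNReal.ofReal (C * ε ^ p) + ENNReal.ofReal C * mengerCurvature n p K μ ≤
          ENNReal.ofReal (C' * ε ^ p) := by
  -- `k ≥ 4` makes the balls `B(x, k t)` large enough to compare neighbouring scales
  refine ⟨4, le_rfl, fun n hn => ?_⟩
  obtain ⟨b₁, hb₁, hbump⟩ := exists_bump hn
  -- planes at an angle of at most `1 / 4` to `P₀` are graphs of slope at most `1`; the bound for
  -- `ε` does not depend on `α`
  refine ⟨1 / 4, b₁, by norm_num, hb₁, fun N hnN C₀ hC₀ b hb => ?_⟩
  have hb0 : 0 < b := hb₁.trans_le hb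
  have hC₁ : 0 < C₀ * 2 ^ n := by positivity
  have hlam : 0 < deltaConst N n / 2 := by
    have := deltaConst_pos N n
    positivity
  obtain ⟨M, ε₂, hM, hε₂, hflat⟩ := exists_flatSystem_const n hC₁.le hlam
  have hJ : 0 ≤ jetConst n b M := jetConst_nonneg n hb0.le hM.le
  obtain ⟨ε₃, hε₃, hint⟩ := exists_integral_const n hn hC₁ hlam
    (by positivity : 0 ≤ M * 207 ^ 6) hJ
  refine ⟨fun _ => min 1 (min ε₂ ε₃), fun _ _ _ => by positivity, fun p hp K k hk => ?_⟩
  have hp0 : 0 < p := by linarith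
  -- the constants are chosen before the measure; if `K` has no lower bound, there is no setting
  obtain ⟨C, hC, hbound⟩ : ∃ C : ℝ, 0 < C ∧ ∀ (η : ℝ) (P₀ : Submodule ℝ (Euc N))
      (μ : Measure (Euc N)), IsSetting n p K C₀ k η P₀ μ → ∀ ε S a A D, 0 < ε → ε ≤ ε₃ →
      GraphSystem n P₀ μ (deltaConst N n / 2) ε (M * 207 ^ 6) S a A D → Continuous D →
      (∀ (q : P₀) (t : ℝ), ‖q‖ ≤ 10 → 0 < t → t < 2 → t ≤ D q / 100 →
        ∃ f : P₀ →ᵃ[ℝ] P₀ᗮ, ∀ u ∈ closedBall q t,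
          ‖A u - f u‖ ≤ jetConst n b M * ε * D q * (t / D q) ^ 2) →
      ∫⁻ q in closedBall (0 : P₀) 10, ∫⁻ t in Ioo (0 : ℝ) 2,
          gammaFun n A q t ^ p / ENNReal.ofReal t ∂volume ∂μHE[n] ≤
        ENNReal.ofReal (C * ε ^ p) + ENNReal.ofReal C * mengerCurvature n p K μ := by
    by_cases hK : ∃ c l : ℝ, 1 ≤ c ∧ 1 ≤ l ∧ HasLowerBound n p K c l
    · obtain ⟨c, l, hc, hl, hlow⟩ := hK
      obtain ⟨C, hC, hbound⟩ := hint p c l hp hc hl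
      refine ⟨C, hC, fun η P₀ μ h ε S a A D hε hε3 hS hD hsmall => ?_⟩
      have := h.isFiniteMeasure
      exact hbound N μ (h.measure_closedBall_le (by linarith)) P₀ h.finrank_eq ε S a A D hε hε3 hS
        hD hsmall K h.proper.aemeasurable hlow
    · exact ⟨1, one_pos, fun η P₀ μ h => absurd h.proper.lower_bound hK⟩
  refine ⟨C, 2 * C, hC, by positivity, ?_⟩
  intro α η P₀ μ e hα hα1 hη _ h ε hηε hε1
  have hε : 0 < ε := (Real.rpow_pos_of_pos hη _).trans_le hηε
  have hηp : η ≤ ε ^ p := by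
    rwa [one_div, Real.rpow_inv_le_iff_of_pos hη.le hε.le hp0] at hηε
  have hε_one : ε ≤ 1 := hε1.trans (min_le_left _ _)
  have hε_flat : ε ≤ ε₂ := hε1.trans ((min_le_right _ _).trans (min_le_left _ _))
  have hε_int : ε ≤ ε₃ := hε1.trans ((min_le_right _ _).trans (min_le_right _ _))
  have hηε' : η ≤ ε := by
    refine hηp.trans ?_
    calc ε ^ p ≤ ε ^ (1 : ℝ) := Real.rpow_le_rpow_of_exponent_ge hε hε_one hp.le
      _ = ε := Real.rpow_one ε
  have := h.isFiniteMeasure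
  refine ⟨nonempty_choices h hn hnN hk hα hε hηε' hb (hbump N P₀ e), fun c => ⟨?_, ?_⟩⟩
  · obtain ⟨a, hS, ha⟩ := h.exists_flatSystem hk hα hα1 hε hηε' c.plane_good
    obtain ⟨hvert, hlip, hchain⟩ := hflat N μ (h.measure_closedBall_le (by linarith)) P₀
      h.finrank_eq ε _ a hε hε_flat hS
    obtain ⟨x, hx⟩ := h.exists_mem_goodBalls hk hα hε hηε'
    have hne : (goodBalls n k α ε P₀ μ).Nonempty := ⟨_, hx⟩
    refine hbound η P₀ μ h ε (goodBalls n k α ε P₀ μ) a c.A (DFun n k α ε P₀ μ) hε hε_int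
      { hS with
        lip := hlip
        approx := fun x t L u hx hL hu hux =>
          (c.norm_A_sub_le h hn hnN hk hα hε hηε' ha hvert hchain hx hL hu hux).trans
            (le_of_eq (by ring))
        dist_nonneg := DFun_nonneg
        dist_le := fun u hu => (h.DFun_le_of_norm_le hk hα hε hηε' u).trans (by linarith)
        dist_le_add := DFun_le_add hne
        exists_of_dist_lt := fun u r hr => exists_of_DFun_lt hne hr }
      (continuous_DFun hne) fun q t hq ht ht2 htD =>
        c.exists_affine_near h hn hnN hk hα hε hηε' hb0 ha hM hchain hq ht ht2 htD
  · calc _ ≤ ENNReal.ofReal (C * ε ^ p) + ENNReal.ofReal C * ENNReal.ofReal (ε ^ p) := by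
          gcongr
          exact h.curvature_le.trans (ENNReal.ofReal_le_ofReal hηp)
      _ = _ := by
          rw [← ENNReal.ofReal_mul hC.le, ← ENNReal.ofReal_add (by positivity) (by positivity)]
          congr 1
          ring
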